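/- Let $M$ be a connected, non-compact smooth $n$-manifold (without boundary, Hausdorff, second countable) with a Finsler metric $F:TM\to[0,\infty)$, i.e. $F$ is smooth and positive off the zero section, $F(x,cv)=cF(x,v)$ for $c\ge 0$, and $g_v(w,w)=\tfrac12\frac{d^2}{dt^2}\big|_{t=0}F^2(x,v+tw)>0$ for all nonzero $v,w\in T_xM$. Geodesics are the nonconstant solutions of the Euler–Lagrange equation of $\tfrac12F^2$ (equivalently, the projections of the integral curves of the geodesic spray). Assume that $F$ is absolutely homogeneous, $F(x,cv)=|c|F(x,v)$ for all $c\in\mathbb R$, and complete, i.e. every geodesic $[a,b)\to M$ extends to a geodesic $[a,\infty)\to M$. A Finslerian volume in dimension $n$ is a rule $\sigma$ that assigns a number $\sigma(N)>0$ to each absolutely homogeneous Minkowski norm $N$ on $\mathbb R^n$ (smooth off $0$, strongly convex), such that $\sigma(N\circ A)=|\det A|\,\sigma(N)$ for $A\in GL_n(\mathbb R)$, $\sigma(|\cdot|)=1$ for the Euclidean norm, and $\sigma(N_1)\le\sigma(N_2)$ whenever $N_1\le N_2$ (the Busemann–Hausdorff and Holmes–Thompson volumes are examples). The associated volume measure $\mu$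 on $(M,F)$ is given in local coordinates by $d\mu=\sigma(F(x,\cdot))\,dx^1\cdots dx^n$. If, for some Finslerian volume, the volume measure satisfies $\mu(M)<\infty$, then every convex function $f:M\to\mathbb R$, i.e. every function such that $f\circ\gamma:[a,b]\to\mathbb R$ is convex for each geodesic $\gamma:[a,b]\to M$, is constant. -/

import Mathlib

open scoped Manifold ContDiff

noncomputable section

/-- A Finsler metric on a smooth `n`-manifold `M`: a function `F` on the tangent bundle, smooth off
the zero section, positive off the zero section, positively homogeneous on each fibre, and such
that the fundamental tensor `g_v(w, w) = (1/2) (d²/dt²) F²(v + t w) |_{t = 0}` is positive definite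
at every nonzero vector `v`. -/
structure FinslerMetric (n : ℕ) (M : Type*) [TopologicalSpace M]
    [ChartedSpace (EuclideanSpace ℝ (Fin n)) M] [IsManifold (𝓡 n) ∞ M] where
  toFun : TangentBundle (𝓡 n) M → ℝ
  smooth : ContMDiffOn (𝓡 n).tangent 𝓘(ℝ, ℝ) ∞ toFun {p | p.2 ≠ 0}
  pos : ∀ (x : M) (v : TangentSpace (𝓡 n) x), v ≠ 0 → 0 < toFun ⟨x, v⟩
  homogeneous : ∀ (x : M) (v : TangentSpace (𝓡 n) x) (c : ℝ), 0 ≤ c →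
    toFun ⟨x, c • v⟩ = c * toFun ⟨x, v⟩
  stronglyConvex : ∀ (x : M) (v w : TangentSpace (𝓡 n) x), v ≠ 0 → w ≠ 0 →
    0 < (1 / 2) * iteratedDeriv 2 (fun t : ℝ => toFun ⟨x, v + t • w⟩ ^ 2) 0

namespace FinslerMetric

variable {n : ℕ} {M : Type*} [TopologicalSpace M]
  [ChartedSpace (EuclideanSpace ℝ (Fin n)) M] [IsManifold (𝓡 n) ∞ M]

/-- Absolute homogeneity (reversibility): `F(x, c v) = |c| F(x, v)` for all real `c`. -/
def IsAbsolutelyHomogeneous (F : FinslerMetric n M) : Prop :=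
  ∀ (x : M) (v : TangentSpace (𝓡 n) x) (c : ℝ), F.toFun ⟨x, c • v⟩ = |c| * F.toFun ⟨x, v⟩

/-- The coordinate expression `F(x, y) = F(x¹, …, xⁿ, y¹, …, yⁿ)` of the metric in a chart `φ`:
`x` is a point of the target of `φ` and `y` stands for the tangent vector `yⁱ ∂/∂xⁱ`. -/
def inChart (F : FinslerMetric n M) (φ : OpenPartialHomeomorph M (EuclideanSpace ℝ (Fin n)))
    (x y : EuclideanSpace ℝ (Fin n)) : ℝ :=
  F.toFun ⟨φ.symm x, mfderiv (𝓡 n) (𝓡 n) φ.symm x y⟩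

/-- The Lagrangian (energy density) `L = F² / 2` in a chart. -/
def lagrangian (F : FinslerMetric n M) (φ : OpenPartialHomeomorph M (EuclideanSpace ℝ (Fin n)))
    (x y : EuclideanSpace ℝ (Fin n)) : ℝ :=
  F.inChart φ x y ^ 2 / 2

/-- `γ` is a (constant speed, nonconstant) geodesic of `F` on the interval `s`: it is continuous
on `s` and, in each chart, it is differentiable with nonzero velocity and satisfies the
Euler–Lagrange equation `d/dt (∂L/∂y) (γ, γ') = (∂L/∂x) (γ, γ')` of `L = F² / 2`, that is,
the equation `γ''ⁱ + 2 Gⁱ(γ, γ') = 0` of the geodesic spray of `F`.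
(Derivatives at the end points of `s` are one-sided.) -/
def IsGeodesicOn (F : FinslerMetric n M) (γ : ℝ → M) (s : Set ℝ) : Prop :=
  ContinuousOn γ s ∧
  ∀ φ ∈ atlas (EuclideanSpace ℝ (Fin n)) M, ∀ t ∈ s, γ t ∈ φ.source →
    DifferentiableWithinAt ℝ (φ ∘ γ) s t ∧
    derivWithin (φ ∘ γ) s t ≠ 0 ∧
    HasDerivWithinAt
      (fun r => fderiv ℝ (fun y => F.lagrangian φ (φ (γ r)) y) (derivWithin (φ ∘ γ) s r))
      (fderiv ℝ (fun x => F.lagrangian φ x (derivWithin (φ ∘ γ) s t)) (φ (γ t))) s t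

/-- (Forward) completeness: each geodesic `γ : [a, b) → M` extends to a geodesic on `[a, ∞)`. -/
def IsComplete (F : FinslerMetric n M) : Prop :=
  ∀ (γ : ℝ → M) (a b : ℝ), a < b → F.IsGeodesicOn γ (Set.Ico a b) →
    ∃ γ' : ℝ → M, F.IsGeodesicOn γ' (Set.Ici a) ∧ Set.EqOn γ' γ (Set.Ico a b)

/-- `f` is convex on `(M, F)`: its restriction to each geodesic `γ : [a, b] → M` is convex. -/
def IsConvex (F : FinslerMetric n M) (f : M → ℝ) : Prop :=
  ∀ (γ : ℝ → M) (a b : ℝ), a < b → F.IsGeodesicOn γ (Set.Icc a b) →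
    ConvexOn ℝ (Set.Icc a b) (f ∘ γ)

end FinslerMetric

/-- Absolutely homogeneous Minkowski norms on `ℝⁿ`: the norms that an absolutely homogeneous
Finsler metric induces on the tangent spaces, read in coordinates. -/
structure IsMinkowskiNorm {n : ℕ} (N : EuclideanSpace ℝ (Fin n) → ℝ) : Prop where
  smooth : ContDiffOn ℝ ∞ N {0}ᶜ
  pos : ∀ v, v ≠ 0 → 0 < N v
  homogeneous : ∀ (c : ℝ) v, N (c • v) = |c| * N v
  stronglyConvex : ∀ v w, v ≠ 0 → w ≠ 0 →
    0 < (1 / 2) * iteratedDeriv 2 (fun t : ℝ => N (v + t • w) ^ 2) 0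

/-- A Finslerian volume in dimension `n` (for absolutely homogeneous metrics): a rule assigning to
each absolutely homogeneous Minkowski norm `N` on `ℝⁿ` a positive density `σ(N)` with respect to
Lebesgue measure, such that the rule is independent of the choice of linear coordinates,
gives Lebesgue measure on Euclidean space, and is monotone with the metric.
The Busemann–Hausdorff and the Holmes–Thompson volumes are examples. -/
structure FinslerVolume (n : ℕ) where
  density : (EuclideanSpace ℝ (Fin n) → ℝ) → ℝ
  pos : ∀ N, IsMinkowskiNorm N → 0 < density N
  covariant : ∀ N, IsMinkowskiNorm N →
    ∀ A : EuclideanSpace ℝ (Fin n) ≃ₗ[ℝ] EuclideanSpace ℝ (Fin n),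
      density (fun v => N (A v)) =
        |LinearMap.det (A : EuclideanSpace ℝ (Fin n) →ₗ[ℝ] EuclideanSpace ℝ (Fin n))| * density N
  euclidean : density (fun v => ‖v‖) = 1
  monotone : ∀ N₁ N₂, IsMinkowskiNorm N₁ → IsMinkowskiNorm N₂ → (∀ v, N₁ v ≤ N₂ v) →
    density N₁ ≤ density N₂

/-- `μ` is the volume measure of `(M, F)` for the Finslerian volume `V`: in each chart,
`dμ = σ(x) dx¹ ⋯ dxⁿ`, where `σ(x)` is the density that `V` assigns to the norm `F(x, ·)`. -/
def FinslerVolume.IsVolumeMeasure {n : ℕ} {M : Type*} [TopologicalSpace M]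
    [ChartedSpace (EuclideanSpace ℝ (Fin n)) M] [IsManifold (𝓡 n) ∞ M] [MeasurableSpace M]
    (V : FinslerVolume n) (F : FinslerMetric n M) (μ : MeasureTheory.Measure M) : Prop :=
  ∀ φ ∈ atlas (EuclideanSpace ℝ (Fin n)) M, ∀ A : Set M, MeasurableSet A → A ⊆ φ.source →
    μ A = ∫⁻ x in φ '' A, ENNReal.ofReal (V.density (F.inChart φ x))

end

noncomputable section

open Set Filter Topology MeasureTheory Metric InnerProductSpace
open scoped Manifold ContDiff NNReal ENNReal Pointwise Function

set_option linter.unusedSectionVars false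

/-! The argument is a recurrence argument for the geodesic flow. Suppose that `f` is not locally
constant at `q`. Short geodesics from `q` reach every nearby point, so `f` changes along one of
them; since geodesics can be reversed and `f` is convex along them, one may choose the direction in
which `f` increases. As `f` is continuous, there is an open set `W` of initial states of energy at
most 1/2 whose geodesics start with `f` within δ/2 of `f q` and satisfy f(γ(1)) ≥ f(γ(0)) + δ.
Completeness lets these geodesics run forever, and convexity keeps f(γ(m)) ≥ f(γ(0)) + δ for all
integers m ≥ 1. Hence γ(m) is never a footpoint of `W`: the set `W` wanders
(`IsConvex.eventually_eq`).

In canonical coordinates (x, p) the geodesic flow is Hamiltonian, so it preserves the volume dx dp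
and the energy. The images of `W` at times 0, 1, 2, ... are therefore disjoint, have the same
positive volume, and stay in the bundle of polars of the unit balls of F. By
`FinslerVolume.exists_volume_polar_le` each polar has volume at most C σ(F(x, ·)), with C depending
only on the Finslerian volume, so this bundle has volume at most C μ(M). Infinitely many disjoint
copies of `W` force μ(M) = ∞ (`volumeMeasure_univ_eq_top_of_wandering`). Thus finite volume makes
`f` locally constant, and connectedness makes it constant.

Two analytic points carry most of the length. First, F² need not be smooth at zero velocity.
Homogeneity of degree two nevertheless makes the spray Lipschitz there, with a constant that shrinks
with the velocity (`exists_norm_spray_sub_le`); this gives an exponential map that is strictly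
differentiable at the zero vector, which is all that is used (`IsLagrangian.exists_exponential`).
Secondly, convexity along geodesics must be shown to imply continuity. Repeated geodesic coning
produces open sets on which `f` is bounded above, a geodesic reflection moves the bound to the given
point, and the usual one-variable inequalities finish (`continuousAt_of_geodesic_convex`).

Phase space is handled chart by chart: a state is a pair (x, p), chart changes act by
volume-preserving cotangent lifts, and the flow up to a given time is obtained by composing short
flows inside charts with chart changes (`HasPhaseTransport`). -/

/-! ### Local flows of Lipschitz vector fields. -/

/-- A locally Lipschitz vector field has a local flow which is uniformly Lipschitz in the initial
point and stays in a given neighbourhood. -/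
theorem exists_local_flow_of_lipschitzOnWith {Z : Type*} [NormedAddCommGroup Z] [NormedSpace ℝ Z]
    [CompleteSpace Z] {f : Z → Z} {z₀ : Z} {K : ℝ≥0} {s : Set Z} (hs : s ∈ 𝓝 z₀)
    (hf : LipschitzOnWith K f s) :
    ∃ r > (0 : ℝ), ∃ ε > (0 : ℝ), ∃ (L : ℝ≥0) (α : Z → ℝ → Z), closedBall z₀ r ⊆ s ∧
      (∀ z ∈ closedBall z₀ r, α z 0 = z ∧ ∀ t ∈ Icc (-ε) ε,
        HasDerivWithinAt (α z) (f (α z t)) (Icc (-ε) ε) t ∧ α z t ∈ s) ∧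
      ∀ t ∈ Icc (-ε) ε, LipschitzOnWith L (α · t) (closedBall z₀ r) := by
  obtain ⟨a, ha, has⟩ := Metric.nhds_basis_closedBall.mem_iff.1 hs
  have ha : 0 < a := ha
  set B : ℝ := K * a + ‖f z₀‖ + 1 with hB
  have hB0 : 0 < B := by positivity
  have hb : ∀ x ∈ closedBall z₀ a, ‖f x‖ ≤ B := by
    intro x hx
    have h1 := hf.norm_sub_le (has hx) (mem_of_mem_nhds hs)
    have h2 : ‖f x‖ ≤ ‖f x - f z₀‖ + ‖f z₀‖ := norm_le_norm_sub_add _ _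
    have h3 : (K : ℝ) * ‖x - z₀‖ ≤ K * a := by
      gcongr
      exact mem_closedBall_iff_norm.1 hx
    linarith
  -- Speed at most B for time ε₀ covers a/2, so orbits starting in the ball of radius a/2 stay in
  -- the ball of radius a: this is the Picard–Lindelöf condition.
  set ε₀ : ℝ := a / (2 * B) with hε₀
  have hε₀0 : 0 < ε₀ := by positivity
  have hpl : IsPicardLindelof (fun _ => f) (tmin := -ε₀) (tmax := ε₀)
      ⟨0, by simp [hε₀0.le]⟩ z₀ (.mk a ha.le) (.mk (a / 2) (half_pos ha).le)
      (.mk B hB0.le) K := by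
    refine IsPicardLindelof.of_time_independent hb (hf.mono has) ?_
    simp only [NNReal.coe_mk, sub_zero, zero_sub, neg_neg, max_self, hε₀]
    apply le_of_eq
    field_simp
    norm_num
  obtain ⟨α, hα, L, hL⟩ := hpl.exists_forall_mem_closedBall_eq_hasDerivWithinAt_lipschitzOnWith
  simp only [NNReal.coe_mk] at hα hL
  have hz₀ : z₀ ∈ closedBall z₀ (a / 2) := mem_closedBall_self (half_pos ha).le
  have hcont : ContinuousWithinAt (α z₀) (Icc (-ε₀) ε₀) 0 :=
    ((hα z₀ hz₀).2 0 ⟨by linarith, hε₀0.le⟩).continuousWithinAt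
  have hcont : ContinuousAt (α z₀) 0 := hcont.continuousAt (Icc_mem_nhds (by linarith) hε₀0)
  have h1 : ∀ᶠ t in 𝓝 (0 : ℝ), dist (α z₀ t) (α z₀ 0) < a / 2 :=
    (Metric.tendsto_nhds.1 hcont.tendsto) _ (half_pos ha)
  obtain ⟨ε₁, hε₁, h1⟩ := Metric.eventually_nhds_iff_ball.1 h1
  set ε := min ε₀ (ε₁ / 2) with hε
  have hε0 : 0 < ε := lt_min hε₀0 (half_pos hε₁)
  -- The central orbit moves less than a/2 up to time ε, and by the Lipschitz bound orbits starting
  -- within r of `z₀` stay within a/2 of it; together they stay in the ball of radius a.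
  set r := min (a / 2) (a / (2 * (L + 1))) with hr
  have hr0 : 0 < r := by positivity
  have hsub : Icc (-ε) ε ⊆ Icc (-ε₀) ε₀ :=
    Icc_subset_Icc (neg_le_neg (min_le_left _ _)) (min_le_left _ _)
  have hball : closedBall z₀ r ⊆ closedBall z₀ (a / 2) :=
    closedBall_subset_closedBall (min_le_left _ _)
  refine ⟨r, hr0, ε, hε0, L, α, (hball.trans (closedBall_subset_closedBall (by linarith))).trans has,
    fun z hz => ⟨(hα z (hball hz)).1, fun t ht =>
      ⟨((hα z (hball hz)).2 t (hsub ht)).mono hsub, has ?_⟩⟩, fun t ht => (hL t (hsub ht)).mono hball⟩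
  have h2 := (hL t (hsub ht)).dist_le_mul z (hball hz) z₀ hz₀
  have h3 := h1 t (by
    rw [mem_ball, Real.dist_eq, sub_zero, abs_lt]
    have := min_le_right ε₀ (ε₁ / 2)
    exact ⟨by linarith [ht.1], by linarith [ht.2]⟩)
  rw [(hα z₀ hz₀).1] at h3
  have h4 : (L : ℝ) * dist z z₀ ≤ a / 2 := by
    have : dist z z₀ ≤ a / (2 * (L + 1)) := (mem_closedBall.1 hz).trans (min_le_right _ _)
    calc (L : ℝ) * dist z z₀ ≤ (L + 1) * (a / (2 * (L + 1))) := by gcongr; linarith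
      _ = a / 2 := by field_simp
  rw [mem_closedBall]
  linarith [dist_triangle (α z t) (α z₀ t) z₀]

/-- Second order Taylor estimate on a convex set where the derivative is Lipschitz. -/
theorem Convex.norm_sub_sub_fderiv_le {Z : Type*} [NormedAddCommGroup Z] [NormedSpace ℝ Z]
    {f : Z → Z} {V : Set Z} (hV : Convex ℝ V) {K : ℝ≥0}
    (hd : ∀ z ∈ V, DifferentiableAt ℝ f z) (hK : LipschitzOnWith K (fderiv ℝ f) V)
    {a b : Z} (ha : a ∈ V) (hb : b ∈ V) :
    ‖f b - f a - fderiv ℝ f a (b - a)‖ ≤ K * ‖b - a‖ ^ 2 := by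
  have hsub : segment ℝ a b ⊆ V := hV.segment_subset ha hb
  have := (convex_segment a b).norm_image_sub_le_of_norm_hasFDerivWithin_le'
    (f := f) (f' := fderiv ℝ f) (φ := fderiv ℝ f a) (C := K * ‖b - a‖)
    (fun x hx => (hd x (hsub hx)).hasFDerivAt.hasFDerivWithinAt)
    (fun x hx => by
      refine (hK.norm_sub_le (hsub hx) ha).trans ?_
      gcongr
      exact norm_sub_le_of_mem_segment hx)
    (left_mem_segment ℝ a b) (right_mem_segment ℝ a b)
  calc _ ≤ _ := this
    _ = _ := by ring

/-! ### Differentiability of flows and Liouville's theorem. -/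

section Liouville

variable {Z : Type*} [NormedAddCommGroup Z] [NormedSpace ℝ Z] [FiniteDimensional ℝ Z]

theorem ContinuousLinearMap.differentiable_det :
    Differentiable ℝ (fun A : Z →L[ℝ] Z => A.det) := by
  let b := Module.finBasis ℝ Z
  have h : (fun A : Z →L[ℝ] Z => A.det) = fun A : Z →L[ℝ] Z =>
      ∑ σ : Equiv.Perm (Fin (Module.finrank ℝ Z)), (Equiv.Perm.sign σ : ℤ) •
        ∏ i, b.repr (A (b i)) (σ i) := by
    ext A
    rw [ContinuousLinearMap.det, ← LinearMap.det_toMatrix b, Matrix.det_apply]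
    simp [LinearMap.toMatrix_apply, Units.smul_def]
  rw [h]
  have h1 : ∀ i j, Differentiable ℝ (fun A : Z →L[ℝ] Z => b.repr (A (b i)) j) := by
    intro i j
    have : (fun A : Z →L[ℝ] Z => b.repr (A (b i)) j) =
        fun A : Z →L[ℝ] Z => (LinearMap.toContinuousLinearMap (b.coord j)) (A (b i)) := rfl
    rw [this]
    fun_prop
  fun_prop

/-- Jacobi's formula: det(D + tAD) = det(1 + tA) det D, and the linear coefficient of det(1 + tA) is
the trace of A. -/
theorem ContinuousLinearMap.fderiv_det_comp (A D : Z →L[ℝ] Z) :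
    fderiv ℝ (fun A : Z →L[ℝ] Z => A.det) D (A ∘L D) = LinearMap.trace ℝ Z A * D.det := by
  have h1 : HasDerivAt (fun t : ℝ => (D + t • (A ∘L D)).det)
      (fderiv ℝ (fun A : Z →L[ℝ] Z => A.det) D (A ∘L D)) 0 := by
    have h2 : HasDerivAt (fun t : ℝ => D + t • (A ∘L D)) (A ∘L D) 0 := by
      simpa using ((hasDerivAt_id (0 : ℝ)).smul_const (A ∘L D)).const_add D
    have h3 : HasFDerivAt (fun A : Z →L[ℝ] Z => A.det)
        (fderiv ℝ (fun A : Z →L[ℝ] Z => A.det) D) (D + (0 : ℝ) • (A ∘L D)) := by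
      simpa using (ContinuousLinearMap.differentiable_det D).hasFDerivAt
    exact h3.comp_hasDerivAt 0 h2
  let b := Module.finBasis ℝ Z
  have h4 : (fun t : ℝ => (D + t • (A ∘L D)).det) = fun t : ℝ =>
      (1 + (LinearMap.toMatrix b b (A : Z →ₗ[ℝ] Z)).trace * t + Polynomial.eval t (1 +
        (Polynomial.X : Polynomial ℝ) • (LinearMap.toMatrix b b (A : Z →ₗ[ℝ] Z)).map
          ⇑Polynomial.C).det.divX.divX * t ^ 2) * D.det := by
    ext t
    rw [← Matrix.det_one_add_smul, ← LinearMap.toMatrix_one b, ← map_smul, ← map_add,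
      LinearMap.det_toMatrix, ContinuousLinearMap.det, ContinuousLinearMap.det, ← LinearMap.det_comp]
    congr 1
  rw [h4] at h1
  refine h1.unique ?_
  rw [LinearMap.trace_eq_matrix_trace ℝ b]
  set c := (LinearMap.toMatrix b b (A : Z →ₗ[ℝ] Z)).trace
  set q := (1 + (Polynomial.X : Polynomial ℝ) • (LinearMap.toMatrix b b (A : Z →ₗ[ℝ] Z)).map
          ⇑Polynomial.C).det.divX.divX
  have h5 : HasDerivAt (fun t : ℝ => 1 + c * t + Polynomial.eval t q * t ^ 2) c 0 := by
    have h6 := (((hasDerivAt_id (0 : ℝ)).const_mul c).const_add 1).add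
      ((q.hasDerivAt 0).mul (hasDerivAt_pow 2 (0 : ℝ)))
    simpa using! h6
  exact h5.mul_const _

/-- The flow of a vector field is differentiable in the initial point, the derivative being the
solution of the variational equation. -/
theorem hasFDerivAt_flow {f : Z → Z} {V U : Set Z} (hV : Convex ℝ V) (hU : IsOpen U) {K K' L : ℝ≥0}
    (hd : ∀ z ∈ V, DifferentiableAt ℝ f z) (hK : LipschitzOnWith K f V) (hVo : IsOpen V)
    (hK' : LipschitzOnWith K' (fderiv ℝ f) V) {α : Z → ℝ → Z} {D : ℝ → Z →L[ℝ] Z} {ε : ℝ}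
    (hα0 : ∀ z ∈ U, α z 0 = z)
    (hα : ∀ z ∈ U, ∀ t ∈ Icc 0 ε, HasDerivWithinAt (α z) (f (α z t)) (Icc 0 ε) t ∧ α z t ∈ V)
    (hL : ∀ t ∈ Icc 0 ε, LipschitzOnWith L (α · t) U) {z : Z} (hz : z ∈ U)
    (hD0 : D 0 = ContinuousLinearMap.id ℝ Z)
    (hD : ∀ t ∈ Icc 0 ε, HasDerivWithinAt D (fderiv ℝ f (α z t) ∘L D t) (Icc 0 ε) t)
    {t : ℝ} (ht : t ∈ Icc 0 ε) : HasFDerivAt (α · t) (D t) z := by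
  -- The added 1 makes the Grönwall constant nonzero, so that the explicit exponential bound
  -- applies.
  set k : ℝ := K + 1
  have hk : 0 < k := by positivity
  set c : ℝ := K' * L ^ 2 / k * (Real.exp (k * t) - 1)
  -- The error e(τ) of the linearisation satisfies |e'| ≤ k |e| + K' L² |z' - z|², by Taylor's
  -- formula for `f`, and e(0) = 0. Grönwall makes it quadratic in z' - z.
  have key : ∀ z' ∈ U, ‖α z' t - α z t - D t (z' - z)‖ ≤ c * ‖z' - z‖ ^ 2 := by
    intro z' hz'
    have hw : ∀ τ ∈ Icc 0 ε, HasDerivWithinAt (fun τ => α z' τ - α z τ - D τ (z' - z))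
        (f (α z' τ) - f (α z τ) - (fderiv ℝ f (α z τ) ∘L D τ) (z' - z)) (Icc 0 ε) τ := by
      intro τ hτ
      have h1 := (hD τ hτ).clm_apply (hasDerivWithinAt_const τ (Icc 0 ε) (z' - z))
      simp only [map_zero, add_zero] at h1
      exact ((hα z' hz' τ hτ).1.sub (hα z hz τ hτ).1).sub h1
    have h2 := norm_le_gronwallBound_of_norm_deriv_right_le (a := 0) (b := ε) (δ := 0) (K := k)
      (ε := K' * L ^ 2 * ‖z' - z‖ ^ 2) (fun τ hτ => (hw τ hτ).continuousWithinAt)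
      (fun τ hτ => ((hw τ ⟨hτ.1, hτ.2.le⟩).mono_of_mem_nhdsWithin
        (Icc_mem_nhdsGE_of_mem hτ)))
      (by simp [hα0 z hz, hα0 z' hz', hD0]) (fun τ hτ => by
        have hτ' : τ ∈ Icc 0 ε := ⟨hτ.1, hτ.2.le⟩
        have e1 : f (α z' τ) - f (α z τ) - (fderiv ℝ f (α z τ) ∘L D τ) (z' - z) =
            (f (α z' τ) - f (α z τ) - fderiv ℝ f (α z τ) (α z' τ - α z τ)) +
            fderiv ℝ f (α z τ) (α z' τ - α z τ - D τ (z' - z)) := by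
          simp only [map_sub, ContinuousLinearMap.comp_apply]; abel
        have e2 := hV.norm_sub_sub_fderiv_le hd hK' (hα z hz τ hτ').2 (hα z' hz' τ hτ').2
        have e3 : ‖α z' τ - α z τ‖ ≤ L * ‖z' - z‖ := (hL τ hτ').norm_sub_le hz' hz
        have e4 : ‖fderiv ℝ f (α z τ)‖ ≤ k := by
          have := norm_fderiv_le_of_lipschitzOn ℝ (hVo.mem_nhds (hα z hz τ hτ').2) hK
          simp only [k]; linarith
        rw [e1]
        refine (norm_add_le _ _).trans ?_
        rw [add_comm]
        refine add_le_add ((ContinuousLinearMap.le_opNorm _ _).trans (by gcongr)) (e2.trans ?_)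
        calc (K' : ℝ) * ‖α z' τ - α z τ‖ ^ 2 ≤ K' * (L * ‖z' - z‖) ^ 2 := by gcongr
          _ = _ := by ring) t ht
    refine h2.trans (le_of_eq ?_)
    rw [gronwallBound_of_K_ne_0 hk.ne']
    simp only [c]
    ring_nf
  refine HasFDerivAt.of_isLittleO ?_
  have h3 : (fun z' => α z' t - α z t - D t (z' - z)) =O[𝓝 z] fun z' => ‖z' - z‖ ^ 2 := by
    refine Asymptotics.IsBigO.of_bound c ?_
    filter_upwards [hU.mem_nhds hz] with z' hz'
    simpa using key z' hz'
  refine h3.trans_isLittleO ?_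
  have h4 := (Asymptotics.isLittleO_norm_pow_id (E' := Z) one_lt_two).comp_tendsto
    (show Tendsto (fun z' => z' - z) (𝓝 z) (𝓝 0) by
      have : Tendsto (fun z' => z' - z) (𝓝 z) (𝓝 (z - z)) := tendsto_id.sub_const z
      simpa using this)
  simpa [Function.comp_def] using! h4

/-- **Liouville's theorem**: the local flow of a smooth divergence-free vector field preserves
volume. -/
theorem exists_volume_preserving_local_flow [MeasurableSpace Z] [BorelSpace Z] (μ : Measure Z)
    [μ.IsAddHaarMeasure] {f : Z → Z} {Ω : Set Z} (hΩ : IsOpen Ω) (hf : ContDiffOn ℝ ∞ f Ω)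
    (htr : ∀ z ∈ Ω, LinearMap.trace ℝ Z (fderiv ℝ f z) = 0) {z₀ : Z} (hz₀ : z₀ ∈ Ω) :
    ∃ U, IsOpen U ∧ z₀ ∈ U ∧ U ⊆ Ω ∧ ∃ ε > (0 : ℝ), ∃ α : Z → ℝ → Z,
      (∀ z ∈ U, α z 0 = z ∧ ∀ t ∈ Icc 0 ε,
        HasDerivWithinAt (α z) (f (α z t)) (Icc 0 ε) t ∧ α z t ∈ Ω) ∧
      ∀ t ∈ Icc 0 ε, ContinuousOn (α · t) U ∧ ∀ A ⊆ U, MeasurableSet A →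
        MeasurableSet ((α · t) '' A) ∧ μ ((α · t) '' A) = μ A := by
  have hfat : ContDiffAt ℝ ∞ f z₀ := hf.contDiffAt (hΩ.mem_nhds hz₀)
  have hfd : ContDiffAt ℝ 1 (fderiv ℝ f) z₀ :=
    (hfat.fderiv_right (m := ∞) (by exact_mod_cast (le_top : (⊤ + 1 : ℕ∞) ≤ ⊤))).of_le (by simp)
  obtain ⟨K, s₁, hs₁, hK⟩ := (hfat.of_le
    (by simp : (1 : WithTop ℕ∞) ≤ (∞ : WithTop ℕ∞))).exists_lipschitzOnWith
  obtain ⟨K', s₂, hs₂, hK'⟩ := hfd.exists_lipschitzOnWith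
  obtain ⟨a, ha, hball⟩ := Metric.mem_nhds_iff.1 (inter_mem (inter_mem hs₁ hs₂) (hΩ.mem_nhds hz₀))
  set V := ball z₀ a
  have hVΩ : V ⊆ Ω := fun z hz => (hball hz).2
  have hd : ∀ z ∈ V, DifferentiableAt ℝ f z := fun z hz =>
    (hf.contDiffAt (hΩ.mem_nhds (hVΩ hz))).differentiableAt (by simp)
  have hKV : LipschitzOnWith K f V := hK.mono fun z hz => (hball hz).1.1
  have hKV' : LipschitzOnWith K' (fderiv ℝ f) V := hK'.mono fun z hz => (hball hz).1.2
  -- The flow and its variational equation are solved as one system, so that the linearised flow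
  -- exists on the same time interval as the flow.
  let Ξ : Z × (Z →L[ℝ] Z) → Z × (Z →L[ℝ] Z) := fun w => (f w.1, fderiv ℝ f w.1 ∘L w.2)
  have hΞ : ContDiffAt ℝ 1 Ξ (z₀, ContinuousLinearMap.id ℝ Z) := by
    have h1 : ContDiffAt ℝ 1 (fun w : Z × (Z →L[ℝ] Z) => f w.1) (z₀, ContinuousLinearMap.id ℝ Z) :=
      (hfat.of_le (by simp)).comp (z₀, ContinuousLinearMap.id ℝ Z) contDiffAt_fst
    have h2 : ContDiffAt ℝ 1 (fun w : Z × (Z →L[ℝ] Z) => fderiv ℝ f w.1)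
        (z₀, ContinuousLinearMap.id ℝ Z) :=
      hfd.comp (z₀, ContinuousLinearMap.id ℝ Z) contDiffAt_fst
    exact h1.prodMk (h2.clm_comp contDiffAt_snd)
  obtain ⟨KΞ, s, hs, hKΞ⟩ := hΞ.exists_lipschitzOnWith
  have hs' : s ∩ Prod.fst ⁻¹' V ∈ 𝓝 (z₀, ContinuousLinearMap.id ℝ Z) :=
    inter_mem hs (continuous_fst.continuousAt.preimage_mem_nhds (ball_mem_nhds _ ha))
  obtain ⟨r, hr, ε, hε, L, β, hrs, hβ, hL⟩ :=
    exists_local_flow_of_lipschitzOnWith hs' (hKΞ.mono inter_subset_left)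
  have hIcc : Icc 0 ε ⊆ Icc (-ε) ε := Icc_subset_Icc_left (by linarith)
  have hmem : ∀ z ∈ ball z₀ r, (z, ContinuousLinearMap.id ℝ Z) ∈
      closedBall (z₀, ContinuousLinearMap.id ℝ Z) r := by
    intro z hz
    simp only [mem_closedBall, Prod.dist_eq, dist_self]
    exact max_le (mem_ball.1 hz).le hr.le
  set α : Z → ℝ → Z := fun z t => (β (z, ContinuousLinearMap.id ℝ Z) t).1
  have hα0 : ∀ z ∈ ball z₀ r, α z 0 = z := fun z hz => by simp only [α, (hβ _ (hmem z hz)).1]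
  have hα : ∀ z ∈ ball z₀ r, ∀ t ∈ Icc 0 ε,
      HasDerivWithinAt (α z) (f (α z t)) (Icc 0 ε) t ∧ α z t ∈ V := fun z hz t ht => by
    obtain ⟨h1, h2⟩ := (hβ _ (hmem z hz)).2 t (hIcc ht)
    exact ⟨((ContinuousLinearMap.fst ℝ Z (Z →L[ℝ] Z)).hasFDerivAt.comp_hasDerivWithinAt t h1).mono hIcc,
      h2.2⟩
  have hD : ∀ z ∈ ball z₀ r, ∀ t ∈ Icc 0 ε,
      HasDerivWithinAt (fun t => (β (z, ContinuousLinearMap.id ℝ Z) t).2)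
        (fderiv ℝ f (α z t) ∘L (β (z, ContinuousLinearMap.id ℝ Z) t).2) (Icc 0 ε) t := by
    intro z hz t ht
    exact ((ContinuousLinearMap.snd ℝ Z (Z →L[ℝ] Z)).hasFDerivAt.comp_hasDerivWithinAt t
      ((hβ _ (hmem z hz)).2 t (hIcc ht)).1).mono hIcc
  have hLα : ∀ t ∈ Icc 0 ε, LipschitzOnWith L (α · t) (ball z₀ r) := by
    intro t ht
    refine LipschitzOnWith.of_dist_le_mul fun x hx y hy => ?_
    have h1 := (hL t (hIcc ht)).dist_le_mul _ (hmem x hx) _ (hmem y hy)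
    have h2 : dist (x, ContinuousLinearMap.id ℝ Z) (y, ContinuousLinearMap.id ℝ Z) = dist x y := by
      simp [Prod.dist_eq]
    rw [h2] at h1
    refine le_trans ?_ h1
    rw [Prod.dist_eq]
    exact le_max_left _ _
  have hball0 : ball z₀ r ⊆ V := fun z hz => (hrs (hmem z hz)).2
  have hder : ∀ z ∈ ball z₀ r, ∀ t ∈ Icc 0 ε, HasFDerivAt (α · t)
      ((β (z, ContinuousLinearMap.id ℝ Z) t).2) z := fun z hz t ht =>
    hasFDerivAt_flow (convex_ball _ _) isOpen_ball hd hKV isOpen_ball hKV' hα0 hα hLα hz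
      (by simp only [(hβ _ (hmem z hz)).1]) (hD z hz) ht
  -- By Jacobi's formula the derivative of the determinant is the divergence times the determinant,
  -- hence zero.
  have hdet : ∀ z ∈ ball z₀ r, ∀ t ∈ Icc 0 ε,
      ((β (z, ContinuousLinearMap.id ℝ Z) t).2).det = 1 := by
    intro z hz t ht
    have h1 : ∀ τ ∈ Icc 0 ε, HasDerivWithinAt
        (fun τ => ((β (z, ContinuousLinearMap.id ℝ Z) τ).2).det) 0 (Icc 0 ε) τ := by
      intro τ hτ
      have h2 := (ContinuousLinearMap.differentiable_det
        ((β (z, ContinuousLinearMap.id ℝ Z) τ).2)).hasFDerivAt.comp_hasDerivWithinAt τ (hD z hz τ hτ)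
      rw [ContinuousLinearMap.fderiv_det_comp, htr _ (hVΩ (hα z hz τ hτ).2), zero_mul] at h2
      exact h2
    have h3 := (convex_Icc (0 : ℝ) ε).norm_image_sub_le_of_norm_hasDerivWithin_le (C := 0) h1
      (by simp) ⟨le_rfl, hε.le⟩ ht
    simp only [(hβ _ (hmem z hz)).1, zero_mul, norm_le_zero_iff, sub_eq_zero] at h3
    rw [h3, ContinuousLinearMap.det]
    simp
  refine ⟨ball z₀ r, isOpen_ball, mem_ball_self hr, hball0.trans hVΩ, ε, hε, α,
    fun z hz => ⟨hα0 z hz, fun t ht => ⟨(hα z hz t ht).1, hVΩ (hα z hz t ht).2⟩⟩,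
    fun t ht => ⟨(hLα t ht).continuousOn, fun A hA hAm => ?_⟩⟩
  -- Two orbits that agree at time t agree at time 0, by uniqueness backwards in time.
  have hinj : InjOn (α · t) A := by
    intro x hx y hy hxy
    have hmono : Icc 0 t ⊆ Icc 0 ε := Icc_subset_Icc_right ht.2
    have := ODE_solution_unique_of_mem_Icc_left (v := fun _ => f) (s := fun _ => V) (K := K)
      (f := α x) (g := α y) (a := 0) (b := t) (fun _ _ => hKV)
      (fun τ hτ => ((hα x (hA hx) τ (hmono hτ)).1.mono hmono).continuousWithinAt)
      (fun τ hτ => ((hα x (hA hx) τ (hmono ⟨hτ.1.le, hτ.2⟩)).1.mono_of_mem_nhdsWithin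
        (mem_of_superset (Icc_mem_nhdsLE_of_mem hτ) hmono)))
      (fun τ hτ => (hα x (hA hx) τ (hmono ⟨hτ.1.le, hτ.2⟩)).2)
      (fun τ hτ => ((hα y (hA hy) τ (hmono hτ)).1.mono hmono).continuousWithinAt)
      (fun τ hτ => ((hα y (hA hy) τ (hmono ⟨hτ.1.le, hτ.2⟩)).1.mono_of_mem_nhdsWithin
        (mem_of_superset (Icc_mem_nhdsLE_of_mem hτ) hmono)))
      (fun τ hτ => (hα y (hA hy) τ (hmono ⟨hτ.1.le, hτ.2⟩)).2) hxy
    have h0 := this ⟨le_rfl, ht.1⟩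
    rwa [hα0 x (hA hx), hα0 y (hA hy)] at h0
  refine ⟨hAm.image_of_continuousOn_injOn ((hLα t ht).continuousOn.mono hA) hinj, ?_⟩
  have h1 := lintegral_image_eq_lintegral_abs_det_fderiv_mul μ hAm
    (fun z hz => (hder z (hA hz) t ht).hasFDerivWithinAt) hinj (fun _ => 1)
  rw [setLIntegral_congr_fun (g := fun _ => 1) hAm (fun z hz => by
    simp [hdet z (hA hz) t ht])] at h1
  simpa using h1

end Liouville

/-! ### Homogeneous convex Lagrangians, the Legendre transform and the Hamiltonian vector field. -/

/-- A Lagrangian on a chart domain `U` which is smooth and strongly convex off the zero section and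
homogeneous of degree two in the velocity. -/
structure IsLagrangian {E : Type*} [NormedAddCommGroup E] [InnerProductSpace ℝ E]
    (U : Set E) (L : E → E → ℝ) : Prop where
  isOpen : IsOpen U
  smooth : ContDiffOn ℝ ∞ (fun z : E × E => L z.1 z.2) (U ×ˢ {0}ᶜ)
  pos : ∀ x ∈ U, ∀ y, y ≠ 0 → 0 < L x y
  homogeneous : ∀ x ∈ U, ∀ (c : ℝ) y, L x (c • y) = c ^ 2 * L x y
  convex : ∀ x ∈ U, ∀ v w, v ≠ 0 → w ≠ 0 → 0 < iteratedDeriv 2 (fun t : ℝ => L x (v + t • w)) 0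

theorem IsLagrangian.isOpen_domain {E : Type*} [NormedAddCommGroup E] [InnerProductSpace ℝ E]
    {U : Set E} {L : E → E → ℝ} (h : IsLagrangian U L) : IsOpen (U ×ˢ ({0}ᶜ : Set E)) :=
  h.isOpen.prod isOpen_compl_singleton

section Lagrangian

variable {E : Type*} [NormedAddCommGroup E] [InnerProductSpace ℝ E] [CompleteSpace E]

/-- The momentum `∂L/∂y` at the state `(x, y)`. -/
def momentum (L : E → E → ℝ) (z : E × E) : E := gradient (L z.1) z.2

/-- The force `∂L/∂x` at the state `(x, y)`. -/
def force (L : E → E → ℝ) (z : E × E) : E := gradient (fun x => L x z.2) z.1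

/-- The Legendre transform `(x, y) ↦ (x, ∂L/∂y)`. -/
def legendre (L : E → E → ℝ) (z : E × E) : E × E := (z.1, momentum L z)

namespace IsLagrangian

variable {U : Set E} {L : E → E → ℝ}

theorem contDiffAt (h : IsLagrangian U L) {z : E × E} (hz : z ∈ U ×ˢ ({0}ᶜ : Set E)) :
    ContDiffAt ℝ ∞ (fun z : E × E => L z.1 z.2) z :=
  h.smooth.contDiffAt (h.isOpen_domain.mem_nhds hz)

theorem hasFDerivAt (h : IsLagrangian U L) {z : E × E} (hz : z ∈ U ×ˢ ({0}ᶜ : Set E)) :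
    HasFDerivAt (fun z : E × E => L z.1 z.2) (fderiv ℝ (fun z : E × E => L z.1 z.2) z) z :=
  ((h.contDiffAt hz).differentiableAt (by simp)).hasFDerivAt

theorem hasFDerivAt_right (h : IsLagrangian U L) {z : E × E} (hz : z ∈ U ×ˢ ({0}ᶜ : Set E)) :
    HasFDerivAt (L z.1) (fderiv ℝ (fun z : E × E => L z.1 z.2) z ∘L ContinuousLinearMap.inr ℝ E E)
      z.2 := by
  have h1 : HasFDerivAt (fun y : E => (z.1, y)) (ContinuousLinearMap.inr ℝ E E) z.2 :=
    hasFDerivAt_prodMk_right z.1 z.2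
  exact HasFDerivAt.comp (g := fun z : E × E => L z.1 z.2) z.2 (h.hasFDerivAt hz) h1

theorem hasFDerivAt_left (h : IsLagrangian U L) {z : E × E} (hz : z ∈ U ×ˢ ({0}ᶜ : Set E)) :
    HasFDerivAt (fun x => L x z.2)
      (fderiv ℝ (fun z : E × E => L z.1 z.2) z ∘L ContinuousLinearMap.inl ℝ E E) z.1 := by
  have h1 : HasFDerivAt (fun x : E => (x, z.2)) (ContinuousLinearMap.inl ℝ E E) z.1 :=
    hasFDerivAt_prodMk_left z.1 z.2
  exact HasFDerivAt.comp (g := fun z : E × E => L z.1 z.2) z.1 (h.hasFDerivAt hz) h1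

theorem fderiv_apply (h : IsLagrangian U L) {z : E × E} (hz : z ∈ U ×ˢ ({0}ᶜ : Set E)) (a b : E) :
    fderiv ℝ (fun z : E × E => L z.1 z.2) z (a, b) =
      inner ℝ (force L z) a + inner ℝ (momentum L z) b := by
  rw [force, momentum, inner_gradient_left, inner_gradient_left, (h.hasFDerivAt_left hz).fderiv,
    (h.hasFDerivAt_right hz).fderiv]
  simp [← map_add]

theorem contDiffOn_momentum (h : IsLagrangian U L) :
    ContDiffOn ℝ ∞ (momentum L) (U ×ˢ ({0}ᶜ : Set E)) := by
  have h1 : ContDiffOn ℝ ∞ (fun z => (toDual ℝ E).symm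
      (fderiv ℝ (fun z : E × E => L z.1 z.2) z ∘L ContinuousLinearMap.inr ℝ E E))
      (U ×ˢ ({0}ᶜ : Set E)) := by
    refine (toDual ℝ E).symm.toContinuousLinearEquiv.contDiff.comp_contDiffOn ?_
    refine ContDiffOn.clm_comp ?_ contDiffOn_const
    exact h.smooth.fderiv_of_isOpen h.isOpen_domain (by exact_mod_cast (le_top : (⊤ + 1 : ℕ∞) ≤ ⊤))
  refine h1.congr fun z hz => ?_
  rw [momentum, gradient, (h.hasFDerivAt_right hz).fderiv]

theorem contDiffOn_force (h : IsLagrangian U L) :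
    ContDiffOn ℝ ∞ (force L) (U ×ˢ ({0}ᶜ : Set E)) := by
  have h1 : ContDiffOn ℝ ∞ (fun z => (toDual ℝ E).symm
      (fderiv ℝ (fun z : E × E => L z.1 z.2) z ∘L ContinuousLinearMap.inl ℝ E E))
      (U ×ˢ ({0}ᶜ : Set E)) := by
    refine (toDual ℝ E).symm.toContinuousLinearEquiv.contDiff.comp_contDiffOn ?_
    refine ContDiffOn.clm_comp ?_ contDiffOn_const
    exact h.smooth.fderiv_of_isOpen h.isOpen_domain (by exact_mod_cast (le_top : (⊤ + 1 : ℕ∞) ≤ ⊤))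
  refine h1.congr fun z hz => ?_
  rw [force, gradient, (h.hasFDerivAt_left hz).fderiv]

theorem hasFDerivAt_momentum (h : IsLagrangian U L) {z : E × E} (hz : z ∈ U ×ˢ ({0}ᶜ : Set E)) :
    HasFDerivAt (momentum L) (fderiv ℝ (momentum L) z) z :=
  ((h.contDiffOn_momentum.contDiffAt (h.isOpen_domain.mem_nhds hz)).differentiableAt
    (by simp)).hasFDerivAt

theorem hasDerivAt_line (h : IsLagrangian U L) {x v w : E} {t : ℝ} (hx : x ∈ U)
    (ht : v + t • w ≠ 0) : HasDerivAt (fun t : ℝ => L x (v + t • w))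
      (inner ℝ (momentum L (x, v + t • w)) w) t := by
  have h1 : HasDerivAt (fun t : ℝ => v + t • w) w t := by
    simpa using ((hasDerivAt_id t).smul_const w).const_add v
  have h2 := (h.hasFDerivAt_right (z := (x, v + t • w)) ⟨hx, ht⟩).comp_hasDerivAt t h1
  convert! h2 using 1
  rw [momentum, inner_gradient_left, (h.hasFDerivAt_right (z := (x, v + t • w)) ⟨hx, ht⟩).fderiv]

theorem hasDerivAt_momentum_line (h : IsLagrangian U L) {x v w : E} {t : ℝ} (hx : x ∈ U)
    (ht : v + t • w ≠ 0) : HasDerivAt (fun t : ℝ => inner ℝ (momentum L (x, v + t • w)) w)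
      (inner ℝ (fderiv ℝ (momentum L) (x, v + t • w) (0, w)) w) t := by
  have h1 : HasDerivAt (fun t : ℝ => (x, v + t • w)) ((0 : E), w) t := by
    refine (hasDerivAt_const t x).prodMk ?_
    simpa using ((hasDerivAt_id t).smul_const w).const_add v
  have h2 := (h.hasFDerivAt_momentum (z := (x, v + t • w)) ⟨hx, ht⟩).comp_hasDerivAt t h1
  simpa using! h2.inner ℝ (hasDerivAt_const t w)

/-- The convexity hypothesis is about second derivatives along lines; rewritten in terms of the
momentum it says that the fibre derivative of the Legendre transform is positive definite. -/
theorem inner_fderiv_momentum_pos (h : IsLagrangian U L) {x v w : E} (hx : x ∈ U) (hv : v ≠ 0)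
    (hw : w ≠ 0) : 0 < inner ℝ (fderiv ℝ (momentum L) (x, v) (0, w)) w := by
  have h1 := h.convex x hx v w hv hw
  have h2 : iteratedDeriv 1 (fun t : ℝ => L x (v + t • w)) =ᶠ[𝓝 0]
      fun t => inner ℝ (momentum L (x, v + t • w)) w := by
    have h3 : ∀ᶠ t : ℝ in 𝓝 0, v + t • w ≠ 0 := by
      have : ContinuousAt (fun t : ℝ => v + t • w) 0 := by fun_prop
      exact this.eventually_ne (by simpa using hv)
    filter_upwards [h3] with t ht
    rw [iteratedDeriv_one]
    exact (h.hasDerivAt_line hx ht).deriv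
  rw [iteratedDeriv_succ, h2.deriv_eq,
    (h.hasDerivAt_momentum_line (t := 0) hx (by simpa using hv)).deriv] at h1
  simpa using h1

theorem momentum_smul (h : IsLagrangian U L) {x y : E} (hx : x ∈ U) (hy : y ≠ 0) {c : ℝ}
    (hc : c ≠ 0) : momentum L (x, c • y) = c • momentum L (x, y) := by
  refine ext_inner_right ℝ fun v => ?_
  have h1 := h.hasDerivAt_line (t := 0) (w := v) (v := c • y) hx (by simp [hc, hy])
  have h2 := (h.hasDerivAt_line (t := 0) (w := c⁻¹ • v) (v := y) hx (by simp [hy])).const_mul (c ^ 2)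
  have h3 : (fun t : ℝ => c ^ 2 * L x (y + t • c⁻¹ • v)) = fun t => L x (c • y + t • v) := by
    ext t
    rw [← h.homogeneous x hx, smul_add, smul_comm t, smul_inv_smul₀ hc]
  rw [h3] at h2
  have h4 := h1.unique h2
  simp only [zero_smul, add_zero] at h4
  rw [h4, inner_smul_right, inner_smul_left]
  simp only [conj_trivial]
  field_simp

/-- For c ≠ 0, differentiability in x is equivalent for y and c y, so both derivatives take the
default value 0 together where it fails; no condition on y is needed. -/
theorem force_smul (h : IsLagrangian U L) {x y : E} (hx : x ∈ U) (c : ℝ) :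
    force L (x, c • y) = c ^ 2 • force L (x, y) := by
  have h1 : (fun x => L x (c • y)) =ᶠ[𝓝 x] fun x => c ^ 2 * L x y := by
    filter_upwards [h.isOpen.mem_nhds hx] with x hx using h.homogeneous x hx c y
  refine ext_inner_right ℝ fun v => ?_
  rw [force, inner_gradient_left, h1.fderiv_eq, inner_smul_left, force, inner_gradient_left]
  by_cases hd : DifferentiableAt ℝ (fun x => L x y) x
  · rw [fderiv_const_mul hd]; simp
  · by_cases hc : c = 0
    · simp [hc]
    · rw [fderiv_zero_of_not_differentiableAt hd, fderiv_zero_of_not_differentiableAt]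
      · simp
      · intro h2
        have := h2.const_mul (c ^ 2)⁻¹
        simp only [← mul_assoc, inv_mul_cancel₀ (pow_ne_zero 2 hc), one_mul] at this
        exact hd this

/-- Euler's identity for a function homogeneous of degree two. -/
theorem inner_momentum_self (h : IsLagrangian U L) {x y : E} (hx : x ∈ U) (hy : y ≠ 0) :
    inner ℝ (momentum L (x, y)) y = 2 * L x y := by
  have h1 := h.hasDerivAt_line (t := 0) (w := y) (v := y) hx (by simpa using hy)
  have h2 : (fun t : ℝ => L x (y + t • y)) = fun t => (1 + t) ^ 2 * L x y := by
    ext t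
    rw [← h.homogeneous x hx, add_smul, one_smul]
  have h3 : HasDerivAt (fun t : ℝ => (1 + t) ^ 2 * L x y) (2 * L x y) 0 := by
    have := (((hasDerivAt_id (0 : ℝ)).const_add 1).pow 2).mul_const (L x y)
    simpa using! this
  rw [h2] at h1
  simpa using h1.unique h3

/-- Strict convexity of the Lagrangian in the velocity. -/
theorem add_inner_momentum_lt (h : IsLagrangian U L) {x y w : E} (hx : x ∈ U) (hy : y ≠ 0)
    (hw : w ≠ y) : L x y + inner ℝ (momentum L (x, y)) (w - y) < L x w := by
  by_cases hseg : ∀ t ∈ Icc (0 : ℝ) 1, y + t • (w - y) ≠ 0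
  · have hmono : StrictMonoOn (fun t : ℝ => inner ℝ (momentum L (x, y + t • (w - y))) (w - y))
        (Icc 0 1) := by
      refine strictMonoOn_of_deriv_pos (convex_Icc 0 1) (fun t ht =>
        (h.hasDerivAt_momentum_line hx (hseg t ht)).continuousAt.continuousWithinAt) fun t ht => ?_
      have ht' := interior_subset ht
      rw [(h.hasDerivAt_momentum_line hx (hseg t ht')).deriv]
      exact h.inner_fderiv_momentum_pos hx (hseg t ht') (sub_ne_zero.2 hw)
    obtain ⟨c, hc, hslope⟩ := exists_hasDerivAt_eq_slope (fun t : ℝ => L x (y + t • (w - y)))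
      (fun t => inner ℝ (momentum L (x, y + t • (w - y))) (w - y)) zero_lt_one
      (fun t ht => (h.hasDerivAt_line hx (hseg t ht)).continuousAt.continuousWithinAt)
      (fun t ht => h.hasDerivAt_line hx (hseg t (Ioo_subset_Icc_self ht)))
    have h1 := hmono ⟨le_rfl, zero_le_one⟩ (Ioo_subset_Icc_self hc) hc.1
    simp only [zero_smul, add_zero, one_smul, add_sub_cancel, sub_zero, div_one] at h1 hslope
    linarith
  -- When the segment meets the origin, where smoothness is lost, w is a nonpositive multiple (1 -
  -- s) y with s = 1/t ≥ 1. By homogeneity the difference of the two sides is s² L(x, y).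
  · push Not at hseg
    obtain ⟨t, ht, h0⟩ := hseg
    have ht0 : 0 < t := by
      rcases ht.1.lt_or_eq with h1 | h1
      · exact h1
      · rw [← h1] at h0; simp [hy] at h0
    have hw' : w = (1 - t⁻¹) • y := by
      have : t • w = (t - 1) • y := by
        rw [smul_sub] at h0
        rw [sub_smul, one_smul, eq_sub_iff_add_eq, ← sub_eq_zero, ← h0]; abel
      rw [← inv_smul_smul₀ ht0.ne' w, this, smul_smul]
      congr 1
      field_simp
    have ht1 : 1 ≤ t⁻¹ := (one_le_inv₀ ht0).2 ht.2
    have hsub : w - y = (-t⁻¹) • y := by rw [hw', sub_smul, one_smul, neg_smul]; abel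
    rw [hsub, inner_smul_right, h.inner_momentum_self hx hy, hw', h.homogeneous x hx]
    have hL := h.pos x hx y hy
    nlinarith [mul_pos hL (by positivity : 0 < t⁻¹), mul_nonneg hL.le (sq_nonneg (1 - t⁻¹))]

/-- If two velocities had the same momentum, adding the strict convexity inequalities at both would
give 0 < 0. -/
theorem injOn_legendre (h : IsLagrangian U L) : InjOn (legendre L) (U ×ˢ ({0}ᶜ : Set E)) := by
  rintro ⟨x, y⟩ ⟨hx, hy⟩ ⟨x', y'⟩ ⟨hx', hy'⟩ heq
  obtain ⟨rfl, h2⟩ := Prod.ext_iff.1 heq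
  simp only [legendre] at h2 hx hy hy'
  by_contra hne
  have hne : y' ≠ y := fun h => hne (by rw [h]; rfl)
  have h3 := h.add_inner_momentum_lt hx hy hne
  have h4 := h.add_inner_momentum_lt hx hy' hne.symm
  rw [← h2, ← neg_sub, inner_neg_right] at h4
  linarith

/-- A Fenchel–Young inequality: the convexity inequality combined with Euler's identity. It later
places the momenta of energy at most 1/2 in the polar of the unit ball. -/
theorem inner_momentum_le (h : IsLagrangian U L) {x y : E} (hx : x ∈ U) (hy : y ≠ 0) (w : E) :
    inner ℝ (momentum L (x, y)) w ≤ L x y + L x w := by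
  rcases eq_or_ne w y with rfl | hw
  · rw [h.inner_momentum_self hx hy]; linarith
  · have := h.add_inner_momentum_lt hx hy hw
    rw [inner_sub_right, h.inner_momentum_self hx hy] at this
    linarith

theorem contDiffOn_legendre (h : IsLagrangian U L) :
    ContDiffOn ℝ ∞ (legendre L) (U ×ˢ ({0}ᶜ : Set E)) :=
  contDiffOn_fst.prodMk h.contDiffOn_momentum

theorem contDiffAt_legendre (h : IsLagrangian U L) {z : E × E} (hz : z ∈ U ×ˢ ({0}ᶜ : Set E)) :
    ContDiffAt ℝ ∞ (legendre L) z :=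
  h.contDiffOn_legendre.contDiffAt (h.isOpen_domain.mem_nhds hz)

variable [FiniteDimensional ℝ E]

/-- The derivative is block triangular, with the identity on positions and a positive definite block
on velocities. The inverse function theorem then makes the Legendre transform open and its inverse
smooth. -/
theorem exists_equiv_hasFDerivAt_legendre (h : IsLagrangian U L) {z : E × E}
    (hz : z ∈ U ×ˢ ({0}ᶜ : Set E)) :
    ∃ A : (E × E) ≃L[ℝ] E × E, HasFDerivAt (legendre L) (A : E × E →L[ℝ] E × E) z := by
  have h1 : HasFDerivAt (legendre L)
      ((ContinuousLinearMap.fst ℝ E E).prod (fderiv ℝ (momentum L) z)) z :=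
    hasFDerivAt_fst.prodMk (h.hasFDerivAt_momentum hz)
  have hinj : Function.Injective
      ((ContinuousLinearMap.fst ℝ E E).prod (fderiv ℝ (momentum L) z) : E × E →ₗ[ℝ] E × E) := by
    rw [← LinearMap.ker_eq_bot, LinearMap.ker_eq_bot']
    rintro ⟨a, b⟩ hab
    obtain ⟨h2, h3⟩ := Prod.ext_iff.1 hab
    simp only [ContinuousLinearMap.coe_prod, LinearMap.prod_apply, Function.prod_apply,
      ContinuousLinearMap.coe_coe, ContinuousLinearMap.coe_fst', Prod.fst_zero,
      Prod.snd_zero] at h2 h3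
    subst h2
    by_contra hb
    have hb : b ≠ 0 := fun h => hb (by rw [h]; rfl)
    have := h.inner_fderiv_momentum_pos hz.1 hz.2 hb
    rw [h3] at this
    simp at this
  refine ⟨(LinearEquiv.ofInjectiveEndo _ hinj).toContinuousLinearEquiv, ?_⟩
  convert h1
  ext v <;> rfl

/-- The Legendre transform as a diffeomorphism onto its (open) image. -/
def legendreHomeo (h : IsLagrangian U L) : OpenPartialHomeomorph (E × E) (E × E) :=
  OpenPartialHomeomorph.ofContinuousOpenRestrict
    (h.injOn_legendre.toPartialEquiv (legendre L) (U ×ˢ ({0}ᶜ : Set E)))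
    h.contDiffOn_legendre.continuousOn (by
      rw [isOpenMap_iff_nhds_le]
      rintro ⟨z, hz⟩
      obtain ⟨A, hA⟩ := h.exists_equiv_hasFDerivAt_legendre hz
      have hs : HasStrictFDerivAt (legendre L) (A : E × E →L[ℝ] E × E) z :=
        (h.contDiffAt_legendre hz).hasStrictFDerivAt' hA (by simp)
      have h1 := hs.map_nhds_eq_of_equiv
      change 𝓝 (legendre L z) ≤ map (legendre L ∘ Subtype.val) _
      rw [← Filter.map_map, map_nhds_subtype_coe_eq_nhds hz (h.isOpen_domain.mem_nhds hz), h1])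
    h.isOpen_domain

theorem legendre_mem (h : IsLagrangian U L) {z : E × E} (hz : z ∈ U ×ˢ ({0}ᶜ : Set E)) :
    legendre L z ∈ h.legendreHomeo.target := h.legendreHomeo.map_source hz

theorem symm_mem (h : IsLagrangian U L) {w : E × E} (hw : w ∈ h.legendreHomeo.target) :
    h.legendreHomeo.symm w ∈ U ×ˢ ({0}ᶜ : Set E) := h.legendreHomeo.map_target hw

theorem legendre_symm (h : IsLagrangian U L) {w : E × E} (hw : w ∈ h.legendreHomeo.target) :
    legendre L (h.legendreHomeo.symm w) = w := h.legendreHomeo.right_inv hw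

theorem symm_legendre (h : IsLagrangian U L) {z : E × E} (hz : z ∈ U ×ˢ ({0}ᶜ : Set E)) :
    h.legendreHomeo.symm (legendre L z) = z := h.legendreHomeo.left_inv hz

theorem symm_fst (h : IsLagrangian U L) {w : E × E} (hw : w ∈ h.legendreHomeo.target) :
    (h.legendreHomeo.symm w).1 = w.1 := by
  exact (congrArg Prod.fst (h.legendre_symm hw) : (legendre L (h.legendreHomeo.symm w)).1 = w.1)

theorem momentum_symm (h : IsLagrangian U L) {w : E × E} (hw : w ∈ h.legendreHomeo.target) :
    momentum L (h.legendreHomeo.symm w) = w.2 := congrArg Prod.snd (h.legendre_symm hw)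

theorem contDiffOn_symm (h : IsLagrangian U L) :
    ContDiffOn ℝ ∞ h.legendreHomeo.symm h.legendreHomeo.target := by
  intro w hw
  obtain ⟨A, hA⟩ := h.exists_equiv_hasFDerivAt_legendre (h.symm_mem hw)
  exact (h.legendreHomeo.contDiffAt_symm hw hA
    (h.contDiffAt_legendre (h.symm_mem hw))).contDiffWithinAt

/-- The Hamiltonian vector field in canonical coordinates `(x, p)`. -/
def hamiltonField (h : IsLagrangian U L) (w : E × E) : E × E :=
  ((h.legendreHomeo.symm w).2, force L (h.legendreHomeo.symm w))

/-- The Hamiltonian in canonical coordinates `(x, p)`. -/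
def hamiltonian (h : IsLagrangian U L) (w : E × E) : ℝ :=
  L (h.legendreHomeo.symm w).1 (h.legendreHomeo.symm w).2

theorem contDiffOn_hamiltonField (h : IsLagrangian U L) :
    ContDiffOn ℝ ∞ h.hamiltonField h.legendreHomeo.target :=
  (contDiff_snd.comp_contDiffOn h.contDiffOn_symm).prodMk
    (h.contDiffOn_force.comp h.contDiffOn_symm fun _ hw => h.symm_mem hw)

theorem contDiffOn_hamiltonian (h : IsLagrangian U L) :
    ContDiffOn ℝ ∞ h.hamiltonian h.legendreHomeo.target :=
  h.smooth.comp h.contDiffOn_symm fun _ hw => h.symm_mem hw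

/-- Write y for the velocity as a function of (x, p). Euler's identity gives 2H = ⟨p, y⟩, so 2 dH =
⟨y, dp⟩ + ⟨p, dy⟩, while the chain rule gives dH = ⟨∂L/∂x, dx⟩ + ⟨p, dy⟩. Subtracting eliminates dy
and leaves dH = ⟨y, dp⟩ - ⟨∂L/∂x, dx⟩. -/
theorem fderiv_hamiltonian (h : IsLagrangian U L) {w : E × E} (hw : w ∈ h.legendreHomeo.target)
    (a b : E) : fderiv ℝ h.hamiltonian w (a, b) =
      inner ℝ (h.hamiltonField w).1 b - inner ℝ (h.hamiltonField w).2 a := by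
  have hmem := h.legendreHomeo.open_target.mem_nhds hw
  have hs : HasFDerivAt h.legendreHomeo.symm (fderiv ℝ h.legendreHomeo.symm w) w :=
    ((h.contDiffOn_symm.contDiffAt hmem).differentiableAt (by simp)).hasFDerivAt
  have h1 : HasFDerivAt h.hamiltonian _ w :=
    HasFDerivAt.comp (g := fun z : E × E => L z.1 z.2) w (h.hasFDerivAt (h.symm_mem hw)) hs
  have h2 : (fun w' : E × E => inner ℝ w'.2 (h.legendreHomeo.symm w').2) =ᶠ[𝓝 w]
      fun w' => 2 * h.hamiltonian w' := by
    filter_upwards [hmem] with w' hw'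
    rw [hamiltonian, ← h.inner_momentum_self (h.symm_mem hw').1 (h.symm_mem hw').2]
    rw [Prod.mk.eta, h.momentum_symm hw']
  have h3 := (hasFDerivAt_snd (𝕜 := ℝ) (p := w)).inner ℝ (hasFDerivAt_snd.comp w hs)
  have h4 := congrArg (fun T => T (a, b))
    ((h3.congr_of_eventuallyEq h2.symm).unique (h1.const_mul 2))
  have hfst : (fderiv ℝ h.legendreHomeo.symm w (a, b)).1 = a := by
    have h5 : (fun w' => (h.legendreHomeo.symm w').1) =ᶠ[𝓝 w] fun w' => w'.1 := by
      filter_upwards [hmem] with w' hw' using h.symm_fst hw'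
    have h6 := (hasFDerivAt_fst.comp w hs).unique
      ((hasFDerivAt_fst (𝕜 := ℝ) (p := w)).congr_of_eventuallyEq h5)
    exact congrArg (fun T => T (a, b)) h6
  have h7 : fderiv ℝ (fun z : E × E => L z.1 z.2) (h.legendreHomeo.symm w)
      (fderiv ℝ h.legendreHomeo.symm w (a, b)) = inner ℝ (h.hamiltonField w).2 a +
      inner ℝ w.2 (fderiv ℝ h.legendreHomeo.symm w (a, b)).2 := by
    rw [← Prod.mk.eta (p := fderiv ℝ h.legendreHomeo.symm w (a, b)),
      h.fderiv_apply (h.symm_mem hw), hfst, h.momentum_symm hw]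
    rfl
  simp only [ContinuousLinearMap.comp_apply, _root_.smul_apply, smul_eq_mul,
    ContinuousLinearMap.prod_apply, fderivInnerCLM_apply, ContinuousLinearMap.coe_snd',
    Function.comp_apply] at h4
  rw [h1.fderiv, ContinuousLinearMap.comp_apply]
  rw [h7] at h4 ⊢
  have h8 : inner ℝ b (h.legendreHomeo.symm w).2 = inner ℝ (h.hamiltonField w).1 b :=
    real_inner_comm _ _
  linarith

theorem fderiv_hamiltonian_hamiltonField (h : IsLagrangian U L) {w : E × E}
    (hw : w ∈ h.legendreHomeo.target) : fderiv ℝ h.hamiltonian w (h.hamiltonField w) = 0 := by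
  rw [← Prod.mk.eta (p := h.hamiltonField w), h.fderiv_hamiltonian hw, real_inner_comm, sub_self]

/-- The two diagonal blocks contribute ∂²H/∂x∂p and -∂²H/∂p∂x, which cancel by symmetry of the
second derivative. -/
theorem trace_fderiv_hamiltonField (h : IsLagrangian U L) {w : E × E}
    (hw : w ∈ h.legendreHomeo.target) :
    LinearMap.trace ℝ (E × E) (fderiv ℝ h.hamiltonField w) = 0 := by
  have hmem := h.legendreHomeo.open_target.mem_nhds hw
  set T := fderiv ℝ h.hamiltonField w with hT
  have hξ : HasFDerivAt h.hamiltonField T w :=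
    ((h.contDiffOn_hamiltonField.contDiffAt hmem).differentiableAt (by simp)).hasFDerivAt
  have hH := h.contDiffOn_hamiltonian.contDiffAt hmem
  have hsymm : IsSymmSndFDerivAt ℝ h.hamiltonian w := hH.isSymmSndFDerivAt
    (by rw [minSmoothness_of_isRCLikeNormedField]; exact WithTop.coe_le_coe.2 le_top)
  have hH2 : HasFDerivAt (fderiv ℝ h.hamiltonian) (fderiv ℝ (fderiv ℝ h.hamiltonian) w) w :=
    ((hH.fderiv_right (m := ∞) (by exact_mod_cast (le_top : (⊤ + 1 : ℕ∞) ≤ ⊤))).differentiableAt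
      (by simp)).hasFDerivAt
  have key : ∀ u : E × E, ∀ a b : E, fderiv ℝ (fderiv ℝ h.hamiltonian) w u (a, b) =
      inner ℝ (T u).1 b - inner ℝ (T u).2 a := by
    intro u a b
    have h1 : HasFDerivAt (fun w' => fderiv ℝ h.hamiltonian w' (a, b)) _ w :=
      hH2.clm_apply (hasFDerivAt_const (a, b) w)
    have h2 : (fun w' => fderiv ℝ h.hamiltonian w' (a, b)) =ᶠ[𝓝 w]
        fun w' => inner ℝ (h.hamiltonField w').1 b - inner ℝ (h.hamiltonField w').2 a := by
      filter_upwards [hmem] with w' hw' using h.fderiv_hamiltonian hw' a b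
    have h3 := ((hasFDerivAt_fst.comp w hξ).inner ℝ (hasFDerivAt_const b w)).sub
      ((hasFDerivAt_snd.comp w hξ).inner ℝ (hasFDerivAt_const a w))
    have h4 := congrArg (fun S => S u) (h1.unique (h3.congr_of_eventuallyEq h2))
    simpa using! h4
  have h1 : (T : E × E →ₗ[ℝ] E × E) =
      LinearMap.inl ℝ E E ∘ₗ (LinearMap.fst ℝ E E ∘ₗ (T : E × E →ₗ[ℝ] E × E)) +
      LinearMap.inr ℝ E E ∘ₗ (LinearMap.snd ℝ E E ∘ₗ (T : E × E →ₗ[ℝ] E × E)) := by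
    ext v <;> simp
  rw [h1, map_add, LinearMap.trace_comp_comm' _ (LinearMap.inl ℝ E E),
    LinearMap.trace_comp_comm' _ (LinearMap.inr ℝ E E),
    LinearMap.trace_eq_sum_inner _ (stdOrthonormalBasis ℝ E),
    LinearMap.trace_eq_sum_inner _ (stdOrthonormalBasis ℝ E), ← Finset.sum_add_distrib]
  refine Finset.sum_eq_zero fun i _ => ?_
  set e := stdOrthonormalBasis ℝ E i
  have h2 := hsymm (e, 0) (0, e)
  rw [key, key] at h2
  simp only [LinearMap.comp_apply, LinearMap.inl_apply, LinearMap.inr_apply, LinearMap.fst_apply,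
    LinearMap.snd_apply, ContinuousLinearMap.coe_coe]
  simp only [inner_zero_right, sub_zero, zero_sub] at h2
  rw [real_inner_comm, h2, real_inner_comm]
  simp

end IsLagrangian
end Lagrangian

/-! ### Equivalence of the Euler–Lagrange equation with Hamilton's equations. -/

section EulerLagrange

variable {E : Type*} [NormedAddCommGroup E] [InnerProductSpace ℝ E]

/-- The curve `c` has nonzero velocity and satisfies the Euler–Lagrange equation of `L` at time
`t`, with derivatives taken within `s`. -/
def EulerLagrangeAt (L : E → E → ℝ) (c : ℝ → E) (s : Set ℝ) (t : ℝ) : Prop :=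
  DifferentiableWithinAt ℝ c s t ∧ derivWithin c s t ≠ 0 ∧
    HasDerivWithinAt (fun r => fderiv ℝ (fun y => L (c r) y) (derivWithin c s r))
      (fderiv ℝ (fun x => L x (derivWithin c s t)) (c t)) s t

variable [CompleteSpace E]

/-- The lift of a curve to phase space, in canonical coordinates. -/
def phaseCurve (L : E → E → ℝ) (c : ℝ → E) (s : Set ℝ) (t : ℝ) : E × E :=
  legendre L (c t, derivWithin c s t)

variable [FiniteDimensional ℝ E] {U : Set E} {L : E → E → ℝ}

theorem IsLagrangian.phaseCurve_mem (h : IsLagrangian U L) {c : ℝ → E} {s : Set ℝ} {t : ℝ}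
    (hc : EulerLagrangeAt L c s t) (hU : c t ∈ U) :
    phaseCurve L c s t ∈ h.legendreHomeo.target :=
  h.legendre_mem ⟨hU, hc.2.1⟩

theorem IsLagrangian.hasDerivWithinAt_phaseCurve (h : IsLagrangian U L) {c : ℝ → E} {s : Set ℝ}
    {t : ℝ} (hc : EulerLagrangeAt L c s t) (hU : c t ∈ U) :
    HasDerivWithinAt (phaseCurve L c s) (h.hamiltonField (phaseCurve L c s t)) s t := by
  have h1 : h.legendreHomeo.symm (phaseCurve L c s t) = (c t, derivWithin c s t) :=
    h.symm_legendre ⟨hU, hc.2.1⟩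
  rw [IsLagrangian.hamiltonField, h1]
  refine hc.1.hasDerivWithinAt.prodMk ?_
  exact HasFDerivAt.comp_hasDerivWithinAt t
    (toDual ℝ E).symm.toContinuousLinearEquiv.hasFDerivAt hc.2.2

/-- The position equation says that the velocity of the projected curve is the one encoded by the
momentum, so the phase lift of the projection is the original solution; the momentum equation is
then the Euler–Lagrange equation. -/
theorem IsLagrangian.eulerLagrangeAt_of_hasDerivWithinAt (h : IsLagrangian U L) {z : ℝ → E × E}
    {s : Set ℝ} (hs : UniqueDiffOn ℝ s) (hmem : ∀ t ∈ s, z t ∈ h.legendreHomeo.target)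
    (hz : ∀ t ∈ s, HasDerivWithinAt z (h.hamiltonField (z t)) s t) {t : ℝ} (ht : t ∈ s) :
    (z t).1 ∈ U ∧ EulerLagrangeAt L (fun r => (z r).1) s t ∧
      phaseCurve L (fun r => (z r).1) s t = z t := by
  have h1 : ∀ r ∈ s, HasDerivWithinAt (fun r => (z r).1) (h.legendreHomeo.symm (z r)).2 s r :=
    fun r hr => (ContinuousLinearMap.fst ℝ E E).hasFDerivAt.comp_hasDerivWithinAt r (hz r hr)
  have h2 : ∀ r ∈ s, ((z r).1, derivWithin (fun r => (z r).1) s r) =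
      h.legendreHomeo.symm (z r) := fun r hr => by
    rw [(h1 r hr).derivWithin (hs r hr)]
    exact Prod.ext (h.symm_fst (hmem r hr)).symm rfl
  have h3 : ∀ r ∈ s, phaseCurve L (fun r => (z r).1) s r = z r := fun r hr => by
    rw [phaseCurve, h2 r hr, h.legendre_symm (hmem r hr)]
  have hD := h.symm_mem (hmem t ht)
  rw [← h2 t ht] at hD
  refine ⟨hD.1, ⟨(h1 t ht).differentiableWithinAt, hD.2, ?_⟩, h3 t ht⟩
  have h4 : HasDerivWithinAt (fun r => (z r).2) (force L (h.legendreHomeo.symm (z t))) s t :=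
    (ContinuousLinearMap.snd ℝ E E).hasFDerivAt.comp_hasDerivWithinAt t (hz t ht)
  have h5 := HasFDerivAt.comp_hasDerivWithinAt t
    (toDual ℝ E).toContinuousLinearEquiv.hasFDerivAt h4
  have h6 : ∀ r ∈ s, fderiv ℝ (fun y => L (z r).1 y) (derivWithin (fun r => (z r).1) s r) =
      toDual ℝ E (z r).2 := fun r hr => by
    rw [← h3 r hr]
    exact (toDual_gradient).symm
  refine (h5.congr h6 (h6 t ht)).congr_deriv ?_
  rw [← h2 t ht]
  exact toDual_gradient

end EulerLagrange

/-! ### The geodesic spray and its regularity at zero velocity. -/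

section Spray

variable {E : Type*} [NormedAddCommGroup E] [InnerProductSpace ℝ E] [CompleteSpace E]
  [FiniteDimensional ℝ E] {U : Set E} {L : E → E → ℝ}

namespace IsLagrangian

open Classical in
/-- The geodesic spray, as an acceleration depending on position and velocity. -/
def spray (h : IsLagrangian U L) (z : E × E) : E :=
  if z.2 = 0 then 0 else
    (fderiv ℝ h.legendreHomeo.symm (legendre L z) (h.hamiltonField (legendre L z))).2

theorem spray_zero (h : IsLagrangian U L) (x : E) : h.spray (x, 0) = 0 := by simp [spray]

theorem contDiffOn_spray (h : IsLagrangian U L) :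
    ContDiffOn ℝ ∞ h.spray (U ×ˢ ({0}ᶜ : Set E)) := by
  have h1 : ContDiffOn ℝ ∞ (fun z =>
      (fderiv ℝ h.legendreHomeo.symm (legendre L z) (h.hamiltonField (legendre L z))).2)
      (U ×ˢ ({0}ᶜ : Set E)) := by
    have h2 : ContDiffOn ℝ ∞ (fun w => fderiv ℝ h.legendreHomeo.symm w (h.hamiltonField w))
        h.legendreHomeo.target :=
      (h.contDiffOn_symm.fderiv_of_isOpen h.legendreHomeo.open_target
        (by exact_mod_cast (le_top : (⊤ + 1 : ℕ∞) ≤ ⊤))).clm_apply h.contDiffOn_hamiltonField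
    exact contDiff_snd.comp_contDiffOn (h2.comp h.contDiffOn_legendre fun z hz => h.legendre_mem hz)
  refine h1.congr fun z hz => ?_
  rw [spray, if_neg (show z.2 ≠ 0 from hz.2)]

/-- The second-order field (y, G) and the Hamiltonian field are related by the Legendre transform;
this converts spray solutions into solutions of Hamilton's equations. -/
theorem fderiv_legendre_spray (h : IsLagrangian U L) {z : E × E}
    (hz : z ∈ U ×ˢ ({0}ᶜ : Set E)) :
    fderiv ℝ (legendre L) z (z.2, h.spray z) = h.hamiltonField (legendre L z) := by
  have hw := h.legendre_mem hz
  have hmem := h.legendreHomeo.open_target.mem_nhds hw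
  have hs : HasFDerivAt h.legendreHomeo.symm (fderiv ℝ h.legendreHomeo.symm (legendre L z))
      (legendre L z) :=
    ((h.contDiffOn_symm.contDiffAt hmem).differentiableAt (by simp)).hasFDerivAt
  have h1 : fderiv ℝ h.legendreHomeo.symm (legendre L z) (h.hamiltonField (legendre L z)) =
      (z.2, h.spray z) := by
    refine Prod.ext ?_ ?_
    · have h5 : (fun w' => (h.legendreHomeo.symm w').1) =ᶠ[𝓝 (legendre L z)] fun w' => w'.1 := by
        filter_upwards [hmem] with w' hw' using h.symm_fst hw'
      have h6 := (hasFDerivAt_fst.comp _ hs).unique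
        ((hasFDerivAt_fst (𝕜 := ℝ) (p := legendre L z)).congr_of_eventuallyEq h5)
      have h7 := congrArg (fun T => T (h.hamiltonField (legendre L z))) h6
      have h8 : (h.hamiltonField (legendre L z)).1 = z.2 := by
        rw [hamiltonField, h.symm_legendre hz]
      exact h7.trans h8
    · rw [spray, if_neg (show z.2 ≠ 0 from hz.2)]
  rw [← h1]
  have hl : HasFDerivAt (legendre L) (fderiv ℝ (legendre L) z)
      (h.legendreHomeo.symm (legendre L z)) := by
    rw [h.symm_legendre hz]
    exact ((h.contDiffAt_legendre hz).differentiableAt (by simp)).hasFDerivAt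
  have h2 : (legendre L ∘ h.legendreHomeo.symm) =ᶠ[𝓝 (legendre L z)] id := by
    filter_upwards [hmem] with w' hw' using h.legendre_symm hw'
  have h3 := (hl.comp _ hs).unique ((hasFDerivAt_id _).congr_of_eventuallyEq h2)
  exact congrArg (fun T => T (h.hamiltonField (legendre L z))) h3

/-- The Legendre transform commutes with scaling of the fibre. Differentiating this relation along
(y, G) and multiplying by c shows that (c y, c² G(x, y)) is mapped to the Hamiltonian field at (x, c
y), and the derivative of the Legendre transform is injective. The value 0 assigned at zero velocity
extends the identity to c = 0 and y = 0. -/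
theorem spray_smul (h : IsLagrangian U L) {x : E} (hx : x ∈ U) (c : ℝ) (y : E) :
    h.spray (x, c • y) = c ^ 2 • h.spray (x, y) := by
  rcases eq_or_ne c 0 with rfl | hc
  · simp [spray_zero]
  rcases eq_or_ne y 0 with rfl | hy
  · simp [spray_zero]
  have hz : ((x, y) : E × E) ∈ U ×ˢ ({0}ᶜ : Set E) := ⟨hx, hy⟩
  have hcy : c • y ≠ 0 := smul_ne_zero hc hy
  have hz' : ((x, c • y) : E × E) ∈ U ×ˢ ({0}ᶜ : Set E) := ⟨hx, hcy⟩
  let m : E × E →L[ℝ] E × E :=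
    (ContinuousLinearMap.fst ℝ E E).prod (c • ContinuousLinearMap.snd ℝ E E)
  have hm : ∀ z : E × E, m z = (z.1, c • z.2) := fun z => rfl
  have h1 : (legendre L ∘ m) =ᶠ[𝓝 (x, y)] (m ∘ legendre L) := by
    filter_upwards [h.isOpen_domain.mem_nhds hz] with z hz
    exact Prod.ext rfl (h.momentum_smul hz.1 hz.2 hc)
  have hd := ((h.contDiffAt_legendre hz).differentiableAt (by simp)).hasFDerivAt
  have hd' : HasFDerivAt (legendre L) (fderiv ℝ (legendre L) (x, c • y)) (m (x, y)) :=
    ((h.contDiffAt_legendre hz').differentiableAt (by simp)).hasFDerivAt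
  have h2 := (hd'.comp _ m.hasFDerivAt).unique
    ((m.hasFDerivAt.comp _ hd).congr_of_eventuallyEq h1)
  have h3 := congrArg (fun T => T (y, h.spray (x, y))) h2
  simp only [ContinuousLinearMap.comp_apply, hm] at h3
  rw [h.fderiv_legendre_spray hz] at h3
  have h4 := h.fderiv_legendre_spray hz'
  simp only [hamiltonField, h.symm_legendre hz, h.symm_legendre hz'] at h3 h4
  obtain ⟨A, hA⟩ := h.exists_equiv_hasFDerivAt_legendre hz'
  rw [hA.fderiv] at h3 h4
  have h5 : A (c • y, c ^ 2 • h.spray (x, y)) = A (c • y, h.spray (x, c • y)) := by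
    have : ((c • y, c ^ 2 • h.spray (x, y)) : E × E) = c • (y, c • h.spray (x, y)) := by
      rw [Prod.smul_mk, smul_smul, sq]
    rw [this, map_smul]
    refine Eq.trans ?_ h4.symm
    refine (congrArg (fun v => c • v) h3).trans ?_
    simp only [Prod.smul_mk, smul_smul, h.force_smul hx, sq]
  exact (Prod.ext_iff.1 (A.injective h5)).2.symm

/-- Degree two homogeneity turns bounds on the compact shell 1/2 ≤ |y| ≤ 1, where the spray is
smooth, into a Lipschitz bound up to zero velocity. The factor ρ in the constant is what makes the
exponential map strictly differentiable at the zero vector. -/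
theorem exists_norm_spray_sub_le (h : IsLagrangian U L) {x₀ : E} (hx₀ : x₀ ∈ U) :
    ∃ a > 0, a ≤ 1 ∧ closedBall x₀ a ⊆ U ∧ ∃ C ≥ 0, ∀ x₁ ∈ closedBall x₀ a, ∀ x₂ ∈ closedBall x₀ a,
      ∀ ρ ≤ 1, ∀ y₁ y₂ : E, ‖y₁‖ ≤ ρ → ‖y₂‖ ≤ ρ →
      ‖h.spray (x₁, y₁) - h.spray (x₂, y₂)‖ ≤ C * ρ * ‖(x₁, y₁) - (x₂, y₂)‖ := by
  obtain ⟨a₀, ha₀, hball₀⟩ := Metric.nhds_basis_closedBall.mem_iff.1 (h.isOpen.mem_nhds hx₀)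
  set a := min a₀ 1
  have ha : 0 < a := lt_min ha₀ one_pos
  have hball : closedBall x₀ a ⊆ U :=
    (closedBall_subset_closedBall (min_le_left _ _)).trans hball₀
  set K : Set (E × E) := closedBall x₀ a ×ˢ (closedBall (0 : E) 1 \ ball 0 (1 / 2)) with hK
  have hKc : IsCompact K :=
    (isCompact_closedBall x₀ a).prod ((isCompact_closedBall 0 1).diff isOpen_ball)
  have hKD : K ⊆ U ×ˢ ({0}ᶜ : Set E) := fun z hz => ⟨hball hz.1, fun h0 => hz.2.2 (by
    rw [mem_singleton_iff.1 h0]; exact mem_ball_self (by norm_num))⟩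
  have hfd : ContinuousOn (fderiv ℝ h.spray) K :=
    ((h.contDiffOn_spray.fderiv_of_isOpen (m := ∞) h.isOpen_domain
      (by exact_mod_cast (le_top : (⊤ + 1 : ℕ∞) ≤ ⊤))).continuousOn).mono hKD
  obtain ⟨C₁, hC₁⟩ := hKc.exists_bound_of_continuousOn (E := E × E →L[ℝ] E) hfd
  obtain ⟨C₂, hC₂⟩ := hKc.exists_bound_of_continuousOn (h.contDiffOn_spray.continuousOn.mono hKD)
  have hquad : ∀ x ∈ closedBall x₀ a, ∀ y : E, ‖h.spray (x, y)‖ ≤ max C₂ 0 * ‖y‖ ^ 2 := by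
    intro x hx y
    rcases eq_or_ne y 0 with rfl | hy
    · simp [spray_zero]
    have hy' : 0 < ‖y‖ := norm_pos_iff.2 hy
    have h1 : y = ‖y‖ • (‖y‖⁻¹ • y) := by rw [smul_inv_smul₀ hy'.ne']
    have h2 : ‖‖y‖⁻¹ • y‖ = 1 := by rw [norm_smul, norm_inv, norm_norm, inv_mul_cancel₀ hy'.ne']
    have h3 := hC₂ (x, ‖y‖⁻¹ • y) ⟨hx, by simp [h2], by simp only [mem_ball_zero_iff, h2]; norm_num⟩
    conv_lhs => rw [h1]
    rw [h.spray_smul (hball hx), norm_smul, norm_pow, norm_norm, mul_comm]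
    gcongr
    exact h3.trans (le_max_left _ _)
  set C := max C₁ 0 + 4 * max C₂ 0
  have hC₁' : max C₁ 0 ≤ C := by
    have : 0 ≤ max C₂ 0 := le_max_right _ _
    simp only [C]; linarith
  have hC₂' : 4 * max C₂ 0 ≤ C := by
    have : 0 ≤ max C₁ 0 := le_max_right _ _
    simp only [C]; linarith
  have hC0 : 0 ≤ C := (le_max_right _ _).trans hC₁'
  have main : ∀ x₁ ∈ closedBall x₀ a, ∀ x₂ ∈ closedBall x₀ a, ∀ y₁ y₂ : E, ‖y₂‖ ≤ ‖y₁‖ → ‖y₁‖ ≤ 1 →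
      ‖h.spray (x₁, y₁) - h.spray (x₂, y₂)‖ ≤ C * ‖y₁‖ * ‖(x₁, y₁) - (x₂, y₂)‖ := by
    intro x₁ hx₁ x₂ hx₂ y₁ y₂ hy hy1
    have hfst : ‖x₁ - x₂‖ ≤ ‖(x₁, y₁) - (x₂, y₂)‖ := norm_fst_le ((x₁, y₁) - (x₂, y₂))
    have hsnd : ‖y₁ - y₂‖ ≤ ‖(x₁, y₁) - (x₂, y₂)‖ := norm_snd_le ((x₁, y₁) - (x₂, y₂))
    -- If the velocities are far apart relative to their size, the quadratic bound on each term
    -- suffices. Otherwise divide by |y₁|: the segment between the rescaled states stays in the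
    -- shell, away from zero velocity, and the mean value inequality applies.
    by_cases hcase : ‖y₁‖ / 2 ≤ ‖y₁ - y₂‖
    · have h1 := hquad x₁ hx₁ y₁
      have h2 := hquad x₂ hx₂ y₂
      have h3 : ‖y₂‖ ^ 2 ≤ ‖y₁‖ ^ 2 := by gcongr
      have h4 : (0 : ℝ) ≤ max C₂ 0 := le_max_right _ _
      calc _ ≤ ‖h.spray (x₁, y₁)‖ + ‖h.spray (x₂, y₂)‖ := norm_sub_le _ _
        _ ≤ 4 * max C₂ 0 * ‖y₁‖ * (‖y₁‖ / 2) := by nlinarith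
        _ ≤ C * ‖y₁‖ * ‖(x₁, y₁) - (x₂, y₂)‖ := by
          gcongr
          exact hcase.trans hsnd
    · push Not at hcase
      have hpos : 0 < ‖y₁‖ := by
        by_contra h0
        have : ‖y₁‖ = 0 := le_antisymm (not_lt.1 h0) (norm_nonneg _)
        rw [this] at hcase
        linarith [norm_nonneg (y₁ - y₂)]
      set ρ := ‖y₁‖
      have hscale : ∀ y : E, y = ρ • (ρ⁻¹ • y) := fun y => by rw [smul_inv_smul₀ hpos.ne']
      have hn1 : ‖ρ⁻¹ • y₁‖ = 1 := by rw [norm_smul, norm_inv, norm_norm, inv_mul_cancel₀ hpos.ne']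
      have hn12 : ‖ρ⁻¹ • y₁ - ρ⁻¹ • y₂‖ = ρ⁻¹ * ‖y₁ - y₂‖ := by
        rw [← smul_sub, norm_smul, norm_inv, norm_norm]
      have hn12' : ‖ρ⁻¹ • y₁ - ρ⁻¹ • y₂‖ < 1 / 2 := by
        rw [hn12, inv_mul_lt_iff₀ hpos]; linarith
      have hn2 : ‖ρ⁻¹ • y₂‖ ≤ 1 := by
        rw [norm_smul, norm_inv, norm_norm, inv_mul_le_iff₀ hpos, mul_one]; exact hy
      have hseg : segment ℝ (x₂, ρ⁻¹ • y₂) (x₁, ρ⁻¹ • y₁) ⊆ K := by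
        have h1 : segment ℝ (x₂, ρ⁻¹ • y₂) (x₁, ρ⁻¹ • y₁) ⊆
            closedBall x₀ a ×ˢ (closedBall (0 : E) 1 ∩ ball (ρ⁻¹ • y₁) (1 / 2)) := by
          refine ((convex_closedBall x₀ a).prod
            ((convex_closedBall 0 1).inter (convex_ball _ _))).segment_subset ⟨hx₂, ?_, ?_⟩
            ⟨hx₁, ?_, ?_⟩
          · simpa using hn2
          · rw [mem_ball_comm, mem_ball, dist_eq_norm]; exact hn12'
          · simp [hn1]
          · simp
        intro z hz
        obtain ⟨hz1, hz2, hz3⟩ := h1 hz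
        refine ⟨hz1, hz2, fun h0 => ?_⟩
        have h4 := norm_sub_norm_le (ρ⁻¹ • y₁) z.2
        rw [hn1, norm_sub_rev] at h4
        rw [mem_ball, dist_eq_norm] at hz3
        rw [mem_ball_zero_iff] at h0
        linarith
      have hmv := (convex_segment (x₂, ρ⁻¹ • y₂) (x₁, ρ⁻¹ • y₁)).norm_image_sub_le_of_norm_fderiv_le
        (𝕜 := ℝ) (f := h.spray) (C := max C₁ 0)
        (fun z hz => (h.contDiffOn_spray.contDiffAt
          (h.isOpen_domain.mem_nhds (hKD (hseg hz)))).differentiableAt (by simp))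
        (fun z hz => (hC₁ z (hseg hz)).trans (le_max_left _ _))
        (left_mem_segment ℝ _ _) (right_mem_segment ℝ _ _)
      have hnorm : ρ * ‖(x₁, ρ⁻¹ • y₁) - (x₂, ρ⁻¹ • y₂)‖ ≤ ‖(x₁, y₁) - (x₂, y₂)‖ := by
        rw [Prod.mk_sub_mk, Prod.norm_mk, hn12, mul_max_of_nonneg _ _ hpos.le,
          mul_inv_cancel_left₀ hpos.ne']
        refine max_le ?_ hsnd
        calc ρ * ‖x₁ - x₂‖ ≤ 1 * ‖x₁ - x₂‖ := by gcongr
          _ ≤ _ := by rw [one_mul]; exact hfst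
      calc ‖h.spray (x₁, y₁) - h.spray (x₂, y₂)‖
          = ρ ^ 2 * ‖h.spray (x₁, ρ⁻¹ • y₁) - h.spray (x₂, ρ⁻¹ • y₂)‖ := by
            conv_lhs => rw [hscale y₁, hscale y₂]
            rw [h.spray_smul (hball hx₁), h.spray_smul (hball hx₂), ← smul_sub, norm_smul,
              norm_pow, norm_norm]
        _ ≤ ρ ^ 2 * (max C₁ 0 * ‖(x₁, ρ⁻¹ • y₁) - (x₂, ρ⁻¹ • y₂)‖) := by gcongr
        _ = max C₁ 0 * ρ * (ρ * ‖(x₁, ρ⁻¹ • y₁) - (x₂, ρ⁻¹ • y₂)‖) := by ring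
        _ ≤ C * ρ * ‖(x₁, y₁) - (x₂, y₂)‖ := by gcongr
  refine ⟨a, ha, min_le_right _ _, hball, C, hC0, fun x₁ hx₁ x₂ hx₂ ρ hρ y₁ y₂ h1 h2 => ?_⟩
  rcases le_total ‖y₂‖ ‖y₁‖ with hle | hle
  · refine (main x₁ hx₁ x₂ hx₂ y₁ y₂ hle (h1.trans hρ)).trans ?_
    gcongr
  · rw [norm_sub_rev, norm_sub_rev (x₁, y₁)]
    refine (main x₂ hx₂ x₁ hx₁ y₂ y₁ hle (h2.trans hρ)).trans ?_
    gcongr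

end IsLagrangian
end Spray

/-! ### The exponential map in a chart. -/

section Exponential

variable {E : Type*} [NormedAddCommGroup E] [InnerProductSpace ℝ E] [CompleteSpace E]
  [FiniteDimensional ℝ E] {U : Set E} {L : E → E → ℝ}

namespace IsLagrangian

/-- Solutions of the spray equation satisfy Hamilton's equations. -/
theorem hasDerivWithinAt_legendre_of_spray (h : IsLagrangian U L) {z : ℝ → E × E} {s : Set ℝ}
    {t : ℝ} (hz : HasDerivWithinAt z ((z t).2, h.spray (z t)) s t)
    (hmem : z t ∈ U ×ˢ ({0}ᶜ : Set E)) :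
    HasDerivWithinAt (fun r => legendre L (z r)) (h.hamiltonField (legendre L (z t))) s t := by
  rw [← h.fderiv_legendre_spray hmem]
  exact (((h.contDiffAt_legendre hmem).differentiableAt
    (by simp)).hasFDerivAt).comp_hasDerivWithinAt t hz

/-- The local flow of the geodesic spray near a point of the zero section. -/
theorem exists_spray_flow (h : IsLagrangian U L) {x₀ : E} (hx₀ : x₀ ∈ U) :
    ∃ r > 0, ∃ ε > 0, ∃ C ≥ 0, ∃ N ⊆ U, ∃ α : E × E → ℝ → E × E,
      (∀ z ∈ closedBall (x₀, (0 : E)) r, α z 0 = z ∧ ∀ t ∈ Icc (-ε) ε,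
        HasDerivWithinAt (α z) ((α z t).2, h.spray (α z t)) (Icc (-ε) ε) t ∧ (α z t).1 ∈ N) ∧
      (∀ t ∈ Icc (-ε) ε, LipschitzOnWith (C.toNNReal) (α · t) (closedBall (x₀, (0 : E)) r)) ∧
      (∀ z ∈ closedBall (x₀, (0 : E)) r, ∀ c : ℝ, |c| ≤ 1 → ∀ t ∈ Icc (-ε) ε,
        α (z.1, c • z.2) t = ((α z (c * t)).1, c • (α z (c * t)).2)) ∧
      (∀ z ∈ closedBall (x₀, (0 : E)) r, z.2 ≠ 0 → ∀ t ∈ Icc (-ε) ε, (α z t).2 ≠ 0) ∧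
      (∀ z ∈ closedBall (x₀, (0 : E)) r, ∀ z' ∈ closedBall (x₀, (0 : E)) r, ∀ t ∈ Icc (-ε) ε,
        ‖h.spray (α z t) - h.spray (α z' t)‖ ≤ C * max ‖z.2‖ ‖z'.2‖ * ‖z - z'‖) := by
  obtain ⟨a, ha, ha1, haU, C₀, hC₀, hS⟩ := h.exists_norm_spray_sub_le hx₀
  set f : E × E → E × E := fun z => (z.2, h.spray z) with hf
  have hball : closedBall (x₀, (0 : E)) a = closedBall x₀ a ×ˢ closedBall 0 a :=
    (closedBall_prod_same _ _ _).symm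
  set K : ℝ≥0 := (C₀ + 1).toNNReal
  have hK : (K : ℝ) = C₀ + 1 := Real.coe_toNNReal _ (by positivity)
  have hlip : LipschitzOnWith K f (closedBall (x₀, (0 : E)) a) := by
    refine LipschitzOnWith.of_dist_le_mul fun z hz z' hz' => ?_
    rw [hball] at hz hz'
    rw [dist_eq_norm, dist_eq_norm, hf, Prod.mk_sub_mk, Prod.norm_mk, hK]
    refine max_le ?_ ?_
    · have : ‖z.2 - z'.2‖ ≤ ‖z - z'‖ := norm_snd_le (z - z')
      nlinarith [norm_nonneg (z - z')]
    · have h1 := hS z.1 hz.1 z'.1 hz'.1 1 le_rfl z.2 z'.2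
        ((mem_closedBall_zero_iff.1 hz.2).trans ha1) ((mem_closedBall_zero_iff.1 hz'.2).trans ha1)
      simp only [Prod.mk.eta, mul_one] at h1
      nlinarith [norm_nonneg (z - z')]
  obtain ⟨r, hr, ε, hε, Λ, α, hrs, hα, hL⟩ :=
    exists_local_flow_of_lipschitzOnWith (closedBall_mem_nhds (x₀, (0 : E)) ha) hlip
  -- uniqueness of solutions inside the ball
  have huniq : ∀ (u v : ℝ → E × E) (t₀ : ℝ), t₀ ∈ Icc (-ε) ε →
      (∀ t ∈ Icc (-ε) ε, HasDerivWithinAt u (f (u t)) (Icc (-ε) ε) t ∧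
        u t ∈ closedBall (x₀, (0 : E)) a) →
      (∀ t ∈ Icc (-ε) ε, HasDerivWithinAt v (f (v t)) (Icc (-ε) ε) t ∧
        v t ∈ closedBall (x₀, (0 : E)) a) → u t₀ = v t₀ → EqOn u v (Icc (-ε) ε) := by
    intro u v t₀ ht₀ hu hv heq t ht
    rcases le_total t t₀ with hle | hle
    · have hsub : Icc t t₀ ⊆ Icc (-ε) ε := Icc_subset_Icc ht.1 ht₀.2
      have hnhds : ∀ τ ∈ Ioc t t₀, Icc (-ε) ε ∈ 𝓝[≤] τ := fun τ hτ =>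
        mem_of_superset (Icc_mem_nhdsLE_of_mem hτ) hsub
      exact ODE_solution_unique_of_mem_Icc_left (v := fun _ => f)
        (s := fun _ => closedBall (x₀, (0 : E)) a) (K := K) (fun _ _ => hlip)
        (fun τ hτ => ((hu τ (hsub hτ)).1.mono hsub).continuousWithinAt)
        (fun τ hτ => (hu τ (hsub (Ioc_subset_Icc_self hτ))).1.mono_of_mem_nhdsWithin (hnhds τ hτ))
        (fun τ hτ => (hu τ (hsub (Ioc_subset_Icc_self hτ))).2)
        (fun τ hτ => ((hv τ (hsub hτ)).1.mono hsub).continuousWithinAt)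
        (fun τ hτ => (hv τ (hsub (Ioc_subset_Icc_self hτ))).1.mono_of_mem_nhdsWithin (hnhds τ hτ))
        (fun τ hτ => (hv τ (hsub (Ioc_subset_Icc_self hτ))).2) heq ⟨le_rfl, hle⟩
    · have hsub : Icc t₀ t ⊆ Icc (-ε) ε := Icc_subset_Icc ht₀.1 ht.2
      have hnhds : ∀ τ ∈ Ico t₀ t, Icc (-ε) ε ∈ 𝓝[≥] τ := fun τ hτ =>
        mem_of_superset (Icc_mem_nhdsGE_of_mem hτ) hsub
      exact ODE_solution_unique_of_mem_Icc_right (v := fun _ => f)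
        (s := fun _ => closedBall (x₀, (0 : E)) a) (K := K) (fun _ _ => hlip)
        (fun τ hτ => ((hu τ (hsub hτ)).1.mono hsub).continuousWithinAt)
        (fun τ hτ => (hu τ (hsub (Ico_subset_Icc_self hτ))).1.mono_of_mem_nhdsWithin (hnhds τ hτ))
        (fun τ hτ => (hu τ (hsub (Ico_subset_Icc_self hτ))).2)
        (fun τ hτ => ((hv τ (hsub hτ)).1.mono hsub).continuousWithinAt)
        (fun τ hτ => (hv τ (hsub (Ico_subset_Icc_self hτ))).1.mono_of_mem_nhdsWithin (hnhds τ hτ))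
        (fun τ hτ => (hv τ (hsub (Ico_subset_Icc_self hτ))).2) heq ⟨hle, le_rfl⟩
  have h0 : (0 : ℝ) ∈ Icc (-ε) ε := ⟨by linarith, hε.le⟩
  -- By degree two homogeneity, running a solution at speed c gives the solution with initial
  -- velocity multiplied by c. The condition |c| ≤ 1 keeps both in the flow domain.
  have hscale : ∀ z ∈ closedBall (x₀, (0 : E)) r, ∀ c : ℝ, |c| ≤ 1 → ∀ t ∈ Icc (-ε) ε,
        α (z.1, c • z.2) t = ((α z (c * t)).1, c • (α z (c * t)).2) := by
    intro z hz c hc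
    have hz' : (z.1, c • z.2) ∈ closedBall (x₀, (0 : E)) r := by
      rw [← closedBall_prod_same] at hz ⊢
      refine ⟨hz.1, ?_⟩
      simp only [mem_closedBall_zero_iff, norm_smul, Real.norm_eq_abs]
      calc |c| * ‖z.2‖ ≤ 1 * ‖z.2‖ := by gcongr
        _ ≤ r := by rw [one_mul]; exact mem_closedBall_zero_iff.1 hz.2
    have hct : MapsTo (fun t => c * t) (Icc (-ε) ε) (Icc (-ε) ε) := by
      intro t ht
      have : |c * t| ≤ ε := by
        rw [abs_mul]
        calc |c| * |t| ≤ 1 * ε := mul_le_mul hc (abs_le.2 ht) (abs_nonneg _) zero_le_one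
          _ = ε := one_mul _
      exact abs_le.1 this
    refine huniq _ _ 0 h0 (hα _ hz').2 (fun t ht => ?_) ?_
    · have h1 := (hα z hz).2 (c * t) (hct ht)
      have h2 : HasDerivWithinAt (fun t => α z (c * t)) (c • f (α z (c * t))) (Icc (-ε) ε) t := by
        refine h1.1.scomp t ?_ hct
        simpa using ((hasDerivAt_id t).const_mul c).hasDerivWithinAt
      have h4 := h1.2
      rw [hball] at h4
      refine ⟨?_, ?_⟩
      · have h3 := ((ContinuousLinearMap.fst ℝ E E).hasFDerivAt.comp_hasDerivWithinAt t h2).prodMk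
          (((ContinuousLinearMap.snd ℝ E E).hasFDerivAt.comp_hasDerivWithinAt t h2).const_smul c)
        refine h3.congr_deriv ?_
        simp only [hf, Prod.smul_mk, ContinuousLinearMap.coe_fst', ContinuousLinearMap.coe_snd']
        rw [h.spray_smul (haU h4.1), Prod.mk.eta, smul_smul, sq]
      · rw [hball]
        refine ⟨h4.1, ?_⟩
        simp only [mem_closedBall_zero_iff, norm_smul, Real.norm_eq_abs]
        calc |c| * ‖(α z (c * t)).2‖ ≤ 1 * ‖(α z (c * t)).2‖ := by gcongr
          _ ≤ a := by rw [one_mul]; exact mem_closedBall_zero_iff.1 h4.2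
    · simp only [mul_zero, (hα _ hz').1, (hα z hz).1]
  have hzero : ∀ z ∈ closedBall (x₀, (0 : E)) r, ∀ t ∈ Icc (-ε) ε, α (z.1, 0) t = (z.1, 0) := by
    intro z hz t ht
    have := hscale z hz 0 (by simp) t ht
    simpa [(hα z hz).1] using this
  have hz0 : ∀ z ∈ closedBall (x₀, (0 : E)) r, (z.1, (0 : E)) ∈ closedBall (x₀, (0 : E)) r := by
    intro z hz
    rw [← closedBall_prod_same] at hz ⊢
    exact ⟨hz.1, by simpa using hr.le⟩
  -- The solution with zero velocity is stationary, so the Lipschitz dependence on initial data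
  -- bounds the velocity by a multiple of the initial one.
  have hbd : ∀ z ∈ closedBall (x₀, (0 : E)) r, ∀ t ∈ Icc (-ε) ε, ‖(α z t).2‖ ≤ Λ * ‖z.2‖ := by
    intro z hz t ht
    have h1 := (hL t ht).norm_sub_le hz (hz0 z hz)
    rw [hzero z hz t ht] at h1
    have h2 : ‖(α z t).2‖ ≤ ‖α z t - (z.1, 0)‖ := by
      have := norm_snd_le (α z t - (z.1, 0))
      simpa only [Prod.snd_sub, sub_zero] using this
    have h3 : ‖z - (z.1, 0)‖ = ‖z.2‖ := by
      conv_lhs => rw [← Prod.mk.eta (p := z)]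
      simp only [Prod.mk_sub_mk, sub_self, sub_zero]
      simp [Prod.norm_mk]
    rw [h3] at h1
    exact h2.trans h1
  refine ⟨r, hr, ε, hε, max (Λ : ℝ) (C₀ * Λ * Λ), le_max_of_le_left Λ.coe_nonneg,
    closedBall x₀ a, haU, α, fun z hz => ⟨(hα z hz).1, fun t ht => ⟨((hα z hz).2 t ht).1, ?_⟩⟩,
    fun t ht => (hL t ht).weaken ?_, hscale, ?_, ?_⟩
  · have := ((hα z hz).2 t ht).2
    rw [hball] at this
    exact this.1
  · rw [← NNReal.coe_le_coe, Real.coe_toNNReal _ (le_max_of_le_left Λ.coe_nonneg)]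
    exact le_max_left _ _
  · intro z hz hne t ht h2
    -- If the velocity vanished at some time, the solution would coincide with a stationary one, by
    -- uniqueness in both directions of time.
    have h3 := (hα z hz).2 t ht
    have h4 := huniq (α z) (fun _ => ((α z t).1, 0)) t ht (hα z hz).2 (fun τ hτ => by
      refine ⟨?_, ?_⟩
      · simp only [hf, h.spray_zero]
        exact hasDerivWithinAt_const _ _ _
      · rw [hball] at h3 ⊢
        exact ⟨h3.2.1, by simpa using ha.le⟩) (Prod.ext rfl h2) h0
    rw [(hα z hz).1] at h4
    exact hne (congrArg Prod.snd h4)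
  · intro z hz z' hz' t ht
    have h1 := ((hα z hz).2 t ht).2
    have h1' := ((hα z' hz').2 t ht).2
    rw [hball] at h1 h1'
    set ρ := min 1 (Λ * max ‖z.2‖ ‖z'.2‖)
    have hρ0 : 0 ≤ ρ := le_min zero_le_one (by positivity)
    have h2 := hS _ h1.1 _ h1'.1 ρ (min_le_left _ _) (α z t).2 (α z' t).2
      (le_min ((mem_closedBall_zero_iff.1 h1.2).trans ha1)
        ((hbd z hz t ht).trans (by gcongr; exact le_max_left _ _)))
      (le_min ((mem_closedBall_zero_iff.1 h1'.2).trans ha1)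
        ((hbd z' hz' t ht).trans (by gcongr; exact le_max_right _ _)))
    simp only [Prod.mk.eta] at h2
    calc _ ≤ C₀ * ρ * ‖α z t - α z' t‖ := h2
      _ ≤ C₀ * (Λ * max ‖z.2‖ ‖z'.2‖) * (Λ * ‖z - z'‖) := by
        gcongr
        · exact min_le_right _ _
        · exact (hL t ht).norm_sub_le hz hz'
      _ = C₀ * Λ * Λ * max ‖z.2‖ ‖z'.2‖ * ‖z - z'‖ := by ring
      _ ≤ _ := by gcongr; exact le_max_right _ _

/-- The exponential map near a point of the zero section: it is strictly differentiable with
derivative `(q, v) ↦ q + v`, and `t ↦ X (q, t v)` is a solution of the Euler–Lagrange equation. -/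
theorem exists_exponential (h : IsLagrangian U L) {x₀ : E} (hx₀ : x₀ ∈ U) :
    ∃ X : E × E → E, HasStrictFDerivAt X
        (ContinuousLinearMap.fst ℝ E E + ContinuousLinearMap.snd ℝ E E) (x₀, 0) ∧
      ∀ᶠ z : E × E in 𝓝 (x₀, 0), ContinuousAt X z ∧ z.1 ∈ U ∧ X (z.1, 0) = z.1 ∧
        HasDerivAt (fun t : ℝ => X (z.1, t • z.2)) z.2 0 ∧
        (z.2 ≠ 0 → ∀ t ∈ Icc (-2 : ℝ) 2, X (z.1, t • z.2) ∈ U ∧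
          EulerLagrangeAt L (fun t => X (z.1, t • z.2)) (Icc (-2) 2) t) := by
  obtain ⟨r, hr, ε, hε, C, hC, N, hN, α, hα, hL, hscale, hne, hS⟩ := h.exists_spray_flow hx₀
  have hIcc0 : (0 : ℝ) ∈ Icc (-ε) ε := ⟨by linarith, hε.le⟩
  -- rescale time so that the unit time map is defined with room to spare
  set k : ℝ := 4 / ε with hk
  have hk0 : 0 < k := by positivity
  have hkε : k⁻¹ = ε / 4 := by rw [hk, inv_div]
  have hk1 : k⁻¹ ∈ Icc (-ε) ε := by rw [hkε]; constructor <;> linarith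
  set X : E × E → E := fun z => (α (z.1, k • z.2) k⁻¹).1 with hX
  let B : Set (E × E) := ball x₀ r ×ˢ ball 0 (r / (2 * k))
  have hB : IsOpen B := isOpen_ball.prod isOpen_ball
  have hxB : (x₀, (0 : E)) ∈ B := ⟨mem_ball_self hr, mem_ball_self (by positivity)⟩
  -- The factor 2k, rather than k, leaves room to follow the curve X(q, t v) for all t in [-2, 2].
  -- Convexity is later used at t = -1 and at reflected points, which needs more than [0, 1].
  have hmem2 : ∀ z ∈ B, (z.1, (2 * k) • z.2) ∈ closedBall (x₀, (0 : E)) r := by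
    intro z hz
    rw [← closedBall_prod_same]
    refine ⟨ball_subset_closedBall hz.1, ?_⟩
    simp only [mem_closedBall_zero_iff, norm_smul, Real.norm_eq_abs, abs_of_pos (mul_pos two_pos hk0)]
    have := mem_ball_zero_iff.1 hz.2
    rw [lt_div_iff₀ (by positivity)] at this
    linarith
  have hmem1 : ∀ z ∈ B, (z.1, k • z.2) ∈ closedBall (x₀, (0 : E)) r := by
    intro z hz
    have h1 := hmem2 z hz
    rw [← closedBall_prod_same] at h1 ⊢
    refine ⟨h1.1, ?_⟩
    have h2 := h1.2
    simp only [mem_closedBall_zero_iff, norm_smul, Real.norm_eq_abs, abs_of_pos hk0,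
      abs_of_pos (mul_pos two_pos hk0)] at h2 ⊢
    nlinarith [mul_nonneg hk0.le (norm_nonneg z.2)]
  -- the curves `t ↦ X (q, t v)`
  have hcurve : ∀ z ∈ B, ∀ t ∈ Icc (-2 : ℝ) 2,
      X (z.1, t • z.2) = (α (z.1, (2 * k) • z.2) ((2 * k)⁻¹ * t)).1 := by
    intro z hz t ht
    have h1 := hscale _ (hmem2 z hz) (t / 2) (by
      rw [abs_le]; constructor <;> linarith [ht.1, ht.2]) k⁻¹ hk1
    have h2 : (t / 2) • (2 * k) • z.2 = k • t • z.2 := by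
      rw [smul_smul, smul_smul]; congr 1; ring
    rw [h2] at h1
    simp only [hX, h1]
    congr 2
    field_simp
  have hmap : MapsTo (fun t => (2 * k)⁻¹ * t) (Icc (-2 : ℝ) 2) (Icc (-ε) ε) := by
    intro t ht
    have h1 : (2 * k)⁻¹ = ε / 8 := by rw [mul_inv, hkε]; ring
    simp only [h1, mem_Icc]
    constructor <;> nlinarith [ht.1, ht.2]
  refine ⟨X, ?_, ?_⟩
  · -- strict differentiability
    rw [hasStrictFDerivAt_iff_isLittleO, Asymptotics.isLittleO_iff]
    intro c hc
    -- M - 1 collects the constants of the estimate below, and the added 1 keeps M positive.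
    -- Velocities smaller than c/M make the final error at most c ‖z - z'‖.
    set M : ℝ := C * k * (1 + k) * k⁻¹ * k⁻¹ + 1
    have hM : 0 < M := by positivity
    have hB' : B ∩ (univ ×ˢ ball 0 (c / M)) ∈ 𝓝 (x₀, (0 : E)) :=
      (hB.inter (isOpen_univ.prod isOpen_ball)).mem_nhds
        ⟨hxB, mem_univ _, mem_ball_self (by positivity)⟩
    filter_upwards [prod_mem_nhds hB' hB'] with p hp
    obtain ⟨z, z'⟩ := p
    obtain ⟨⟨hz, -, hzc⟩, ⟨hz', -, hzc'⟩⟩ := hp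
    simp only at hz hz' hzc hzc' ⊢
    set w := (z.1, k • z.2)
    set w' := (z'.1, k • z'.2)
    have hw := hmem1 z hz
    have hw' := hmem1 z' hz'
    set A : ℝ := C * max ‖w.2‖ ‖w'.2‖ * ‖w - w'‖
    have hA0 : 0 ≤ A := by positivity
    have hsub : Icc 0 k⁻¹ ⊆ Icc (-ε) ε := Icc_subset_Icc hIcc0.1 hk1.2
    have h0mem : (0 : ℝ) ∈ Icc 0 k⁻¹ := ⟨le_rfl, by positivity⟩
    -- The difference of the accelerations is at most A, which carries the factor max(|w.2|,
    -- |w'.2|). Integrating once controls the change of the velocity difference, and a second time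
    -- the deviation from straight motion.
    have h1 : ∀ t ∈ Icc 0 k⁻¹, ‖((α w t).2 - (α w' t).2) - (w.2 - w'.2)‖ ≤ A * k⁻¹ := by
      intro t ht
      have h2 : ∀ τ ∈ Icc 0 k⁻¹, HasDerivWithinAt (fun τ => (α w τ).2 - (α w' τ).2)
          (h.spray (α w τ) - h.spray (α w' τ)) (Icc 0 k⁻¹) τ := fun τ hτ =>
        ((ContinuousLinearMap.snd ℝ E E).hasFDerivAt.comp_hasDerivWithinAt τ
          (((hα w hw).2 τ (hsub hτ)).1.mono hsub)).sub
        ((ContinuousLinearMap.snd ℝ E E).hasFDerivAt.comp_hasDerivWithinAt τ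
          (((hα w' hw').2 τ (hsub hτ)).1.mono hsub))
      have h3 := (convex_Icc 0 k⁻¹).norm_image_sub_le_of_norm_hasDerivWithin_le h2
        (fun τ hτ => hS w hw w' hw' τ (hsub hτ)) h0mem ht
      rw [(hα w hw).1, (hα w' hw').1] at h3
      refine h3.trans ?_
      gcongr
      rw [sub_zero, Real.norm_eq_abs, abs_of_nonneg ht.1]
      exact ht.2
    have h4 : ∀ τ ∈ Icc 0 k⁻¹, HasDerivWithinAt
        (fun τ => (α w τ).1 - (α w' τ).1 - τ • (w.2 - w'.2))
        (((α w τ).2 - (α w' τ).2) - (w.2 - w'.2)) (Icc 0 k⁻¹) τ := fun τ hτ => by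
      have h5 := ((ContinuousLinearMap.fst ℝ E E).hasFDerivAt.comp_hasDerivWithinAt τ
          (((hα w hw).2 τ (hsub hτ)).1.mono hsub)).sub
        ((ContinuousLinearMap.fst ℝ E E).hasFDerivAt.comp_hasDerivWithinAt τ
          (((hα w' hw').2 τ (hsub hτ)).1.mono hsub))
      refine h5.sub ?_
      simpa using ((hasDerivAt_id τ).smul_const (w.2 - w'.2)).hasDerivWithinAt
    have h6 := (convex_Icc 0 k⁻¹).norm_image_sub_le_of_norm_hasDerivWithin_le h4 h1 h0mem
      (right_mem_Icc.2 (by positivity))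
    rw [(hα w hw).1, (hα w' hw').1] at h6
    have h7 : X z - X z' - (ContinuousLinearMap.fst ℝ E E + ContinuousLinearMap.snd ℝ E E) (z - z') =
        (α w k⁻¹).1 - (α w' k⁻¹).1 - k⁻¹ • (w.2 - w'.2) - (w.1 - w'.1 - (0 : ℝ) • (w.2 - w'.2)) := by
      simp only [w, w', ← smul_sub, inv_smul_smul₀ hk0.ne', zero_smul, sub_zero, hX,
        _root_.add_apply, ContinuousLinearMap.coe_fst', ContinuousLinearMap.coe_snd', Prod.fst_sub,
        Prod.snd_sub]
      abel
    rw [h7]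
    refine h6.trans ?_
    have hw2 : ‖w - w'‖ ≤ (1 + k) * ‖z - z'‖ := by
      simp only [w, w', Prod.mk_sub_mk, ← smul_sub, Prod.norm_mk, norm_smul, Real.norm_eq_abs,
        abs_of_pos hk0]
      have e1 : ‖z.1 - z'.1‖ ≤ ‖z - z'‖ := norm_fst_le (z - z')
      have e2 : ‖z.2 - z'.2‖ ≤ ‖z - z'‖ := norm_snd_le (z - z')
      refine max_le ?_ ?_
      · nlinarith [norm_nonneg (z - z')]
      · nlinarith [norm_nonneg (z - z')]
    have hw3 : max ‖w.2‖ ‖w'.2‖ ≤ k * (c / M) := by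
      simp only [w, w', norm_smul, Real.norm_eq_abs, abs_of_pos hk0]
      rw [mem_ball_zero_iff] at hzc hzc'
      exact max_le (by gcongr) (by gcongr)
    rw [sub_zero, Real.norm_eq_abs, abs_of_pos (inv_pos.2 hk0)]
    calc A * k⁻¹ * k⁻¹ ≤ C * (k * (c / M)) * ((1 + k) * ‖z - z'‖) * k⁻¹ * k⁻¹ := by
          simp only [A]; gcongr
      _ = (M - 1) * (c / M) * ‖z - z'‖ := by simp only [M]; ring
      _ ≤ M * (c / M) * ‖z - z'‖ := by gcongr; linarith
      _ = c * ‖z - z'‖ := by rw [mul_div_cancel₀ _ hM.ne']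
  · filter_upwards [hB.mem_nhds hxB] with z hz
    have hX0 : X (z.1, 0) = z.1 := by
      have h1 := hcurve z hz 0 ⟨by norm_num, by norm_num⟩
      rw [zero_smul, mul_zero, (hα _ (hmem2 z hz)).1] at h1
      exact h1
    have hder : ∀ t ∈ Icc (-2 : ℝ) 2, HasDerivWithinAt
        (fun t => α (z.1, (2 * k) • z.2) ((2 * k)⁻¹ * t))
        ((2 * k)⁻¹ • ((α (z.1, (2 * k) • z.2) ((2 * k)⁻¹ * t)).2,
          h.spray (α (z.1, (2 * k) • z.2) ((2 * k)⁻¹ * t)))) (Icc (-2) 2) t := by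
      intro t ht
      refine ((hα _ (hmem2 z hz)).2 _ (hmap ht)).1.scomp t ?_ hmap
      simpa using ((hasDerivAt_id t).const_mul (2 * k)⁻¹).hasDerivWithinAt
    refine ⟨?_, hN ?_, hX0, ?_, fun hz2 t ht => ?_⟩
    · have h1 := (hL k⁻¹ hk1).continuousOn
      have h2 : ContinuousOn (fun z : E × E => α (z.1, k • z.2) k⁻¹) B :=
        h1.comp (by fun_prop) hmem1
      exact (continuous_fst.comp_continuousOn h2).continuousAt (hB.mem_nhds hz)
    · have := ((hα _ (hmem2 z hz)).2 0 hIcc0).2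
      rwa [(hα _ (hmem2 z hz)).1] at this
    · have h1 := ((ContinuousLinearMap.fst ℝ E E).hasFDerivAt.comp_hasDerivWithinAt 0
        (hder 0 ⟨by norm_num, by norm_num⟩)).hasDerivAt (Icc_mem_nhds (by norm_num) (by norm_num))
      simp only [mul_zero, (hα _ (hmem2 z hz)).1, Prod.smul_mk, ContinuousLinearMap.coe_fst',
        inv_smul_smul₀ (mul_pos two_pos hk0).ne'] at h1
      refine h1.congr_of_eventuallyEq ?_
      filter_upwards [Icc_mem_nhds (by norm_num : (-2 : ℝ) < 0) (by norm_num : (0 : ℝ) < 2)]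
        with t ht using hcurve z hz t ht
    · -- the rescaled solution of the spray equation
      set u : ℝ → E × E := fun t => ((α (z.1, (2 * k) • z.2) ((2 * k)⁻¹ * t)).1,
        (2 * k)⁻¹ • (α (z.1, (2 * k) • z.2) ((2 * k)⁻¹ * t)).2) with hu
      have hk2 : (2 * k)⁻¹ ≠ 0 := by positivity
      have huU : ∀ t ∈ Icc (-2 : ℝ) 2, u t ∈ U ×ˢ ({0}ᶜ : Set E) := fun t ht =>
        ⟨hN ((hα _ (hmem2 z hz)).2 _ (hmap ht)).2, smul_ne_zero hk2
          (hne _ (hmem2 z hz) (smul_ne_zero (by positivity) hz2) _ (hmap ht))⟩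
      have hud : ∀ t ∈ Icc (-2 : ℝ) 2,
          HasDerivWithinAt u ((u t).2, h.spray (u t)) (Icc (-2) 2) t := by
        intro t ht
        have h3 := ((ContinuousLinearMap.fst ℝ E E).hasFDerivAt.comp_hasDerivWithinAt t
          (hder t ht)).prodMk (((ContinuousLinearMap.snd ℝ E E).hasFDerivAt.comp_hasDerivWithinAt t
          (hder t ht)).const_smul (2 * k)⁻¹)
        refine h3.congr_deriv ?_
        simp only [hu, Prod.smul_mk, ContinuousLinearMap.coe_fst', ContinuousLinearMap.coe_snd']
        rw [h.spray_smul (huU t ht).1, smul_smul, sq]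
      obtain ⟨h5, h6, -⟩ := h.eulerLagrangeAt_of_hasDerivWithinAt (z := fun t => legendre L (u t))
        (uniqueDiffOn_Icc (by norm_num)) (fun t ht => h.legendre_mem (huU t ht))
        (fun t ht => h.hasDerivWithinAt_legendre_of_spray (hud t ht) (huU t ht)) ht
      have h7 : EqOn (fun t : ℝ => X (z.1, t • z.2)) (fun t => (u t).1) (Icc (-2) 2) :=
        fun t ht => hcurve z hz t ht
      have h8 : ∀ t ∈ Icc (-2 : ℝ) 2, derivWithin (fun t : ℝ => X (z.1, t • z.2)) (Icc (-2) 2) t =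
          derivWithin (fun t => (u t).1) (Icc (-2) 2) t := fun t ht => derivWithin_congr h7 (h7 ht)
      refine ⟨by rw [hcurve z hz t ht]; exact h5, ?_⟩
      refine ⟨h6.1.congr h7 (h7 ht), by rw [h8 t ht]; exact h6.2.1, ?_⟩
      rw [h8 t ht, show (fun t : ℝ => X (z.1, t • z.2)) t = (u t).1 from h7 ht]
      exact h6.2.2.congr (fun τ hτ => by
          simp only [h8 τ hτ]; rw [show X (z.1, τ • z.2) = (u τ).1 from h7 hτ]; rfl)
        (by simp only [h8 t ht]; rw [show X (z.1, t • z.2) = (u t).1 from h7 ht]; rfl)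

end IsLagrangian
end Exponential

/-! ### The local logarithm and the comparison of geodesic with affine interpolation. -/

section GeodesicConvexity

variable {E : Type*} [NormedAddCommGroup E] [NormedSpace ℝ E] [CompleteSpace E] {X : E × E → E}
  {x₀ : E}

/-- A local inverse of the exponential map near the diagonal. -/
theorem exists_logarithm (hX : HasStrictFDerivAt X
      (ContinuousLinearMap.fst ℝ E E + ContinuousLinearMap.snd ℝ E E) (x₀, 0))
    (hX0 : ∀ᶠ z : E × E in 𝓝 (x₀, 0), X (z.1, 0) = z.1) :
    ∃ l : E × E → E, HasStrictFDerivAt l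
        (ContinuousLinearMap.snd ℝ E E - ContinuousLinearMap.fst ℝ E E) (x₀, x₀) ∧
      l (x₀, x₀) = 0 ∧ (∀ᶠ p in 𝓝 x₀, l (p, p) = 0) ∧
      ∀ᶠ z : E × E in 𝓝 (x₀, x₀), X (z.1, l z) = z.2 := by
  let A : (E × E) ≃L[ℝ] E × E := ContinuousLinearEquiv.equivOfInverse
    ((ContinuousLinearMap.fst ℝ E E).prod
      (ContinuousLinearMap.fst ℝ E E + ContinuousLinearMap.snd ℝ E E))
    ((ContinuousLinearMap.fst ℝ E E).prod
      (ContinuousLinearMap.snd ℝ E E - ContinuousLinearMap.fst ℝ E E))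
    (fun z => by simp) (fun z => by simp)
  -- The map (x, v) ↦ (x, X(x, v)) has the invertible derivative (x, v) ↦ (x, x + v); the logarithm
  -- is the second component of its local inverse.
  have hP : HasStrictFDerivAt (fun z : E × E => (z.1, X z)) (A : E × E →L[ℝ] E × E) (x₀, 0) :=
    hasStrictFDerivAt_fst.prodMk hX
  have hX00 : X (x₀, 0) = x₀ := hX0.self_of_nhds
  set g := hP.localInverse (fun z : E × E => (z.1, X z)) A (x₀, 0)
  have hg : HasStrictFDerivAt g (A.symm : E × E →L[ℝ] E × E) (x₀, x₀) := by
    have := hP.to_localInverse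
    simp only [hX00] at this
    exact this
  have hr : ∀ᶠ z in 𝓝 ((x₀, x₀) : E × E), ((g z).1, X (g z)) = z := by
    have := hP.eventually_right_inverse
    simp only [hX00] at this
    exact this
  have hl : ∀ᶠ z in 𝓝 ((x₀, 0) : E × E), g (z.1, X z) = z := hP.eventually_left_inverse
  have hdiag : ∀ᶠ p in 𝓝 x₀, g (p, p) = (p, 0) := by
    have hc : Tendsto (fun p : E => (p, (0 : E))) (𝓝 x₀) (𝓝 (x₀, 0)) :=
      (Continuous.prodMk_left (0 : E)).tendsto x₀
    filter_upwards [hc.eventually hl, hc.eventually hX0] with p h1 h2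
    simpa [h2] using h1
  refine ⟨fun z => (g z).2, ?_, ?_, ?_, ?_⟩
  · exact (ContinuousLinearMap.snd ℝ E E).hasStrictFDerivAt.comp (x₀, x₀) hg
  · exact congrArg Prod.snd hdiag.self_of_nhds
  · filter_upwards [hdiag] with p hp using congrArg Prod.snd hp
  · filter_upwards [hr] with z hz
    have h1 : (g z).1 = z.1 := (Prod.ext_iff.1 hz).1
    have h2 : X (g z) = z.2 := (Prod.ext_iff.1 hz).2
    rw [← h2, ← h1]

theorem HasStrictFDerivAt.exists_ball_norm_sub_le {F G : Type*} [NormedAddCommGroup F]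
    [NormedSpace ℝ F] [NormedAddCommGroup G] [NormedSpace ℝ G] {f : F → G} {f' : F →L[ℝ] G} {x : F}
    (hf : HasStrictFDerivAt f f' x) {η : ℝ} (hη : 0 < η) :
    ∃ δ > 0, ∀ y ∈ ball x δ, ∀ z ∈ ball x δ, ‖f y - f z - f' (y - z)‖ ≤ η * ‖y - z‖ := by
  have h := (hasStrictFDerivAt_iff_isLittleO.1 hf).def hη
  obtain ⟨δ, hδ, hb⟩ := Metric.eventually_nhds_iff_ball.1 h
  exact ⟨δ, hδ, fun y hy z hz => hb (y, z) (by rw [← ball_prod_same]; exact ⟨hy, hz⟩)⟩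

/-- The geodesic interpolation `X (p, r log_p a)` is close to affine interpolation. -/
theorem exists_ball_geodesic_interpolation (hX : HasStrictFDerivAt X
      (ContinuousLinearMap.fst ℝ E E + ContinuousLinearMap.snd ℝ E E) (x₀, 0)) {l : E × E → E}
    (hl : HasStrictFDerivAt l
        (ContinuousLinearMap.snd ℝ E E - ContinuousLinearMap.fst ℝ E E) (x₀, x₀))
    (hl0 : l (x₀, x₀) = 0) (hdiag : ∀ᶠ p in 𝓝 x₀, l (p, p) = 0) {η : ℝ} (hη : 0 < η) :
    ∃ δ > 0, ∀ p ∈ ball x₀ δ, ∀ a ∈ ball x₀ δ, ∀ a' ∈ ball x₀ δ, ∀ r ∈ Icc (0 : ℝ) 1,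
      ∀ r' ∈ Icc (0 : ℝ) 1, ‖X (p, r • l (p, a)) - X (p, r' • l (p, a')) -
        (r • (a - p) - r' • (a' - p))‖ ≤ η * (‖a - a'‖ + |r - r'| * ‖a' - p‖) := by
  -- The total error factor is κ(1 + κ) + κ, which is at most 3κ ≤ η when κ ≤ 1.
  set κ := min (η / 3) 1
  have hκ : 0 < κ := lt_min (by positivity) one_pos
  have hκ1 : κ ≤ 1 := min_le_right _ _
  have hκη : 3 * κ ≤ η := by have := min_le_left (η / 3) 1; simp only [κ]; linarith
  obtain ⟨δ₁, hδ₁, hX1⟩ := hX.exists_ball_norm_sub_le hκ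
  obtain ⟨δ₂, hδ₂, hl1⟩ := hl.exists_ball_norm_sub_le hκ
  obtain ⟨δ₃, hδ₃, hl2⟩ := Metric.eventually_nhds_iff_ball.1 hdiag
  have hlc : ∀ᶠ z in 𝓝 (x₀, x₀), l z ∈ ball (0 : E) δ₁ := by
    have := hl.continuousAt.tendsto
    rw [hl0] at this
    exact this.eventually (ball_mem_nhds _ hδ₁)
  obtain ⟨δ₄, hδ₄, hl3⟩ := Metric.eventually_nhds_iff_ball.1 hlc
  set δ := min (min δ₁ δ₂) (min δ₃ δ₄)
  have hδ : 0 < δ := by positivity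
  have hδ1 : δ ≤ δ₁ := (min_le_left _ _).trans (min_le_left _ _)
  have hδ2 : δ ≤ δ₂ := (min_le_left _ _).trans (min_le_right _ _)
  have hδ3 : δ ≤ δ₃ := (min_le_right _ _).trans (min_le_left _ _)
  have hδ4 : δ ≤ δ₄ := (min_le_right _ _).trans (min_le_right _ _)
  refine ⟨δ, hδ, fun p hp a ha a' ha' r hr r' hr' => ?_⟩
  have hpair : ∀ {δ' : ℝ} {b : E}, δ ≤ δ' → b ∈ ball x₀ δ → (p, b) ∈ ball (x₀, x₀) δ' := by
    intro δ' b h hb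
    rw [← ball_prod_same]
    exact ⟨ball_subset_ball h hp, ball_subset_ball h hb⟩
  have hv : ∀ b ∈ ball x₀ δ, ∀ ρ ∈ Icc (0 : ℝ) 1, (p, ρ • l (p, b)) ∈ ball (x₀, (0 : E)) δ₁ := by
    intro b hb ρ hρ
    rw [← ball_prod_same]
    refine ⟨ball_subset_ball hδ1 hp, ?_⟩
    have := mem_ball_zero_iff.1 (hl3 _ (hpair hδ4 hb))
    rw [mem_ball_zero_iff, norm_smul, Real.norm_eq_abs, abs_of_nonneg hρ.1]
    nlinarith [norm_nonneg (l (p, b)), hρ.2]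
  have hll : ∀ b ∈ ball x₀ δ, ∀ b' ∈ ball x₀ δ, ‖l (p, b) - l (p, b') - (b - b')‖ ≤ κ * ‖b - b'‖ := by
    intro b hb b' hb'
    simpa [Prod.norm_mk] using hl1 (p, b) (hpair hδ2 hb) (p, b') (hpair hδ2 hb')
  have h1 := hX1 _ (hv a ha r hr) _ (hv a' ha' r' hr')
  have h2 := hll a ha a' ha'
  have h3 := hll a' ha' p hp
  rw [hl2 p (ball_subset_ball hδ3 hp), sub_zero] at h3
  set v := r • l (p, a)
  set v' := r' • l (p, a')
  set Q := ‖a - a'‖ + |r - r'| * ‖a' - p‖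
  have h4 : v - v' - (r • (a - p) - r' • (a' - p)) =
      r • (l (p, a) - l (p, a') - (a - a')) + (r - r') • (l (p, a') - (a' - p)) := by
    simp only [v, v']
    module
  have h5 : ‖v - v' - (r • (a - p) - r' • (a' - p))‖ ≤ κ * Q := by
    rw [h4]
    refine (norm_add_le _ _).trans ?_
    rw [norm_smul, norm_smul, Real.norm_eq_abs, Real.norm_eq_abs, abs_of_nonneg hr.1]
    have e1 : r * ‖l (p, a) - l (p, a') - (a - a')‖ ≤ 1 * (κ * ‖a - a'‖) := by
      gcongr; exact hr.2
    have e2 : |r - r'| * ‖l (p, a') - (a' - p)‖ ≤ |r - r'| * (κ * ‖a' - p‖) := by gcongr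
    simp only [Q]
    linarith
  have h6 : ‖r • (a - p) - r' • (a' - p)‖ ≤ Q := by
    have : r • (a - p) - r' • (a' - p) = r • (a - a') + (r - r') • (a' - p) := by module
    rw [this]
    refine (norm_add_le _ _).trans ?_
    rw [norm_smul, norm_smul, Real.norm_eq_abs, Real.norm_eq_abs, abs_of_nonneg hr.1]
    have : r * ‖a - a'‖ ≤ 1 * ‖a - a'‖ := by gcongr; exact hr.2
    simp only [Q]
    linarith
  have hQ : 0 ≤ Q := by positivity
  have h7 : ‖v - v'‖ ≤ (1 + κ) * Q := by
    have := norm_sub_norm_le (v - v') (r • (a - p) - r' • (a' - p))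
    linarith
  have h8 : ‖X (p, v) - X (p, v') - (v - v')‖ ≤ κ * ((1 + κ) * Q) := by
    refine le_trans ?_ (mul_le_mul_of_nonneg_left h7 hκ.le)
    simpa [Prod.norm_mk] using h1
  calc ‖X (p, v) - X (p, v') - (r • (a - p) - r' • (a' - p))‖
      = ‖(X (p, v) - X (p, v') - (v - v')) + (v - v' - (r • (a - p) - r' • (a' - p)))‖ := by
        congr 1; abel
    _ ≤ κ * ((1 + κ) * Q) + κ * Q := (norm_add_le _ _).trans (add_le_add h8 h5)
    _ ≤ 3 * κ * Q := by nlinarith [mul_nonneg hκ.le hQ]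
    _ ≤ η * Q := by gcongr

end GeodesicConvexity

/-! ### Continuity of functions that are convex along geodesics. -/

section ConvexContinuity

variable {E : Type*} [NormedAddCommGroup E] [InnerProductSpace ℝ E] [CompleteSpace E]
  [FiniteDimensional ℝ E] {X : E × E → E} {x₀ : E} {f : E → ℝ}

/-- Interpolation bound for a function which is convex along the curves `t ↦ X (p, t v)`. -/
theorem le_max_of_convexOn_line {p v : E} (hconv : ConvexOn ℝ (Icc (-2 : ℝ) 2) (fun t => f (X (p, t • v))))
    {r : ℝ} (hr : r ∈ Icc (0 : ℝ) 1) : f (X (p, r • v)) ≤ max (f (X (p, 0))) (f (X (p, v))) := by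
  have h := hconv.2 (x := 0) ⟨by norm_num, by norm_num⟩ (y := 1) ⟨by norm_num, by norm_num⟩
    (sub_nonneg.2 hr.2) hr.1 (by ring)
  simp only [smul_eq_mul, mul_zero, mul_one, zero_add, zero_smul, one_smul] at h
  refine h.trans ?_
  have h1 := le_max_left (f (X (p, 0))) (f (X (p, v)))
  have h2 := le_max_right (f (X (p, 0))) (f (X (p, v)))
  nlinarith [hr.1, hr.2]

/-- By coning off repeatedly, one finds an approximately linear family of points of any dimension
on which a geodesically convex function is bounded above. -/
theorem exists_approximatesLinear_bounded (hX : HasStrictFDerivAt X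
      (ContinuousLinearMap.fst ℝ E E + ContinuousLinearMap.snd ℝ E E) (x₀, 0))
    (hf : ∀ᶠ z : E × E in 𝓝 (x₀, 0), X (z.1, 0) = z.1 ∧
      ConvexOn ℝ (Icc (-2 : ℝ) 2) (fun t => f (X (z.1, t • z.2))))
    {ι : Type*} [Fintype ι] (b : OrthonormalBasis ι ℝ E) (S : Finset ι) :
    ∀ η > 0, ∀ ρ > 0, ∃ (R : E → E) (u : E) (δ K : ℝ), 0 < δ ∧
      (∀ w ∈ ball u δ, R w ∈ ball x₀ ρ ∧ f (R w) ≤ K) ∧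
      ∀ w ∈ ball u δ, ∀ w' ∈ ball u δ,
        ‖R w - R w' - ∑ i ∈ S, inner ℝ (b i) (w - w') • b i‖ ≤ η * ‖w - w'‖ := by
  classical
  obtain ⟨l, hl, hl0, hdiag, hXl⟩ := exists_logarithm hX (hf.mono fun _ h => h.1)
  induction S using Finset.induction_on with
  | empty =>
    intro η hη ρ hρ
    refine ⟨fun _ => x₀, 0, 1, f x₀, one_pos, fun w _ => ⟨mem_ball_self hρ, le_rfl⟩, ?_⟩
    intro w _ w' _
    simp only [sub_self, Finset.sum_empty, norm_zero]
    positivity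
  | insert j S hj ih =>
    intro η hη ρ hρ
    set T : E →L[ℝ] E := ∑ i ∈ S, (innerSL ℝ (b i)).smulRight (b i) with hT
    have hTapp : ∀ w, T w = ∑ i ∈ S, inner ℝ (b i) w • b i := by
      intro w; simp [hT]
    set B : ℝ := ‖T‖ + η / 3 with hB
    have hB0 : 0 < B := by positivity
    set η₂ : ℝ := min (η / (3 * (2 * B + 1))) 1
    have hη₂ : 0 < η₂ := by positivity
    obtain ⟨δ₀, hδ₀, hint⟩ := exists_ball_geodesic_interpolation hX hl hl0 hdiag hη₂
    -- a ball in which convexity is available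
    have hgood : ∀ᶠ z : E × E in 𝓝 (x₀, x₀), X (z.1, l z) = z.2 ∧ X (z.1, 0) = z.1 ∧
        ConvexOn ℝ (Icc (-2 : ℝ) 2) (fun t => f (X (z.1, t • l z))) := by
      have hc : Tendsto (fun z : E × E => (z.1, l z)) (𝓝 (x₀, x₀)) (𝓝 (x₀, 0)) := by
        have h1 : ContinuousAt (fun z : E × E => (z.1, l z)) (x₀, x₀) :=
          continuousAt_fst.prodMk hl.continuousAt
        simpa [ContinuousAt, hl0] using h1
      filter_upwards [hXl, hc.eventually hf] with z h1 h2 using ⟨h1, h2.1, h2.2⟩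
    obtain ⟨δ₁, hδ₁, hgood⟩ := Metric.eventually_nhds_iff_ball.1 hgood
    set σ : ℝ := min (min δ₀ δ₁) ρ / 16
    have hσ : 0 < σ := by positivity
    have hσ0 : 16 * σ ≤ δ₀ := by
      have : min (min δ₀ δ₁) ρ ≤ δ₀ := (min_le_left _ _).trans (min_le_left _ _)
      simp only [σ]; linarith
    have hσ1 : 16 * σ ≤ δ₁ := by
      have : min (min δ₀ δ₁) ρ ≤ δ₁ := (min_le_left _ _).trans (min_le_right _ _)
      simp only [σ]; linarith
    have hσρ : 16 * σ ≤ ρ := by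
      have : min (min δ₀ δ₁) ρ ≤ ρ := min_le_right _ _
      simp only [σ]; linarith
    obtain ⟨R, u, δ, K, hδ, hR, hRl⟩ := ih (η / 3) (by positivity) σ hσ
    have hu := hR u (mem_ball_self hδ)
    -- The apex of the cone. In the affine model p + (1 - t/σ)(Rw - p) = Rw + (t/σ)(p - Rw), and p -
    -- Rw is close to σ b_j, so coning with parameter t = ⟨b_j, w - u⟩ adds the direction b_j to the
    -- linear part.
    set p := R u + σ • b j with hp
    have hbj : ‖b j‖ = 1 := b.orthonormal.1 j
    have hpu : ‖p - R u‖ = σ := by simp [hp, norm_smul, hbj, abs_of_pos hσ]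
    have hpx : p ∈ ball x₀ (2 * σ) := by
      rw [mem_ball_iff_norm]
      have h1 := mem_ball_iff_norm.1 hu.1
      have h2 := norm_add_le (p - R u) (R u - x₀)
      rw [sub_add_sub_cancel] at h2
      linarith
    -- The three bounds keep the new ball inside the old one, keep t/σ at most 1, and make the error
    -- from replacing Rw by Ru at most η/3.
    set δ' : ℝ := min (min (δ / 2) (σ / 2)) (η * σ / (12 * B))
    have hδ' : 0 < δ' := by positivity
    have hδ'1 : 2 * δ' ≤ δ := by
      have : δ' ≤ δ / 2 := (min_le_left _ _).trans (min_le_left _ _)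
      linarith
    have hδ'2 : 2 * δ' ≤ σ := by
      have : δ' ≤ σ / 2 := (min_le_left _ _).trans (min_le_right _ _)
      linarith
    have hδ'3 : 4 * B * δ' / σ ≤ η / 3 := by
      have : δ' ≤ η * σ / (12 * B) := min_le_right _ _
      rw [le_div_iff₀ (by positivity)] at this
      rw [div_le_iff₀ hσ]
      linarith
    have hRlip : ∀ w ∈ ball u δ, ∀ w' ∈ ball u δ, ‖R w - R w'‖ ≤ B * ‖w - w'‖ := by
      intro w hw w' hw'
      have h1 := hRl w hw w' hw'
      rw [← hTapp] at h1
      have h2 := norm_sub_norm_le (R w - R w') (T (w - w'))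
      have h3 := T.le_opNorm (w - w')
      simp only [hB]
      linarith
    -- Moving the centre by δ' b_j makes t positive on the whole ball. The parameter 1 - t/σ then
    -- lies in [0, 1], so convexity bounds f by its values at the apex and at the base point.
    have hdom : ∀ w ∈ ball (u + δ' • b j) δ', ‖w - u‖ < 2 * δ' ∧ 0 < inner ℝ (b j) (w - u) := by
      intro w hw
      rw [mem_ball_iff_norm] at hw
      have h1 : w - u = (w - (u + δ' • b j)) + δ' • b j := by abel
      constructor
      · rw [h1]
        refine (norm_add_le _ _).trans_lt ?_
        rw [norm_smul, hbj, Real.norm_eq_abs, abs_of_pos hδ']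
        linarith
      · rw [h1, inner_add_right, inner_smul_right, real_inner_self_eq_norm_sq, hbj]
        have h2 := abs_real_inner_le_norm (b j) (w - (u + δ' • b j))
        rw [hbj, one_mul] at h2
        have h3 := (abs_le.1 h2).1
        linarith
    have hdom' : ∀ w ∈ ball (u + δ' • b j) δ', w ∈ ball u δ := fun w hw => by
      rw [mem_ball_iff_norm]; linarith [(hdom w hw).1]
    have htle : ∀ w : E, |inner ℝ (b j) w| ≤ ‖w‖ := fun w => by
      have := abs_real_inner_le_norm (b j) w
      rwa [hbj, one_mul] at this
    have hr : ∀ w ∈ ball (u + δ' • b j) δ', 1 - inner ℝ (b j) (w - u) / σ ∈ Icc (0 : ℝ) 1 := by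
      intro w hw
      obtain ⟨h1, h2⟩ := hdom w hw
      have h3 := (abs_le.1 (htle (w - u))).2
      have h4 : inner ℝ (b j) (w - u) / σ ≤ 1 := (div_le_one hσ).2 (by linarith)
      have h5 : 0 ≤ inner ℝ (b j) (w - u) / σ := by positivity
      exact ⟨by linarith, by linarith⟩
    have hpa : ∀ w ∈ ball (u + δ' • b j) δ', ‖R w - p‖ ≤ 2 * B * δ' + σ := by
      intro w hw
      have h1 := hRlip w (hdom' w hw) u (mem_ball_self hδ)
      have h2 := norm_add_le (R w - R u) (R u - p)
      rw [sub_add_sub_cancel, norm_sub_rev (R u), hpu] at h2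
      have h3 : B * ‖w - u‖ ≤ B * (2 * δ') := by gcongr; exact (hdom w hw).1.le
      linarith
    have hbig : ∀ {r : ℝ}, 2 * σ ≤ r → ∀ w ∈ ball u δ, R w ∈ ball x₀ r := fun h w hw =>
      ball_subset_ball (by linarith) (hR w hw).1
    have hpair : ∀ w ∈ ball u δ, (p, R w) ∈ ball (x₀, x₀) δ₁ := fun w hw => by
      rw [← ball_prod_same]
      exact ⟨ball_subset_ball (by linarith) hpx, hbig (by linarith) w hw⟩
    refine ⟨fun w => X (p, (1 - inner ℝ (b j) (w - u) / σ) • l (p, R w)), u + δ' • b j, δ',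
      max (f p) K, hδ', fun w hw => ⟨?_, ?_⟩, fun w hw w' hw' => ?_⟩
    · have h1 := hint p (ball_subset_ball (by linarith) hpx) (R w) (hbig (by linarith) w (hdom' w hw))
        (R w) (hbig (by linarith) w (hdom' w hw)) _ (hr w hw) 0 ⟨le_rfl, zero_le_one⟩
      rw [zero_smul, zero_smul, sub_zero, sub_self, norm_zero, zero_add, sub_zero,
        (hgood _ (hpair w (hdom' w hw))).2.1] at h1
      set r := 1 - inner ℝ (b j) (w - u) / σ
      have hr1 := hr w hw
      have h2 : ‖R w - p‖ ≤ 3 * σ := by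
        have e1 := mem_ball_iff_norm.1 (hR w (hdom' w hw)).1
        have e2 := mem_ball_iff_norm.1 hpx
        have e3 := norm_sub_le (R w - x₀) (p - x₀)
        rw [sub_sub_sub_cancel_right] at e3
        linarith
      have h3 : η₂ * (|r| * ‖R w - p‖) ≤ 1 * (1 * (3 * σ)) := by
        gcongr
        · exact min_le_right _ _
        · rw [abs_of_nonneg hr1.1]; exact hr1.2
      have h4 : ‖r • (R w - p)‖ ≤ 1 * (3 * σ) := by
        rw [norm_smul, Real.norm_eq_abs, abs_of_nonneg hr1.1]
        gcongr
        exact hr1.2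
      rw [mem_ball_iff_norm]
      have h5 := mem_ball_iff_norm.1 hpx
      have h6 : X (p, r • l (p, R w)) - x₀ = (X (p, r • l (p, R w)) - p - r • (R w - p)) +
        (r • (R w - p) + (p - x₀)) := by abel
      rw [h6]
      have h7 := norm_add_le (X (p, r • l (p, R w)) - p - r • (R w - p)) (r • (R w - p) + (p - x₀))
      have h8 := norm_add_le (r • (R w - p)) (p - x₀)
      linarith
    · obtain ⟨h1, h2, h3⟩ := hgood _ (hpair w (hdom' w hw))
      have h4 := le_max_of_convexOn_line h3 (hr w hw)
      simp only at h1 h2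
      rw [h1, h2] at h4
      exact h4.trans (max_le_max le_rfl (hR w (hdom' w hw)).2)
    · rw [Finset.sum_insert hj]
      set t := inner ℝ (b j) (w - u) with ht
      set t' := inner ℝ (b j) (w' - u) with ht'
      set a := R w
      set a' := R w'
      have h1 := hint p (ball_subset_ball (by linarith) hpx) a (hbig (by linarith) w (hdom' w hw))
        a' (hbig (by linarith) w' (hdom' w' hw')) _ (hr w hw) _ (hr w' hw')
      have htt : t - t' = inner ℝ (b j) (w - w') := by
        rw [ht, ht', ← inner_sub_right, sub_sub_sub_cancel_right]
      have htt' : |t - t'| ≤ ‖w - w'‖ := by rw [htt]; exact htle _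
      have hrr : (1 - t / σ) - (1 - t' / σ) = -((t - t') / σ) := by ring
      have h2 : |(1 - t / σ) - (1 - t' / σ)| ≤ ‖w - w'‖ / σ := by
        rw [hrr, abs_neg, abs_div, abs_of_pos hσ]; gcongr
      have h3 := hRl w (hdom' w hw) w' (hdom' w' hw')
      have haa := hRlip w (hdom' w hw) w' (hdom' w' hw')
      have hau := hRlip w' (hdom' w' hw') u (mem_ball_self hδ)
      have ht2 : |t| ≤ 2 * δ' := (htle _).trans (hdom w hw).1.le
      -- the three error terms
      have e1 : η₂ * (‖a - a'‖ + |(1 - t / σ) - (1 - t' / σ)| * ‖a' - p‖) ≤ η / 3 * ‖w - w'‖ := by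
        calc _ ≤ η₂ * (B * ‖w - w'‖ + ‖w - w'‖ / σ * (2 * B * δ' + σ)) := by
              gcongr; exact hpa w' hw'
          _ = η₂ * ((B + 2 * B * δ' / σ + 1) * ‖w - w'‖) := by field_simp; ring
          _ ≤ η₂ * ((2 * B + 1) * ‖w - w'‖) := by
              have : 2 * B * δ' / σ ≤ B := by
                rw [div_le_iff₀ hσ]; nlinarith
              gcongr
              linarith
          _ ≤ η / (3 * (2 * B + 1)) * ((2 * B + 1) * ‖w - w'‖) := by
              gcongr; exact min_le_left _ _
          _ = η / 3 * ‖w - w'‖ := by field_simp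
      have e2 : ‖(t / σ) • (a - a') + ((t - t') / σ) • (a' - R u)‖ ≤ η / 3 * ‖w - w'‖ := by
        refine (norm_add_le _ _).trans ?_
        have hd : ∀ a : ℝ, |a / σ| = |a| / σ := fun a => by rw [abs_div, abs_of_pos hσ]
        rw [norm_smul, norm_smul, Real.norm_eq_abs, Real.norm_eq_abs, hd, hd]
        calc |t| / σ * ‖a - a'‖ + |t - t'| / σ * ‖a' - R u‖
            ≤ 2 * δ' / σ * (B * ‖w - w'‖) + ‖w - w'‖ / σ * (B * (2 * δ')) := by
              gcongr
              exact hau.trans (by gcongr; exact (hdom w' hw').1.le)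
          _ = 4 * B * δ' / σ * ‖w - w'‖ := by ring
          _ ≤ η / 3 * ‖w - w'‖ := by gcongr
      -- The total error splits into the geodesic versus affine error, the error of the inductive
      -- map, and the error from the variation of the base point; each is at most η/3 times ‖w -
      -- w'‖.
      have e3 : X (p, (1 - t / σ) • l (p, a)) - X (p, (1 - t' / σ) • l (p, a')) -
          (inner ℝ (b j) (w - w') • b j + ∑ i ∈ S, inner ℝ (b i) (w - w') • b i) =
          (X (p, (1 - t / σ) • l (p, a)) - X (p, (1 - t' / σ) • l (p, a')) -
            ((1 - t / σ) • (a - p) - (1 - t' / σ) • (a' - p))) +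
          ((a - a' - ∑ i ∈ S, inner ℝ (b i) (w - w') • b i) -
            ((t / σ) • (a - a') + ((t - t') / σ) • (a' - R u))) := by
        rw [← htt, hp]
        have hσ' : t / σ * σ = t := div_mul_cancel₀ _ hσ.ne'
        have hσ'' : t' / σ * σ = t' := div_mul_cancel₀ _ hσ.ne'
        have e4 : (t - t') • b j = (t / σ) • σ • b j - (t' / σ) • σ • b j := by
          rw [smul_smul, smul_smul, hσ', hσ'', sub_smul]
        rw [e4, sub_div]
        module
      rw [e3]
      refine (norm_add_le _ _).trans ?_
      have e5 := norm_sub_le (a - a' - ∑ i ∈ S, inner ℝ (b i) (w - w') • b i)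
        ((t / σ) • (a - a') + ((t - t') / σ) • (a' - R u))
      linarith

/-- A geodesically convex function is bounded above near points arbitrarily close to `x₀`. -/
theorem exists_mem_ball_bounded_above (hX : HasStrictFDerivAt X
      (ContinuousLinearMap.fst ℝ E E + ContinuousLinearMap.snd ℝ E E) (x₀, 0))
    (hf : ∀ᶠ z : E × E in 𝓝 (x₀, 0), X (z.1, 0) = z.1 ∧
      ConvexOn ℝ (Icc (-2 : ℝ) 2) (fun t => f (X (z.1, t • z.2)))) {ρ : ℝ} (hρ : 0 < ρ) :
    ∃ y ∈ ball x₀ ρ, ∃ K, ∀ᶠ x in 𝓝 y, f x ≤ K := by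
  obtain ⟨R, u, δ, K, hδ, hR, hRl⟩ := exists_approximatesLinear_bounded hX hf
    (stdOrthonormalBasis ℝ E) Finset.univ (1 / 2) (by norm_num) ρ hρ
  refine ⟨R u, (hR u (mem_ball_self hδ)).1, K, ?_⟩
  -- With the full basis the linear part is the identity, and an error constant 1/2 < 1 makes the
  -- image of R a neighbourhood of R u.
  have happ : ApproximatesLinearOn R (ContinuousLinearEquiv.refl ℝ E : E →L[ℝ] E) (ball u δ)
      (1 / 2) := by
    intro w hw w' hw'
    have := hRl w hw w' hw'
    rw [(stdOrthonormalBasis ℝ E).sum_repr'] at this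
    simpa using this
  have himg := happ.image_mem_nhds (ContinuousLinearEquiv.refl ℝ E).toNonlinearRightInverse
    (ball_mem_nhds u hδ) (by
      rcases subsingleton_or_nontrivial E with hE | hE
      · exact Or.inl hE
      · right
        have h1 : (ContinuousLinearEquiv.refl ℝ E).toNonlinearRightInverse.nnnorm = 1 := by
          change ‖(((ContinuousLinearEquiv.refl ℝ E).symm : E ≃L[ℝ] E) : E →L[ℝ] E)‖₊ = 1
          exact ContinuousLinearMap.nnnorm_id
        rw [h1, inv_one]
        exact NNReal.coe_lt_coe.1 (by norm_num))
  filter_upwards [himg] with x hx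
  obtain ⟨w, hw, rfl⟩ := hx
  exact (hR w hw).2

/-- A function which is convex along geodesics is locally bounded above. -/
theorem eventually_le_of_geodesic_convex (hX : HasStrictFDerivAt X
      (ContinuousLinearMap.fst ℝ E E + ContinuousLinearMap.snd ℝ E E) (x₀, 0))
    (hf : ∀ᶠ z : E × E in 𝓝 (x₀, 0), X (z.1, 0) = z.1 ∧
      ConvexOn ℝ (Icc (-2 : ℝ) 2) (fun t => f (X (z.1, t • z.2)))) :
    ∃ K, ∀ᶠ x in 𝓝 x₀, f x ≤ K := by
  obtain ⟨l, hl, hl0, -, hXl⟩ := exists_logarithm hX (hf.mono fun _ h => h.1)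
  have hX00 : X (x₀, 0) = x₀ := hf.self_of_nhds.1
  have hl0' : l (x₀, x₀) = 0 := hl0
  -- reflection of `x₀` through `a`
  have hrefl : HasStrictFDerivAt (fun a => X (a, (2 : ℝ) • l (a, x₀)))
      ((ContinuousLinearEquiv.neg ℝ : E ≃L[ℝ] E) : E →L[ℝ] E) x₀ := by
    have h1 : HasStrictFDerivAt (fun a : E => (a, x₀)) (ContinuousLinearMap.inl ℝ E E) x₀ :=
      (hasStrictFDerivAt_id x₀).prodMk (hasStrictFDerivAt_const x₀ x₀)
    have h2 := (hasStrictFDerivAt_id x₀).prodMk ((HasStrictFDerivAt.comp (f := fun a : E => (a, x₀)) x₀ hl h1).const_smul (2 : ℝ))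
    have h3 : HasStrictFDerivAt X (ContinuousLinearMap.fst ℝ E E + ContinuousLinearMap.snd ℝ E E)
        (id x₀, ((2 : ℝ) • (l ∘ fun a : E => (a, x₀))) x₀) := by
      simpa [hl0] using hX
    refine (h3.comp x₀ h2).congr_fderiv ?_
    ext v
    simp only [ContinuousLinearMap.comp_apply, ContinuousLinearMap.prod_apply, _root_.add_apply,
      ContinuousLinearMap.coe_fst', ContinuousLinearMap.coe_snd', _root_.smul_apply,
      _root_.sub_apply, ContinuousLinearMap.inl_apply, ContinuousLinearMap.coe_id', id,
      ContinuousLinearEquiv.coe_coe, ContinuousLinearEquiv.neg_apply]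
    module
  -- The reflection has derivative v ↦ v - 2v = -v as a function of the centre, so every point near
  -- `x₀` is a reflection of `x₀`. The centre can thus be chosen so that `x₀` is sent to a point
  -- near which f is bounded above.
  have hmap := hrefl.map_nhds_eq_of_equiv
  simp only [hl0, smul_zero, hX00] at hmap
  obtain ⟨K₁, s₁, hs₁, hLX⟩ := hX.exists_lipschitzOnWith
  obtain ⟨K₂, s₂, hs₂, hLl⟩ := hl.exists_lipschitzOnWith
  have hcX : ∀ᶠ z in 𝓝 (x₀, (0 : E)), ContinuousAt X z := by
    filter_upwards [eventually_mem_nhds_iff.2 hs₁] with z hz using hLX.continuousOn.continuousAt hz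
  have hcl : ∀ᶠ z in 𝓝 (x₀, x₀), ContinuousAt l z := by
    filter_upwards [eventually_mem_nhds_iff.2 hs₂] with z hz using hLl.continuousOn.continuousAt hz
  have hta : Tendsto (fun a : E => (a, (2 : ℝ) • l (a, x₀))) (𝓝 x₀) (𝓝 (x₀, 0)) := by
    have h1 : ContinuousAt (fun a : E => (a, (2 : ℝ) • l (a, x₀))) x₀ := by
      refine continuousAt_id.prodMk (ContinuousAt.const_smul ?_ 2)
      exact ContinuousAt.comp (f := fun a : E => (a, x₀)) hl.continuousAt (by fun_prop)
    simpa [ContinuousAt, hl0] using h1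
  have hta' : Tendsto (fun a : E => (a, x₀)) (𝓝 x₀) (𝓝 (x₀, x₀)) :=
    (Continuous.prodMk_left x₀).tendsto x₀
  have hV : ∀ᶠ a in 𝓝 x₀, (∀ᶠ z in 𝓝 (a, (2 : ℝ) • l (a, x₀)), X (z.1, 0) = z.1 ∧
      ConvexOn ℝ (Icc (-2 : ℝ) 2) (fun t => f (X (z.1, t • z.2)))) ∧
      ContinuousAt X (a, (2 : ℝ) • l (a, x₀)) ∧ ContinuousAt l (a, x₀) ∧
      ∀ᶠ z in 𝓝 (a, x₀), X (z.1, l z) = z.2 :=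
    (hta.eventually hf.eventually_nhds).and ((hta.eventually hcX).and ((hta'.eventually hcl).and
      (hta'.eventually hXl.eventually_nhds)))
  have himg := Filter.image_mem_map (m := fun a => X (a, (2 : ℝ) • l (a, x₀))) hV
  rw [hmap] at himg
  obtain ⟨ρ, hρ, hball⟩ := Metric.mem_nhds_iff.1 himg
  obtain ⟨y, hy, K, hK⟩ := exists_mem_ball_bounded_above hX hf hρ
  obtain ⟨a, ⟨ha1, ha2, ha3, ha4⟩, rfl⟩ := hball hy
  have hcont1 : Tendsto (fun x : E => (a, x)) (𝓝 x₀) (𝓝 (a, x₀)) :=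
    (Continuous.prodMk_right a).tendsto x₀
  have hcont2 : Tendsto (fun x : E => (a, (2 : ℝ) • l (a, x))) (𝓝 x₀)
      (𝓝 (a, (2 : ℝ) • l (a, x₀))) := by
    have h1 : Tendsto (fun x => l (a, x)) (𝓝 x₀) (𝓝 (l (a, x₀))) := ha3.tendsto.comp hcont1
    exact tendsto_const_nhds.prodMk_nhds (h1.const_smul 2)
  refine ⟨max (f a) K, ?_⟩
  filter_upwards [hcont2.eventually ha1, (ha2.tendsto.comp hcont2).eventually hK,
    hcont1.eventually ha4] with x h1 h2 h3
  -- x is the midpoint of the geodesic from the centre a to the reflection of x, where f is at most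
  -- K.
  have h4 := le_max_of_convexOn_line h1.2 (r := 1 / 2) ⟨by norm_num, by norm_num⟩
  simp only [h1.1, smul_smul] at h4
  norm_num at h4
  rw [h3] at h4
  rcases h4 with h4 | h4
  · exact h4.trans (le_max_left _ _)
  · exact h4.trans ((by simpa using h2 : _ ≤ K).trans (le_max_right _ _))

/-- A function which is convex along geodesics is continuous. -/
theorem continuousAt_of_geodesic_convex (hX : HasStrictFDerivAt X
      (ContinuousLinearMap.fst ℝ E E + ContinuousLinearMap.snd ℝ E E) (x₀, 0))
    (hf : ∀ᶠ z : E × E in 𝓝 (x₀, 0), X (z.1, 0) = z.1 ∧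
      ConvexOn ℝ (Icc (-2 : ℝ) 2) (fun t => f (X (z.1, t • z.2)))) : ContinuousAt f x₀ := by
  obtain ⟨l, hl, hl0, -, hXl⟩ := exists_logarithm hX (hf.mono fun _ h => h.1)
  obtain ⟨K, hK⟩ := eventually_le_of_geodesic_convex hX hf
  have hX00 : X (x₀, 0) = x₀ := hf.self_of_nhds.1
  have hc0 : Tendsto (fun v : E => (x₀, v)) (𝓝 0) (𝓝 (x₀, 0)) :=
    (Continuous.prodMk_right x₀).tendsto 0
  have hcX : Tendsto (fun v => X (x₀, v)) (𝓝 0) (𝓝 x₀) := by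
    have := hX.continuousAt.tendsto.comp hc0
    rwa [hX00] at this
  obtain ⟨d, hd, hball⟩ := Metric.eventually_nhds_iff_ball.1
    ((hcX.eventually hK).and (hc0.eventually hf))
  have hc1 : Tendsto (fun x : E => (x₀, x)) (𝓝 x₀) (𝓝 (x₀, x₀)) :=
    (Continuous.prodMk_right x₀).tendsto x₀
  have hcl : Tendsto (fun x => l (x₀, x)) (𝓝 x₀) (𝓝 0) := by
    have := hl.continuousAt.tendsto.comp hc1
    rwa [hl0] at this
  have hKx : f x₀ ≤ K := hK.self_of_nhds
  have hest : ∀ᶠ x in 𝓝 x₀, |f x - f x₀| ≤ ‖l (x₀, x)‖ * (2 / d * (K - f x₀)) := by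
    filter_upwards [hc1.eventually hXl, hcl.eventually (ball_mem_nhds 0 (half_pos hd))] with x h1 h2
    set w := l (x₀, x) with hw
    rcases eq_or_ne w 0 with h0 | h0
    · rw [h0, hX00] at h1
      rw [← h1, h0]
      simp
    have hw0 : 0 < ‖w‖ := norm_pos_iff.2 h0
    -- The geodesic is extended in both directions to the fixed length d/2, where f is at most K.
    -- Then x is its point at parameter s, proportional to ‖w‖.
    set v := (d / 2 / ‖w‖) • w with hv
    have hvn : ‖v‖ = d / 2 := by
      rw [hv, norm_smul, Real.norm_eq_abs, abs_of_pos (by positivity), div_mul_cancel₀ _ hw0.ne']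
    have hvm : v ∈ ball (0 : E) d := by rw [mem_ball_zero_iff, hvn]; linarith
    have hvm' : -v ∈ ball (0 : E) d := by rw [mem_ball_zero_iff, norm_neg, hvn]; linarith
    obtain ⟨g1, -, hconv⟩ := hball v hvm
    obtain ⟨g2, -⟩ := hball (-v) hvm'
    simp only at hconv
    set s := ‖w‖ / (d / 2) with hs
    have hs0 : 0 < s := by positivity
    have hs1 : s ≤ 1 := by
      rw [hs, div_le_one (by positivity)]
      exact (mem_ball_zero_iff.1 h2).le
    have hsv : s • v = w := by
      rw [hs, hv, smul_smul, div_mul_div_cancel₀ (by positivity), div_self hw0.ne', one_smul]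
    have c1 := hconv.2 (x := 0) ⟨by norm_num, by norm_num⟩ (y := 1) ⟨by norm_num, by norm_num⟩
      (sub_nonneg.2 hs1) hs0.le (by ring)
    -- Here x₀ lies between the parameters -1 and s, which gives the lower bound for f x; the
    -- preceding inequality gives the upper bound.
    have c2 := hconv.2 (show (-1 : ℝ) ∈ Icc (-2 : ℝ) 2 from ⟨by norm_num, by norm_num⟩)
      (show s ∈ Icc (-2 : ℝ) 2 from ⟨by linarith, by linarith⟩)
      (show 0 ≤ s / (1 + s) by positivity) (show 0 ≤ 1 / (1 + s) by positivity)
      (by field_simp; ring)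
    have e1 : s / (1 + s) * (-1) + 1 / (1 + s) * s = 0 := by field_simp; ring
    simp only [smul_eq_mul, e1, mul_zero, mul_one, zero_add, zero_smul, one_smul, neg_smul, hX00,
      hsv, h1] at c1 c2
    have c3 : (1 + s) * f x₀ ≤ s * f (X (x₀, -v)) + f x := by
      have : f x₀ ≤ (s * f (X (x₀, -v)) + f x) / (1 + s) := by
        refine c2.trans (le_of_eq ?_); ring
      rw [le_div_iff₀ (by positivity)] at this
      linarith
    have e2 : ‖w‖ * (2 / d * (K - f x₀)) = s * (K - f x₀) := by
      rw [hs]; field_simp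
    rw [e2, abs_le]
    constructor
    · nlinarith
    · nlinarith
  rw [ContinuousAt, tendsto_iff_dist_tendsto_zero]
  have hlim : Tendsto (fun x => ‖l (x₀, x)‖ * (2 / d * (K - f x₀))) (𝓝 x₀) (𝓝 0) := by
    simpa using hcl.norm.mul_const (2 / d * (K - f x₀))
  refine squeeze_zero' (Eventually.of_forall fun _ => dist_nonneg) ?_ hlim
  filter_upwards [hest] with x hx using hx

/-- If `f` takes the value `f x₀` at all `X (x₀, v)` with `v` small then `f` is locally constant at
`x₀`. -/
theorem eventually_eq_of_exponential (hX : HasStrictFDerivAt X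
      (ContinuousLinearMap.fst ℝ E E + ContinuousLinearMap.snd ℝ E E) (x₀, 0))
    (hX0 : ∀ᶠ z : E × E in 𝓝 (x₀, 0), X (z.1, 0) = z.1)
    (hf : ∀ᶠ v in 𝓝 (0 : E), f (X (x₀, v)) = f x₀) : ∀ᶠ x in 𝓝 x₀, f x = f x₀ := by
  obtain ⟨l, hl, hl0, -, hXl⟩ := exists_logarithm hX hX0
  have hc1 : Tendsto (fun x : E => (x₀, x)) (𝓝 x₀) (𝓝 (x₀, x₀)) :=
    (Continuous.prodMk_right x₀).tendsto x₀
  have hcl : Tendsto (fun x => l (x₀, x)) (𝓝 x₀) (𝓝 0) := by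
    have := hl.continuousAt.tendsto.comp hc1
    rwa [hl0] at this
  filter_upwards [hc1.eventually hXl, hcl.eventually hf] with x h1 h2
  rwa [h1] at h2

end ConvexContinuity

/-! ### Minkowski norms, Auerbach bases and the volume of the polar body. -/

section MinkowskiNorm

variable {n : ℕ} {N : EuclideanSpace ℝ (Fin n) → ℝ}

theorem iteratedDeriv_two_norm_add_smul_sq {E : Type*} [NormedAddCommGroup E]
    [InnerProductSpace ℝ E] (v w : E) :
    iteratedDeriv 2 (fun t : ℝ => ‖v + t • w‖ ^ 2) 0 = 2 * ‖w‖ ^ 2 := by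
  have h : (fun t : ℝ => ‖v + t • w‖ ^ 2) =
      fun t : ℝ => ‖v‖ ^ 2 + 2 * inner ℝ v w * t + ‖w‖ ^ 2 * t ^ 2 := by
    funext t
    rw [norm_add_sq_real, inner_smul_right, norm_smul, mul_pow, Real.norm_eq_abs, sq_abs]
    ring
  have h1 : deriv (fun t : ℝ => ‖v‖ ^ 2 + 2 * inner ℝ v w * t + ‖w‖ ^ 2 * t ^ 2) =
      fun t => 2 * inner ℝ v w + ‖w‖ ^ 2 * (2 * t) := by
    funext t
    have := (((hasDerivAt_id t).const_mul (2 * inner ℝ v w)).const_add (‖v‖ ^ 2)).add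
      ((hasDerivAt_pow 2 t).const_mul (‖w‖ ^ 2))
    refine (this.congr_deriv ?_).deriv
    simp
  rw [h, iteratedDeriv_succ, iteratedDeriv_one, h1]
  have := (((hasDerivAt_id (0 : ℝ)).const_mul 2).const_mul (‖w‖ ^ 2)).const_add (2 * inner ℝ v w)
  refine (this.congr_deriv ?_).deriv
  ring

/-- These Euclidean norms are those whose density is known, by covariance and normalisation;
monotonicity compares a general norm with one of them. -/
theorem isMinkowskiNorm_norm_comp
    (A : EuclideanSpace ℝ (Fin n) ≃ₗ[ℝ] EuclideanSpace ℝ (Fin n)) :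
    IsMinkowskiNorm (fun v => ‖A v‖) where
  smooth := by
    have hA : ContDiff ℝ ∞ A := A.toContinuousLinearEquiv.contDiff
    exact hA.contDiffOn.norm ℝ fun x hx => (map_ne_zero_iff A A.injective).2 hx
  pos v hv := norm_pos_iff.2 ((map_ne_zero_iff A A.injective).2 hv)
  homogeneous c v := by rw [map_smul, norm_smul, Real.norm_eq_abs]
  stronglyConvex v w _ hw := by
    simp only [map_add, map_smul]
    rw [iteratedDeriv_two_norm_add_smul_sq]
    have := norm_pos_iff.2 ((map_ne_zero_iff A A.injective).2 hw)
    positivity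

namespace IsMinkowskiNorm

theorem map_zero (hN : IsMinkowskiNorm N) : N 0 = 0 := by
  simpa using hN.homogeneous 0 0

theorem exists_pos_mul_norm_le (hN : IsMinkowskiNorm N) :
    ∃ m > 0, ∀ v, m * ‖v‖ ≤ N v := by
  rcases (sphere (0 : EuclideanSpace ℝ (Fin n)) 1).eq_empty_or_nonempty with h | h
  · refine ⟨1, one_pos, fun v => ?_⟩
    rcases eq_or_ne v 0 with rfl | hv
    · simp [hN.map_zero]
    · exfalso
      have : (‖v‖⁻¹ • v) ∈ sphere (0 : EuclideanSpace ℝ (Fin n)) 1 := by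
        rw [mem_sphere_zero_iff_norm, norm_smul, norm_inv, norm_norm,
          inv_mul_cancel₀ (norm_ne_zero_iff.2 hv)]
      rw [h] at this
      exact this
  · have hs : sphere (0 : EuclideanSpace ℝ (Fin n)) 1 ⊆ {0}ᶜ := by
      rintro v hv rfl
      simp at hv
    obtain ⟨u, hu, hmin⟩ := (isCompact_sphere 0 1).exists_isMinOn h
      (hN.smooth.continuousOn.mono hs)
    refine ⟨N u, hN.pos u (hs hu), fun v => ?_⟩
    rcases eq_or_ne v 0 with rfl | hv
    · simp [hN.map_zero]
    have hv' := norm_pos_iff.2 hv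
    have h1 : N u ≤ N (‖v‖⁻¹ • v) := hmin (by
      rw [mem_sphere_zero_iff_norm, norm_smul, norm_inv, norm_norm, inv_mul_cancel₀ hv'.ne'])
    rw [hN.homogeneous, abs_of_pos (by positivity), inv_mul_eq_div, le_div_iff₀ hv'] at h1
    exact h1

theorem exists_pos_le_mul_norm (hN : IsMinkowskiNorm N) :
    ∃ m > 0, ∀ v, N v ≤ m * ‖v‖ := by
  have hs : sphere (0 : EuclideanSpace ℝ (Fin n)) 1 ⊆ {0}ᶜ := by
    rintro v hv rfl
    simp at hv
  obtain ⟨K, hK⟩ := (isCompact_sphere (0 : EuclideanSpace ℝ (Fin n)) 1).exists_bound_of_continuousOn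
    (hN.smooth.continuousOn.mono hs)
  refine ⟨max K 1, by positivity, fun v => ?_⟩
  rcases eq_or_ne v 0 with rfl | hv
  · simp [hN.map_zero]
  have hv' := norm_pos_iff.2 hv
  have h1 : N (‖v‖⁻¹ • v) ≤ K := (Real.le_norm_self _).trans (hK _ (by
    rw [mem_sphere_zero_iff_norm, norm_smul, norm_inv, norm_norm, inv_mul_cancel₀ hv'.ne']))
  rw [hN.homogeneous, abs_of_pos (by positivity), inv_mul_eq_div, div_le_iff₀ hv'] at h1
  exact h1.trans (by gcongr; exact le_max_left _ _)

theorem continuous (hN : IsMinkowskiNorm N) : Continuous N := by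
  rw [continuous_iff_continuousAt]
  intro v
  rcases eq_or_ne v 0 with rfl | hv
  · obtain ⟨m, -, hm⟩ := hN.exists_pos_le_mul_norm
    obtain ⟨m', hm'0, hm'⟩ := hN.exists_pos_mul_norm_le
    rw [ContinuousAt, hN.map_zero]
    refine squeeze_zero (fun v => (by positivity : 0 ≤ m' * ‖v‖).trans (hm' v)) hm ?_
    have : Continuous fun v : EuclideanSpace ℝ (Fin n) => m * ‖v‖ := by fun_prop
    simpa using this.tendsto 0
  · exact hN.smooth.continuousOn.continuousAt (isOpen_compl_singleton.mem_nhds hv)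

/-- An Auerbach basis of the unit ball. -/
theorem exists_auerbach_basis (hN : IsMinkowskiNorm N) :
    ∃ b : Module.Basis (Fin n) ℝ (EuclideanSpace ℝ (Fin n)),
      (∀ i, N (b i) ≤ 1) ∧ ∀ v i, |b.repr v i| ≤ N v := by
  set b₀ := (EuclideanSpace.basisFun (Fin n) ℝ).toBasis
  set K : Set (EuclideanSpace ℝ (Fin n)) := {v | N v ≤ 1} with hK
  have hKc : IsCompact K := by
    obtain ⟨m, hm, h⟩ := hN.exists_pos_mul_norm_le
    refine Metric.isCompact_of_isClosed_isBounded (isClosed_le hN.continuous continuous_const) ?_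
    refine (isBounded_closedBall (x := (0 : EuclideanSpace ℝ (Fin n))) (r := 1 / m)).subset ?_
    intro v hv
    rw [mem_closedBall_zero_iff, le_div_iff₀ hm, mul_comm]
    exact (h v).trans hv
  have hP : IsCompact (Set.pi univ fun _ : Fin n => K) := isCompact_univ_pi fun _ => hKc
  have hdet : Continuous fun e : Fin n → EuclideanSpace ℝ (Fin n) => |b₀.det e| := by
    refine continuous_abs.comp ?_
    change Continuous fun e : Fin n → EuclideanSpace ℝ (Fin n) => b₀.det e
    refine Continuous.congr (f := fun e : Fin n → EuclideanSpace ℝ (Fin n) =>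
      (Matrix.of fun i j => e j i).det) (Continuous.matrix_det
        (continuous_pi fun i => continuous_pi fun j => ?_)) fun e => ?_
    · exact (EuclideanSpace.proj (𝕜 := ℝ) i).continuous.comp (continuous_apply j)
    · rw [Module.Basis.det_apply]
      congr 1
  obtain ⟨m, hm, hle⟩ := hN.exists_pos_le_mul_norm
  -- A small multiple of the standard basis lies in the unit ball, so the maximal determinant is
  -- positive and the maximising vectors form a basis.
  have hsmall : (fun i => m⁻¹ • b₀ i) ∈ Set.pi univ fun _ : Fin n => K := by
    intro i _
    rw [hK, mem_ofPred_eq, hN.homogeneous, abs_of_pos (by positivity), inv_mul_le_iff₀ hm, mul_one]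
    simpa [b₀] using hle (b₀ i)
  obtain ⟨e, he, hmax⟩ := hP.exists_isMaxOn ⟨_, hsmall⟩ hdet.continuousOn
  have hpos : 0 < |b₀.det e| := by
    refine lt_of_lt_of_le ?_ (hmax hsmall)
    have : (fun i => m⁻¹ • b₀ i) = fun i => (fun _ : Fin n => m⁻¹) i • b₀ i := rfl
    simp only
    rw [this, AlternatingMap.map_smul_univ, Module.Basis.det_self]
    positivity
  obtain ⟨hli, hsp⟩ := (Module.Basis.is_basis_iff_det b₀).2 (isUnit_iff_ne_zero.2 (abs_pos.1 hpos))
  refine ⟨Module.Basis.mk hli hsp.ge, fun i => ?_, fun v i => ?_⟩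
  · rw [Module.Basis.mk_apply]
    exact he i (mem_univ i)
  set b := Module.Basis.mk hli hsp.ge with hb
  have hbe : ∀ i, b i = e i := fun i => Module.Basis.mk_apply hli hsp.ge i
  -- Cramer's rule: replacing e_i by v multiplies the determinant by the i-th coordinate of v.
  -- Taking v of norm 1, maximality bounds this coordinate by 1.
  have hrepl : ∀ v i, b₀.det (Function.update e i v) = b.repr v i * b₀.det e := by
    intro v i
    conv_lhs => rw [← b.sum_repr v]
    rw [AlternatingMap.map_update_sum, Finset.sum_eq_single i]
    · rw [AlternatingMap.map_update_smul, hbe, Function.update_eq_self, smul_eq_mul]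
    · intro j _ hj
      rw [AlternatingMap.map_update_smul, hbe, AlternatingMap.map_update_self _ _ hj.symm,
        smul_zero]
    · simp
  rcases eq_or_ne v 0 with rfl | hv
  · simp [hN.map_zero]
  have hNv := hN.pos v hv
  have h1 : |b₀.det (Function.update e i ((N v)⁻¹ • v))| ≤ |b₀.det e| := by
    refine hmax fun j _ => ?_
    rcases eq_or_ne j i with rfl | hj
    · rw [Function.update_self, hK, mem_ofPred_eq, hN.homogeneous, abs_of_pos (by positivity),
        inv_mul_cancel₀ hNv.ne']
    · rw [Function.update_of_ne hj]
      exact he j (mem_univ j)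
  rw [hrepl, abs_mul, map_smul, Finsupp.smul_apply, smul_eq_mul, abs_mul,
    abs_of_pos (inv_pos.2 hNv)] at h1
  have h2 := (mul_le_iff_le_one_left hpos).1 h1
  rwa [inv_mul_le_iff₀ hNv, mul_one] at h2

end IsMinkowskiNorm

/-- The volume of the polar of the unit ball is bounded by a multiple of the density. -/
theorem FinslerVolume.exists_volume_polar_le (V : FinslerVolume n) :
    ∃ C : ℝ≥0∞, C ≠ ⊤ ∧ ∀ N : EuclideanSpace ℝ (Fin n) → ℝ, IsMinkowskiNorm N →
      volume {p : EuclideanSpace ℝ (Fin n) | ∀ w, N w ≤ 1 → ⟪p, w⟫_ℝ ≤ 1} ≤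
        C * ENNReal.ofReal (V.density N) := by
  -- n + 1 serves as a crude comparison constant between the Euclidean and the maximum norm, and is
  -- positive also for n = 0.
  set c : ℝ := ((n : ℝ) + 1)⁻¹ with hc
  have hc0 : 0 < c := by positivity
  refine ⟨volume (closedBall (0 : EuclideanSpace ℝ (Fin n)) (n + 1)) *
    ENNReal.ofReal ((c ^ n)⁻¹), ?_, ?_⟩
  · exact ENNReal.mul_ne_top (isCompact_closedBall _ _).measure_ne_top ENNReal.ofReal_ne_top
  intro N hN
  obtain ⟨b, hb1, hb2⟩ := hN.exists_auerbach_basis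
  set b₀ := (EuclideanSpace.basisFun (Fin n) ℝ).toBasis
  set A : EuclideanSpace ℝ (Fin n) ≃ₗ[ℝ] EuclideanSpace ℝ (Fin n) :=
    b.equiv b₀ (Equiv.refl _) with hA
  have hAv : ∀ v i, A v i = b.repr v i := by
    intro v i
    have h : b₀.repr (A v) i = b.repr v i := by
      rw [hA, Module.Basis.equiv]
      simp
    rwa [OrthonormalBasis.coe_toBasis_repr_apply, EuclideanSpace.basisFun_repr] at h
  have hcoord : ∀ (q : EuclideanSpace ℝ (Fin n)) (r : ℝ), 0 ≤ r → (∀ i, |q i| ≤ r) →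
      ‖q‖ ≤ (n + 1) * r := by
    intro q r hr hq
    rw [EuclideanSpace.norm_eq]
    refine Real.sqrt_le_iff.2 ⟨by positivity, ?_⟩
    calc ∑ i, ‖q i‖ ^ 2 ≤ ∑ _i : Fin n, r ^ 2 := by
          refine Finset.sum_le_sum fun i _ => ?_
          rw [Real.norm_eq_abs]
          gcongr
          exact hq i
      _ = n * r ^ 2 := by simp
      _ ≤ ((n + 1) * r) ^ 2 := by
          rw [mul_pow]
          have : (0 : ℝ) ≤ n := Nat.cast_nonneg n
          gcongr
          nlinarith
  have hNnn : ∀ v, 0 ≤ N v := by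
    intro v
    rcases eq_or_ne v 0 with rfl | hv
    · exact hN.map_zero.ge
    · exact (hN.pos v hv).le
  -- comparison of `N` with a Euclidean norm
  set S := LinearEquiv.smulOfNeZero ℝ (EuclideanSpace ℝ (Fin n)) c hc0.ne'
  have hdens : c ^ n * |LinearMap.det (A : EuclideanSpace ℝ (Fin n) →ₗ[ℝ] _)| ≤ V.density N := by
    have h1 := V.monotone _ N (isMinkowskiNorm_norm_comp (A.trans S)) hN fun v => by
      have : ‖A v‖ ≤ (n + 1) * N v :=
        hcoord _ _ (hNnn v) fun i => by rw [hAv]; exact hb2 v i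
      change ‖c • A v‖ ≤ N v
      rw [norm_smul, Real.norm_eq_abs, abs_of_pos hc0, hc, inv_mul_le_iff₀ (by positivity)]
      exact this
    have h2 := V.covariant (fun v => ‖v‖)
      (isMinkowskiNorm_norm_comp (LinearEquiv.refl ℝ (EuclideanSpace ℝ (Fin n)))) (A.trans S)
    rw [V.euclidean, mul_one] at h2
    have h3 : ((A.trans S : EuclideanSpace ℝ (Fin n) ≃ₗ[ℝ] EuclideanSpace ℝ (Fin n)) :
        EuclideanSpace ℝ (Fin n) →ₗ[ℝ] EuclideanSpace ℝ (Fin n)) =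
        c • (A : EuclideanSpace ℝ (Fin n) →ₗ[ℝ] _) := rfl
    rw [h3, LinearMap.det_smul, finrank_euclideanSpace_fin, abs_mul,
      abs_of_pos (by positivity)] at h2
    rw [← h2]
    exact h1
  -- the polar is contained in the preimage of a ball
  set B : EuclideanSpace ℝ (Fin n) →ₗ[ℝ] EuclideanSpace ℝ (Fin n) :=
    LinearMap.adjoint (A.symm : EuclideanSpace ℝ (Fin n) →ₗ[ℝ] EuclideanSpace ℝ (Fin n)) with hB
  have hBdet : LinearMap.det B =
      (LinearMap.det (A : EuclideanSpace ℝ (Fin n) →ₗ[ℝ] EuclideanSpace ℝ (Fin n)))⁻¹ := by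
    have h := LinearMap.toMatrix_adjoint (EuclideanSpace.basisFun (Fin n) ℝ)
      (EuclideanSpace.basisFun (Fin n) ℝ)
      (A.symm : EuclideanSpace ℝ (Fin n) →ₗ[ℝ] EuclideanSpace ℝ (Fin n))
    rw [← LinearMap.det_toMatrix b₀, hB, h, Matrix.det_conjTranspose, LinearMap.det_toMatrix,
      star_trivial, LinearEquiv.det_coe_symm]
  have hsub : {p : EuclideanSpace ℝ (Fin n) | ∀ w, N w ≤ 1 → ⟪p, w⟫_ℝ ≤ 1} ⊆
      B ⁻¹' closedBall 0 (n + 1) := by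
    intro p hp
    rw [mem_preimage, mem_closedBall_zero_iff, ← mul_one ((n : ℝ) + 1)]
    refine hcoord _ _ zero_le_one fun i => ?_
    have h1 : B p i = ⟪p, b i⟫_ℝ := by
      have h2 : A.symm (b₀ i) = b i := by
        rw [LinearEquiv.symm_apply_eq, hA, Module.Basis.equiv_apply]; rfl
      have h3 : ⟪B p, b₀ i⟫_ℝ = B p i := by
        simp [b₀, EuclideanSpace.inner_single_right]
      rw [← h3, hB, LinearMap.adjoint_inner_left, LinearEquiv.coe_coe, h2]
    rw [h1, abs_le]
    constructor
    · have := hp (-b i) (by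
        have := hN.homogeneous (-1) (b i)
        rw [neg_one_smul, abs_neg, abs_one, one_mul] at this
        rw [this]; exact hb1 i)
      rw [inner_neg_right] at this
      linarith
    · exact hp _ (hb1 i)
  have hdA : LinearMap.det (A : EuclideanSpace ℝ (Fin n) →ₗ[ℝ] EuclideanSpace ℝ (Fin n)) ≠ 0 :=
    A.isUnit_det'.ne_zero
  have hBne : LinearMap.det B ≠ 0 := by rw [hBdet]; exact inv_ne_zero hdA
  refine (measure_mono hsub).trans ?_
  rw [Measure.addHaar_preimage_linearMap _ hBne, hBdet, inv_inv, mul_comm, mul_assoc,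
    ← ENNReal.ofReal_mul (by positivity)]
  gcongr
  rw [inv_mul_eq_div, le_div_iff₀ (by positivity), mul_comm]
  exact hdens

end MinkowskiNorm

/-! ### The Euler–Lagrange equation under restriction and translation of time. -/

section EulerLagrangeLocality

variable {E : Type*} [NormedAddCommGroup E] [InnerProductSpace ℝ E] {L : E → E → ℝ}
  {c c' : ℝ → E} {s s' : Set ℝ} {t : ℝ}

theorem Filter.EventuallyEq.derivWithin_of_subset {f g : ℝ → E} (h : f =ᶠ[𝓝[s] t] g) :
    derivWithin f s =ᶠ[𝓝[s] t] derivWithin g s := by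
  filter_upwards [h.fderivWithin' (𝕜 := ℝ) Subset.rfl] with r hr
  rw [derivWithin, derivWithin, hr]

/-- Differentiability is required near t, and not only at t, because the equation differentiates the
momentum, which involves the velocity relative to s' at nearby times. -/
theorem EulerLagrangeAt.mono (h : EulerLagrangeAt L c s t)
    (hd : ∀ᶠ r in 𝓝[s] t, DifferentiableWithinAt ℝ c s r) (hss : s' ⊆ s)
    (hs' : UniqueDiffOn ℝ s') (ht : t ∈ s') :
    EulerLagrangeAt L c s' t ∧ derivWithin c s' t = derivWithin c s t := by
  have h1 : ∀ᶠ r in 𝓝[s'] t, derivWithin c s' r = derivWithin c s r := by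
    filter_upwards [self_mem_nhdsWithin, nhdsWithin_mono t hss hd] with r hr hr'
    exact derivWithin_subset hss (hs' r hr) hr'
  have h2 := h1.self_of_nhdsWithin ht
  refine ⟨⟨h.1.mono hss, h2 ▸ h.2.1, ?_⟩, h2⟩
  rw [h2]
  refine (h.2.2.mono hss).congr_of_eventuallyEq ?_ (by rw [h2])
  filter_upwards [h1] with r hr
  rw [hr]

theorem EulerLagrangeAt.comp_add_const {a : ℝ} (h : EulerLagrangeAt L c s (t + a))
    (hs : ∀ r, r + a ∈ s ↔ r ∈ s') : EulerLagrangeAt L (fun r => c (r + a)) s' t ∧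
      derivWithin (fun r => c (r + a)) s' t = derivWithin c s (t + a) := by
  have hs1 : a +ᵥ s' = s := by
    ext r
    rw [Set.mem_vadd_set_iff_neg_vadd_mem, vadd_eq_add, ← hs]
    simp
  have hs2 : (fun r => r + a) ⁻¹' s = s' := by ext r; exact hs r
  have h1 : ∀ r, derivWithin (fun r => c (r + a)) s' r = derivWithin c s (r + a) := fun r => by
    rw [derivWithin_comp_add_const, hs1]
  have h3 : HasDerivWithinAt (fun r : ℝ => r + a) 1 s' t := ((hasDerivAt_id t).add_const a).hasDerivWithinAt
  have hm : MapsTo (fun r : ℝ => r + a) s' s := fun r hr => (hs r).2 hr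
  refine ⟨⟨?_, ?_, ?_⟩, h1 t⟩
  · exact h.1.comp t h3.differentiableWithinAt hm
  · rw [h1]; exact h.2.1
  · simp only [h1]
    have := h.2.2.scomp t h3 hm
    rwa [one_smul] at this

end EulerLagrangeLocality

/-! ### Invariance under changes of coordinates, and the cotangent lift. -/

section ChartChange

variable {E : Type*} [NormedAddCommGroup E] [InnerProductSpace ℝ E]

/-- A smooth change of coordinates relating the Lagrangians `L` and `L'`. -/
structure IsLagrangianChange (e : OpenPartialHomeomorph E E) (L L' : E → E → ℝ) : Prop where
  smooth : ContDiffOn ℝ ∞ e e.source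
  smooth_symm : ContDiffOn ℝ ∞ e.symm e.target
  comp : ∀ x ∈ e.source, ∀ y, L x y = L' (e x) (fderiv ℝ e x y)

namespace IsLagrangianChange

variable {e : OpenPartialHomeomorph E E} {U U' : Set E} {L L' : E → E → ℝ}

theorem hasFDerivAt (h : IsLagrangianChange e L L') {x : E} (hx : x ∈ e.source) :
    HasFDerivAt e (fderiv ℝ e x) x :=
  ((h.smooth.contDiffAt (e.open_source.mem_nhds hx)).differentiableAt (by simp)).hasFDerivAt

theorem hasFDerivAt_symm (h : IsLagrangianChange e L L') {x : E} (hx : x ∈ e.target) :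
    HasFDerivAt e.symm (fderiv ℝ e.symm x) x :=
  ((h.smooth_symm.contDiffAt (e.open_target.mem_nhds hx)).differentiableAt (by simp)).hasFDerivAt

theorem fderiv_symm_comp (h : IsLagrangianChange e L L') {x : E} (hx : x ∈ e.source) :
    fderiv ℝ e.symm (e x) ∘L fderiv ℝ e x = ContinuousLinearMap.id ℝ E := by
  refine ((h.hasFDerivAt_symm (e.map_source hx)).comp x (h.hasFDerivAt hx)).unique
    ((hasFDerivAt_id x).congr_of_eventuallyEq ?_)
  filter_upwards [e.open_source.mem_nhds hx] with y hy using e.left_inv hy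

theorem fderiv_comp_symm (h : IsLagrangianChange e L L') {x : E} (hx : x ∈ e.source) :
    fderiv ℝ e x ∘L fderiv ℝ e.symm (e x) = ContinuousLinearMap.id ℝ E := by
  have h1 : HasFDerivAt e (fderiv ℝ e x) (e.symm (e x)) := by
    rw [e.left_inv hx]; exact h.hasFDerivAt hx
  refine (h1.comp (e x) (h.hasFDerivAt_symm (e.map_source hx))).unique
    ((hasFDerivAt_id (e x)).congr_of_eventuallyEq ?_)
  filter_upwards [e.open_target.mem_nhds (e.map_source hx)] with y hy using e.right_inv hy

theorem symm_apply (h : IsLagrangianChange e L L') {x : E} (hx : x ∈ e.source) (y : E) :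
    fderiv ℝ e.symm (e x) (fderiv ℝ e x y) = y :=
  congrArg (fun T => T y) (h.fderiv_symm_comp hx)

theorem apply_symm (h : IsLagrangianChange e L L') {x : E} (hx : x ∈ e.source) (y : E) :
    fderiv ℝ e x (fderiv ℝ e.symm (e x) y) = y :=
  congrArg (fun T => T y) (h.fderiv_comp_symm hx)

theorem fderiv_ne_zero (h : IsLagrangianChange e L L') {x y : E} (hx : x ∈ e.source)
    (hy : y ≠ 0) : fderiv ℝ e x y ≠ 0 := fun h0 => hy (by
  rw [← h.symm_apply hx y, h0, map_zero])

theorem apply_target (h : IsLagrangianChange e L L') {x : E} (hx : x ∈ e.target) (y : E) :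
    L' x y = L (e.symm x) (fderiv ℝ e.symm x y) := by
  have h1 := h.comp _ (e.map_target hx) (fderiv ℝ e.symm x y)
  have h2 := h.apply_symm (e.map_target hx) y
  rw [e.right_inv hx] at h1 h2
  rw [h1, h2]

theorem hasFDerivAt_velocity (h : IsLagrangianChange e L L') (hL : IsLagrangian U L)
    (hU : e.source ⊆ U) [CompleteSpace E] {x y : E} (hx : x ∈ e.source) (hy : y ≠ 0) :
    HasFDerivAt (L' (e x)) (fderiv ℝ (L x) y ∘L fderiv ℝ e.symm (e x)) (fderiv ℝ e x y) := by
  have h1 : L' (e x) = fun w => L x (fderiv ℝ e.symm (e x) w) := by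
    funext w
    rw [h.apply_target (e.map_source hx), e.left_inv hx]
  rw [h1]
  have h2 := hL.hasFDerivAt_right (z := (x, y)) ⟨hU hx, hy⟩
  rw [← h2.fderiv] at h2
  refine HasFDerivAt.comp (g := L x) _ ?_ (fderiv ℝ e.symm (e x)).hasFDerivAt
  rw [h.symm_apply hx]
  exact h2

variable [CompleteSpace E]

/-- The momentum is pulled back by the derivative of the inverse coordinate change. Differentiating
this factor in time yields a second derivative term, which by symmetry equals the one arising in the
force from the dependence of the old velocity on the new position. -/
theorem eulerLagrangeAt_comp (h : IsLagrangianChange e L L') (hL : IsLagrangian U L)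
    (hU : e.source ⊆ U) {c : ℝ → E} {s : Set ℝ} {t : ℝ} (hs : UniqueDiffOn ℝ s) (ht : t ∈ s)
    (hct : c t ∈ e.source) (hc : ∀ᶠ r in 𝓝[s] t, EulerLagrangeAt L c s r) :
    EulerLagrangeAt L' (e ∘ c) s t ∧
      derivWithin (e ∘ c) s t = fderiv ℝ e (c t) (derivWithin c s t) := by
  obtain ⟨hct1, hct2, hct3⟩ := hc.self_of_nhdsWithin ht
  have hev : ∀ᶠ r in 𝓝[s] t, r ∈ s ∧ c r ∈ e.source ∧ EulerLagrangeAt L c s r := by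
    filter_upwards [self_mem_nhdsWithin,
      hct1.continuousWithinAt.preimage_mem_nhdsWithin (e.open_source.mem_nhds hct), hc]
      with r h1 h2 h3 using ⟨h1, h2, h3⟩
  have hder : ∀ r, c r ∈ e.source → EulerLagrangeAt L c s r →
      HasDerivWithinAt (e ∘ c) (fderiv ℝ e (c r) (derivWithin c s r)) s r := fun r hr hr' =>
    (h.hasFDerivAt hr).comp_hasDerivWithinAt r hr'.1.hasDerivWithinAt
  have hder' : ∀ᶠ r in 𝓝[s] t, derivWithin (e ∘ c) s r = fderiv ℝ e (c r) (derivWithin c s r) := by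
    filter_upwards [hev] with r hr using (hder r hr.2.1 hr.2.2).derivWithin (hs r hr.1)
  have hd0 := hder t hct ⟨hct1, hct2, hct3⟩
  have hdt := hder'.self_of_nhdsWithin ht
  set v := derivWithin c s t with hv
  refine ⟨⟨hd0.differentiableWithinAt, ?_, ?_⟩, hdt⟩
  · rw [hdt]
    exact h.fderiv_ne_zero hct hct2
  rw [hdt]
  -- the momentum is pulled back by the inverse coordinate change
  have hP : ∀ᶠ r in 𝓝[s] t, fderiv ℝ (fun y => L' ((e ∘ c) r) y) (derivWithin (e ∘ c) s r) =
      fderiv ℝ (fun y => L (c r) y) (derivWithin c s r) ∘L fderiv ℝ e.symm ((e ∘ c) r) := by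
    filter_upwards [hev, hder'] with r hr hr'
    rw [hr']
    exact (h.hasFDerivAt_velocity hL hU hr.2.1 hr.2.2.2.1).fderiv
  have hmem := e.open_target.mem_nhds (e.map_source hct)
  have hsm : ContDiffOn ℝ ∞ (fderiv ℝ e.symm) e.target :=
    h.smooth_symm.fderiv_of_isOpen e.open_target (by exact_mod_cast (le_top : (⊤ + 1 : ℕ∞) ≤ ⊤))
  have hD2 : HasFDerivAt (fderiv ℝ e.symm) (fderiv ℝ (fderiv ℝ e.symm) (e (c t))) (e (c t)) :=
    ((hsm.contDiffAt hmem).differentiableAt (by simp)).hasFDerivAt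
  have hD2c : HasDerivWithinAt (fun r => fderiv ℝ e.symm ((e ∘ c) r))
      (fderiv ℝ (fderiv ℝ e.symm) (e (c t)) (fderiv ℝ e (c t) v)) s t :=
    HasFDerivAt.comp_hasDerivWithinAt t hD2 hd0
  have hprod := hct3.clm_comp hD2c
  refine (hprod.congr_of_eventuallyEq hP (hP.self_of_nhdsWithin ht)).congr_deriv ?_
  -- identify the force
  set w := fderiv ℝ e (c t) v with hw
  have hsymm : IsSymmSndFDerivAt ℝ e.symm (e (c t)) :=
    (h.smooth_symm.contDiffAt hmem).isSymmSndFDerivAt (by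
      simpa using WithTop.coe_le_coe.2 (le_top : (2 : ℕ∞) ≤ ⊤))
  have hL'w : (fun x => L' x w) =ᶠ[𝓝 (e (c t))] fun x => L (e.symm x) (fderiv ℝ e.symm x w) := by
    filter_upwards [hmem] with x hx using h.apply_target hx w
  have hz : (c t, v) ∈ U ×ˢ ({0}ᶜ : Set E) := ⟨hU hct, hct2⟩
  have hz' : (e.symm (e (c t)), fderiv ℝ e.symm (e (c t)) w) = (c t, v) := by
    rw [e.left_inv hct, hw, h.symm_apply hct]
  have hpair : HasFDerivAt (fun x => (e.symm x, fderiv ℝ e.symm x w))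
      ((fderiv ℝ e.symm (e (c t))).prod
        ((ContinuousLinearMap.apply ℝ E w) ∘L fderiv ℝ (fderiv ℝ e.symm) (e (c t)))) (e (c t)) :=
    (h.hasFDerivAt_symm (e.map_source hct)).prodMk
      ((ContinuousLinearMap.apply ℝ E w).hasFDerivAt.comp _ hD2)
  have hLz := hL.hasFDerivAt hz
  rw [← hz'] at hLz
  have htot := (hLz.comp (e (c t)) hpair).congr_of_eventuallyEq hL'w
  rw [Function.comp_apply, htot.fderiv, hz']
  ext k
  have hl := (hL.hasFDerivAt_left hz).fderiv
  have hr := (hL.hasFDerivAt_right hz).fderiv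
  simp only at hl hr
  simp only [_root_.add_apply, ContinuousLinearMap.comp_apply, ContinuousLinearMap.prod_apply,
    ContinuousLinearMap.apply_apply]
  rw [hl, show fderiv ℝ (fun y => L (c t) y) (derivWithin c s t) = _ from hr]
  simp only [ContinuousLinearMap.comp_apply, ContinuousLinearMap.inl_apply,
    ContinuousLinearMap.inr_apply]
  rw [hsymm.eq w k, ← map_add]
  simp

/-- The map induced by a change of coordinates on canonical coordinates. -/
def _root_.cotangentLift (e : OpenPartialHomeomorph E E) (z : E × E) : E × E :=
  (e z.1, ContinuousLinearMap.adjoint (fderiv ℝ e.symm (e z.1)) z.2)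

theorem legendre_eq (h : IsLagrangianChange e L L') (hL : IsLagrangian U L) (hU : e.source ⊆ U)
    {x y : E} (hx : x ∈ e.source) (hy : y ≠ 0) :
    legendre L' (e x, fderiv ℝ e x y) = cotangentLift e (legendre L (x, y)) := by
  refine Prod.ext rfl (ext_inner_right ℝ fun w => ?_)
  change inner ℝ (momentum L' (e x, fderiv ℝ e x y)) w =
    inner ℝ (ContinuousLinearMap.adjoint (fderiv ℝ e.symm (e x)) (momentum L (x, y))) w
  rw [ContinuousLinearMap.adjoint_inner_left, momentum, momentum, inner_gradient_left,
    inner_gradient_left, (h.hasFDerivAt_velocity hL hU hx hy).fderiv]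
  rfl

theorem phaseCurve_comp (h : IsLagrangianChange e L L') (hL : IsLagrangian U L)
    (hU : e.source ⊆ U) {c : ℝ → E} {s : Set ℝ} {t : ℝ} (hs : UniqueDiffOn ℝ s) (ht : t ∈ s)
    (hct : c t ∈ e.source) (hc : EulerLagrangeAt L c s t) :
    phaseCurve L' (e ∘ c) s t = cotangentLift e (phaseCurve L c s t) := by
  have h1 : HasDerivWithinAt (e ∘ c) (fderiv ℝ e (c t) (derivWithin c s t)) s t :=
    (h.hasFDerivAt hct).comp_hasDerivWithinAt t hc.1.hasDerivWithinAt
  rw [phaseCurve, h1.derivWithin (hs t ht), phaseCurve, ← h.legendre_eq hL hU hct hc.2.1]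
  rfl

theorem adjoint_comp (h : IsLagrangianChange e L L') {x : E} (hx : x ∈ e.source) (p : E) :
    ContinuousLinearMap.adjoint (fderiv ℝ e x)
      (ContinuousLinearMap.adjoint (fderiv ℝ e.symm (e x)) p) = p := by
  refine ext_inner_right ℝ fun w => ?_
  rw [ContinuousLinearMap.adjoint_inner_left, ContinuousLinearMap.adjoint_inner_left,
    h.symm_apply hx]

theorem injOn_cotangentLift (h : IsLagrangianChange e L L') :
    InjOn (cotangentLift e) (e.source ×ˢ univ) := by
  rintro ⟨x, p⟩ ⟨hx, -⟩ ⟨x', p'⟩ ⟨hx', -⟩ heq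
  obtain ⟨h1, h2⟩ := Prod.ext_iff.1 heq
  simp only [cotangentLift] at h1 h2 hx hx'
  obtain rfl := e.injOn hx hx' h1
  rw [← h.adjoint_comp hx p, h2, h.adjoint_comp hx p']

theorem contDiffOn_cotangentLift (h : IsLagrangianChange e L L') :
    ContDiffOn ℝ ∞ (cotangentLift e) (e.source ×ˢ univ) := by
  have h1 : ContDiffOn ℝ ∞ (fun z : E × E => e z.1) (e.source ×ˢ univ) :=
    h.smooth.comp contDiffOn_fst fun z hz => hz.1
  have hsm : ContDiffOn ℝ ∞ (fderiv ℝ e.symm) e.target :=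
    h.smooth_symm.fderiv_of_isOpen e.open_target (by exact_mod_cast (le_top : (⊤ + 1 : ℕ∞) ≤ ⊤))
  have h2 : ContDiffOn ℝ ∞ (fun z : E × E => fderiv ℝ e.symm (e z.1)) (e.source ×ˢ univ) :=
    hsm.comp h1 fun z hz => e.map_source hz.1
  have h3 : ContDiffOn ℝ ∞ (fun z : E × E =>
      (ContinuousLinearMap.adjoint (𝕜 := ℝ) (E := E) (F := E)).toContinuousLinearEquiv
        (fderiv ℝ e.symm (e z.1))) (e.source ×ˢ univ) :=
    ContDiff.comp_contDiffOn (ContinuousLinearEquiv.contDiff _) h2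
  exact h1.prodMk (h3.clm_apply contDiffOn_snd)

variable [FiniteDimensional ℝ E]

/-- The derivative is block triangular, with the derivative of e on positions and its inverse
adjoint on momenta; the two determinants are inverse to each other. -/
theorem abs_det_fderiv_cotangentLift (h : IsLagrangianChange e L L') {z : E × E}
    (hz : z.1 ∈ e.source) : |(fderiv ℝ (cotangentLift e) z).det| = 1 := by
  have hz' : z ∈ e.source ×ˢ (univ : Set E) := ⟨hz, mem_univ _⟩
  have hopen : IsOpen (e.source ×ˢ (univ : Set E)) := e.open_source.prod isOpen_univ
  have hd : HasFDerivAt (cotangentLift e) (fderiv ℝ (cotangentLift e) z) z :=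
    ((h.contDiffOn_cotangentLift.contDiffAt (hopen.mem_nhds hz')).differentiableAt
      (by simp)).hasFDerivAt
  set T := fderiv ℝ (cotangentLift e) z with hT
  set D := ContinuousLinearMap.adjoint (fderiv ℝ e.symm (e z.1)) with hD
  have h1 : ∀ w, (T w).1 = fderiv ℝ e z.1 w.1 := fun w =>
    congrArg (fun S => S w) ((hasFDerivAt_fst.comp z hd).unique
      ((h.hasFDerivAt hz).comp z hasFDerivAt_fst))
  have h2 : ∀ p, (T (0, p)).2 = D p := fun p => by
    have h3 : HasFDerivAt (fun p => cotangentLift e (z.1, p)) (T ∘L ContinuousLinearMap.inr ℝ E E)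
        z.2 := HasFDerivAt.comp (g := cotangentLift e) (f := fun p => (z.1, p)) z.2 hd
        (hasFDerivAt_prodMk_right z.1 z.2)
    have h4 : HasFDerivAt D (ContinuousLinearMap.snd ℝ E E ∘L T ∘L ContinuousLinearMap.inr ℝ E E)
        z.2 := HasFDerivAt.comp (g := Prod.snd) (f := fun p => cotangentLift e (z.1, p)) z.2
      hasFDerivAt_snd h3
    exact congrArg (fun S => S p) (h4.unique D.hasFDerivAt)
  set b := Module.finBasis ℝ E
  have h4 : LinearMap.toMatrix (b.prod b) (b.prod b) (T : E × E →ₗ[ℝ] E × E) =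
      Matrix.fromBlocks (LinearMap.toMatrix b b (fderiv ℝ e z.1 : E →ₗ[ℝ] E)) 0
        (LinearMap.toMatrix b b ((ContinuousLinearMap.snd ℝ E E ∘L T ∘L
          ContinuousLinearMap.inl ℝ E E : E →L[ℝ] E) : E →ₗ[ℝ] E))
        (LinearMap.toMatrix b b (D : E →ₗ[ℝ] E)) := by
    ext i j
    rcases i with i | i <;> rcases j with j | j <;> simp [LinearMap.toMatrix_apply, h1, h2]
  have h5 : T.det = (fderiv ℝ e z.1).det * D.det := by
    rw [ContinuousLinearMap.det, ← LinearMap.det_toMatrix (b.prod b), h4,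
      Matrix.det_fromBlocks_zero₁₂, LinearMap.det_toMatrix, LinearMap.det_toMatrix]
  have h6 : D.det = (fderiv ℝ e.symm (e z.1)).det := by
    have := LinearMap.toMatrix_adjoint (stdOrthonormalBasis ℝ E) (stdOrthonormalBasis ℝ E)
      (fderiv ℝ e.symm (e z.1) : E →ₗ[ℝ] E)
    rw [ContinuousLinearMap.det, ContinuousLinearMap.det,
      ← LinearMap.det_toMatrix (stdOrthonormalBasis ℝ E).toBasis,
      ← LinearMap.det_toMatrix (stdOrthonormalBasis ℝ E).toBasis (fderiv ℝ e.symm (e z.1) : E →ₗ[ℝ] E),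
      ← star_trivial (LinearMap.toMatrix _ _ (fderiv ℝ e.symm (e z.1) : E →ₗ[ℝ] E)).det,
      ← Matrix.det_conjTranspose, ← this]
    rfl
  have h7 : (fderiv ℝ e z.1).det * (fderiv ℝ e.symm (e z.1)).det = 1 := by
    have := congrArg (fun S : E →L[ℝ] E => LinearMap.det (S : E →ₗ[ℝ] E)) (h.fderiv_comp_symm hz)
    rw [ContinuousLinearMap.det, ContinuousLinearMap.det, ← LinearMap.det_comp]
    exact this.trans LinearMap.det_id
  rw [h5, h6, h7, abs_one]

/-- The map induced on canonical coordinates by a change of coordinates preserves volume. -/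
theorem measure_image_cotangentLift (h : IsLagrangianChange e L L') [MeasurableSpace E]
    [BorelSpace E] (μ : Measure (E × E)) [μ.IsAddHaarMeasure] {A : Set (E × E)}
    (hA : A ⊆ e.source ×ˢ univ) (hAm : MeasurableSet A) :
    MeasurableSet (cotangentLift e '' A) ∧ μ (cotangentLift e '' A) = μ A := by
  have hopen : IsOpen (e.source ×ˢ (univ : Set E)) := e.open_source.prod isOpen_univ
  have hd : ∀ z ∈ A, HasFDerivWithinAt (cotangentLift e) (fderiv ℝ (cotangentLift e) z) A z :=
    fun z hz => ((h.contDiffOn_cotangentLift.contDiffAt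
      (hopen.mem_nhds (hA hz))).differentiableAt (by simp)).hasFDerivAt.hasFDerivWithinAt
  have hinj := h.injOn_cotangentLift.mono hA
  refine ⟨measurable_image_of_fderivWithin hAm hd hinj, ?_⟩
  rw [← lintegral_abs_det_fderiv_eq_addHaar_image μ hAm hd hinj,
    setLIntegral_congr_fun hAm (g := fun _ => 1) fun z hz => by
      simp only [h.abs_det_fderiv_cotangentLift (hA hz).1, ENNReal.ofReal_one]]
  simp

end IsLagrangianChange

end ChartChange

/-! ### Finsler metrics and geodesics in charts. -/

namespace FinslerMetric

variable {n : ℕ} {M : Type*} [TopologicalSpace M]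
  [ChartedSpace (EuclideanSpace ℝ (Fin n)) M] [IsManifold (𝓡 n) ∞ M]
  {φ ψ : OpenPartialHomeomorph M (EuclideanSpace ℝ (Fin n))}

theorem contMDiff_totalSpace_mk {E : Type*} [NormedAddCommGroup E] [NormedSpace ℝ E] :
    ContMDiff 𝓘(ℝ, E × E) 𝓘(ℝ, E).tangent ∞
      (fun z : E × E => (⟨z.1, z.2⟩ : TangentBundle 𝓘(ℝ, E) E)) := by
  intro z
  rw [Bundle.contMDiffAt_totalSpace]
  refine ⟨contMDiff_iff_contDiff.2 contDiff_fst z, ?_⟩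
  simp only [trivializationAt_model_space_apply]
  exact contMDiff_iff_contDiff.2 contDiff_snd z

theorem inChart_eq (F : FinslerMetric n M) (φ : OpenPartialHomeomorph M (EuclideanSpace ℝ (Fin n)))
    (x y : EuclideanSpace ℝ (Fin n)) :
    F.inChart φ x y = F.toFun (tangentMap (𝓡 n) (𝓡 n) φ.symm ⟨x, y⟩) := rfl

theorem mfderiv_symm_ne_zero (hφ : φ ∈ atlas (EuclideanSpace ℝ (Fin n)) M)
    {x y : EuclideanSpace ℝ (Fin n)} (hx : x ∈ φ.target) (hy : y ≠ 0) :
    mfderiv (𝓡 n) (𝓡 n) φ.symm x y ≠ 0 := fun h0 => hy <| by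
  have hd := (mdifferentiable_of_mem_atlas (I := 𝓡 n) hφ).symm
  exact hd.mfderiv_injective (x := x) hx (h0.trans (map_zero _).symm)

theorem contDiffOn_inChart (F : FinslerMetric n M) (hφ : φ ∈ atlas (EuclideanSpace ℝ (Fin n)) M) :
    ContDiffOn ℝ ∞ (fun z : EuclideanSpace ℝ (Fin n) × EuclideanSpace ℝ (Fin n) =>
      F.inChart φ z.1 z.2) (φ.target ×ˢ {0}ᶜ) := by
  rw [← contMDiffOn_iff_contDiffOn]
  have h1 : ContMDiffOn (𝓡 n) (𝓡 n) ∞ φ.symm φ.target :=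
    contMDiffOn_symm_of_mem_maximalAtlas (IsManifold.subset_maximalAtlas hφ)
  have h2 := h1.contMDiffOn_tangentMapWithin (m := ∞)
    (by exact_mod_cast (le_top : (⊤ + 1 : ℕ∞) ≤ ⊤)) φ.open_target.uniqueMDiffOn
  have h3 := h2.comp (contMDiff_totalSpace_mk (E := EuclideanSpace ℝ (Fin n))).contMDiffOn
    (s := φ.target ×ˢ {0}ᶜ) (fun z hz => hz.1)
  have h4 : ∀ z ∈ φ.target ×ˢ ({0}ᶜ : Set (EuclideanSpace ℝ (Fin n))),
      tangentMapWithin (𝓡 n) (𝓡 n) φ.symm φ.target ⟨z.1, z.2⟩ =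
        tangentMap (𝓡 n) (𝓡 n) φ.symm ⟨z.1, z.2⟩ := fun z hz =>
    tangentMapWithin_eq_tangentMap (φ.open_target.uniqueMDiffOn _ hz.1)
      (mdifferentiableAt_atlas_symm hφ hz.1)
  refine (F.smooth.comp h3 fun z hz => ?_).congr fun z hz => ?_
  · simp only [mem_preimage, Function.comp_apply, h4 z hz]
    exact mfderiv_symm_ne_zero hφ hz.1 hz.2
  · simp only [Function.comp_apply, h4 z hz]
    rfl

theorem inChart_smul (F : FinslerMetric n M) (hF : F.IsAbsolutelyHomogeneous)
    (x y : EuclideanSpace ℝ (Fin n)) (c : ℝ) :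
    F.inChart φ x (c • y) = |c| * F.inChart φ x y := by
  exact (congrArg (fun v => F.toFun ⟨φ.symm x, v⟩)
    ((mfderiv (𝓡 n) (𝓡 n) φ.symm x).map_smul c y)).trans (hF _ _ c)

theorem inChart_pos (F : FinslerMetric n M) (hφ : φ ∈ atlas (EuclideanSpace ℝ (Fin n)) M)
    {x y : EuclideanSpace ℝ (Fin n)} (hx : x ∈ φ.target) (hy : y ≠ 0) : 0 < F.inChart φ x y :=
  F.pos _ _ (mfderiv_symm_ne_zero hφ hx hy)

theorem iteratedDeriv_inChart_pos (F : FinslerMetric n M)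
    (hφ : φ ∈ atlas (EuclideanSpace ℝ (Fin n)) M) {x v w : EuclideanSpace ℝ (Fin n)}
    (hx : x ∈ φ.target) (hv : v ≠ 0) (hw : w ≠ 0) :
    0 < (1 / 2) * iteratedDeriv 2 (fun t : ℝ => F.inChart φ x (v + t • w) ^ 2) 0 := by
  have h := F.stronglyConvex (φ.symm x) _ _ (mfderiv_symm_ne_zero hφ hx hv)
    (mfderiv_symm_ne_zero hφ hx hw)
  refine h.trans_eq ?_
  congr 2
  funext t
  have h1 : mfderiv (𝓡 n) (𝓡 n) φ.symm x (v + t • w) =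
      mfderiv (𝓡 n) (𝓡 n) φ.symm x v + t • mfderiv (𝓡 n) (𝓡 n) φ.symm x w :=
    ((mfderiv (𝓡 n) (𝓡 n) φ.symm x).map_add v (t • w)).trans
      (congrArg _ ((mfderiv (𝓡 n) (𝓡 n) φ.symm x).map_smul t w))
  exact congrArg (fun v => F.toFun ⟨φ.symm x, v⟩ ^ 2) h1.symm

theorem isMinkowskiNorm_inChart (F : FinslerMetric n M) (hF : F.IsAbsolutelyHomogeneous)
    (hφ : φ ∈ atlas (EuclideanSpace ℝ (Fin n)) M) {x : EuclideanSpace ℝ (Fin n)}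
    (hx : x ∈ φ.target) : IsMinkowskiNorm (F.inChart φ x) where
  smooth := (F.contDiffOn_inChart hφ).comp (contDiff_prodMk_right x).contDiffOn
    fun _ hy => ⟨hx, hy⟩
  pos _ hy := F.inChart_pos hφ hx hy
  homogeneous c _ := F.inChart_smul hF x _ c
  stronglyConvex _ _ hv hw := F.iteratedDeriv_inChart_pos hφ hx hv hw

theorem isLagrangian (F : FinslerMetric n M) (hF : F.IsAbsolutelyHomogeneous)
    (hφ : φ ∈ atlas (EuclideanSpace ℝ (Fin n)) M) : IsLagrangian φ.target (F.lagrangian φ) where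
  isOpen := φ.open_target
  smooth := ((F.contDiffOn_inChart hφ).pow 2).div_const 2
  pos x hx y hy := by
    have := F.inChart_pos hφ hx hy
    simp only [lagrangian]
    positivity
  homogeneous x _ c y := by
    simp only [lagrangian]
    rw [F.inChart_smul hF, mul_pow, sq_abs]
    ring
  convex x hx v w hv hw := by
    have h := F.iteratedDeriv_inChart_pos hφ hx hv hw
    have h1 : (fun t : ℝ => F.lagrangian φ x (v + t • w)) =
        fun t : ℝ => (1 / 2) * F.inChart φ x (v + t • w) ^ 2 := by
      funext t; simp only [lagrangian]; ring
    rw [h1, iteratedDeriv_const_mul_field]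
    exact h

/-- The chain rule for φ⁻¹ = ψ⁻¹ ∘ (ψ ∘ φ⁻¹) on the overlap: both coordinate velocities represent
the same tangent vector. -/
theorem isLagrangianChange (F : FinslerMetric n M) (hφ : φ ∈ atlas (EuclideanSpace ℝ (Fin n)) M)
    (hψ : ψ ∈ atlas (EuclideanSpace ℝ (Fin n)) M) :
    IsLagrangianChange (φ.symm ≫ₕ ψ) (F.lagrangian φ) (F.lagrangian ψ) := by
  have hsm : ∀ {φ ψ : OpenPartialHomeomorph M (EuclideanSpace ℝ (Fin n))},
      φ ∈ atlas (EuclideanSpace ℝ (Fin n)) M → ψ ∈ atlas (EuclideanSpace ℝ (Fin n)) M →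
      ContDiffOn ℝ ∞ (φ.symm ≫ₕ ψ) (φ.symm ≫ₕ ψ).source := by
    intro φ ψ hφ hψ
    rw [← contMDiffOn_iff_contDiffOn]
    have h1 : ContMDiffOn (𝓡 n) (𝓡 n) ∞ φ.symm φ.target :=
      contMDiffOn_symm_of_mem_maximalAtlas (IsManifold.subset_maximalAtlas hφ)
    have h2 : ContMDiffOn (𝓡 n) (𝓡 n) ∞ ψ ψ.source :=
      contMDiffOn_of_mem_maximalAtlas (IsManifold.subset_maximalAtlas hψ)
    exact h2.comp (h1.mono fun x hx => hx.1) fun x hx => hx.2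
  refine ⟨hsm hφ hψ, hsm hψ hφ, fun x hx y => ?_⟩
  have h1 := (hsm hφ hψ).contDiffAt ((φ.symm ≫ₕ ψ).open_source.mem_nhds hx)
  have h2 : MDifferentiableAt (𝓡 n) (𝓡 n) (φ.symm ≫ₕ ψ) x :=
    (h1.differentiableAt (by simp)).mdifferentiableAt
  have hopen := (φ.symm ≫ₕ ψ).open_source
  have h3 : MDifferentiableAt (𝓡 n) (𝓡 n) ψ.symm ((φ.symm ≫ₕ ψ) x) :=
    mdifferentiableAt_atlas_symm hψ (ψ.map_source hx.2)
  have h4 : tangentMap (𝓡 n) (𝓡 n) φ.symm ⟨x, y⟩ =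
      tangentMap (𝓡 n) (𝓡 n) ψ.symm (tangentMap (𝓡 n) (𝓡 n) (φ.symm ≫ₕ ψ) ⟨x, y⟩) := by
    rw [← tangentMap_comp_at _ h3 h2,
      ← tangentMapWithin_eq_tangentMap (p := ⟨x, y⟩) (hopen.uniqueMDiffOn _ hx)
        (mdifferentiableAt_atlas_symm hφ hx.1),
      ← tangentMapWithin_eq_tangentMap (p := ⟨x, y⟩) (hopen.uniqueMDiffOn _ hx) (h3.comp x h2)]
    refine tangentMapWithin_congr (fun z hz => ?_) _ hx
    exact (ψ.left_inv hz.2).symm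
  have h5 : tangentMap (𝓡 n) (𝓡 n) (φ.symm ≫ₕ ψ) ⟨x, y⟩ =
      ⟨(φ.symm ≫ₕ ψ) x, fderiv ℝ (φ.symm ≫ₕ ψ) x y⟩ := by
    rw [tangentMap, mfderiv_eq_fderiv]
    rfl
  rw [lagrangian, lagrangian, inChart_eq, inChart_eq, h4, h5]

theorem isGeodesicOn_iff {F : FinslerMetric n M} {γ : ℝ → M} {s : Set ℝ} :
    F.IsGeodesicOn γ s ↔ ContinuousOn γ s ∧ ∀ φ ∈ atlas (EuclideanSpace ℝ (Fin n)) M, ∀ t ∈ s,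
      γ t ∈ φ.source → EulerLagrangeAt (F.lagrangian φ) (φ ∘ γ) s t := Iff.rfl

/-- The lift of a curve to phase space in the canonical coordinates of a chart. -/
def phase (F : FinslerMetric n M) (φ : OpenPartialHomeomorph M (EuclideanSpace ℝ (Fin n)))
    (γ : ℝ → M) (s : Set ℝ) (t : ℝ) : EuclideanSpace ℝ (Fin n) × EuclideanSpace ℝ (Fin n) :=
  phaseCurve (F.lagrangian φ) (φ ∘ γ) s t

theorem phase_fst (F : FinslerMetric n M) (γ : ℝ → M) (s : Set ℝ) (t : ℝ) :
    (F.phase φ γ s t).1 = φ (γ t) := rfl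

/-- Coordinate invariance of the Euler–Lagrange equation: checking it in one chart containing the
curve suffices for all charts. -/
theorem isGeodesicOn_of_eulerLagrangeAt {F : FinslerMetric n M} (hF : F.IsAbsolutelyHomogeneous)
    (hφ : φ ∈ atlas (EuclideanSpace ℝ (Fin n)) M) {s : Set ℝ} (hs : UniqueDiffOn ℝ s)
    {c : ℝ → EuclideanSpace ℝ (Fin n)}
    (hc : ∀ t ∈ s, c t ∈ φ.target ∧ EulerLagrangeAt (F.lagrangian φ) c s t) :
    F.IsGeodesicOn (φ.symm ∘ c) s := by
  rw [isGeodesicOn_iff]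
  refine ⟨φ.continuousOn_symm.comp (fun t ht => (hc t ht).2.1.continuousWithinAt)
    fun t ht => (hc t ht).1, fun ψ hψ t ht hψt => ?_⟩
  exact ((F.isLagrangianChange hφ hψ).eulerLagrangeAt_comp (F.isLagrangian hF hφ)
    (fun x hx => hx.1) hs ht ⟨(hc t ht).1, hψt⟩
    (eventually_nhdsWithin_of_forall fun r hr => (hc r hr).2)).1

namespace IsGeodesicOn

variable {F : FinslerMetric n M} {γ γ' : ℝ → M} {s s' : Set ℝ} {t : ℝ}

theorem eventually_mem_source (h : F.IsGeodesicOn γ s) (ht : t ∈ s) (hγ : γ t ∈ φ.source) :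
    ∀ᶠ r in 𝓝[s] t, r ∈ s ∧ γ r ∈ φ.source := by
  filter_upwards [self_mem_nhdsWithin,
    (h.1 t ht).preimage_mem_nhdsWithin (φ.open_source.mem_nhds hγ)] with r h1 h2 using ⟨h1, h2⟩

theorem eventually_eulerLagrangeAt (h : F.IsGeodesicOn γ s)
    (hφ : φ ∈ atlas (EuclideanSpace ℝ (Fin n)) M) (ht : t ∈ s) (hγ : γ t ∈ φ.source) :
    ∀ᶠ r in 𝓝[s] t, EulerLagrangeAt (F.lagrangian φ) (φ ∘ γ) s r := by
  filter_upwards [h.eventually_mem_source ht hγ] with r hr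
    using (isGeodesicOn_iff.1 h).2 φ hφ r hr.1 hr.2

theorem mono (h : F.IsGeodesicOn γ s) (hss : s' ⊆ s) (hs' : UniqueDiffOn ℝ s') :
    F.IsGeodesicOn γ s' := by
  rw [isGeodesicOn_iff]
  exact ⟨h.1.mono hss, fun φ hφ t ht hγ => ((isGeodesicOn_iff.1 h).2 φ hφ t (hss ht) hγ |>.mono
      ((h.eventually_eulerLagrangeAt hφ (hss ht) hγ).mono fun r hr => hr.1) hss hs' ht).1⟩

theorem phase_mono (h : F.IsGeodesicOn γ s) (hφ : φ ∈ atlas (EuclideanSpace ℝ (Fin n)) M)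
    (hss : s' ⊆ s) (hs' : UniqueDiffOn ℝ s') (ht : t ∈ s') (hγ : γ t ∈ φ.source) :
    F.phase φ γ s' t = F.phase φ γ s t := by
  have h1 := ((isGeodesicOn_iff.1 h).2 φ hφ t (hss ht) hγ |>.mono
      ((h.eventually_eulerLagrangeAt hφ (hss ht) hγ).mono fun r hr => hr.1) hss hs' ht).2
  rw [phase, phaseCurve, h1]
  rfl

theorem _root_.FinslerMetric.phase_congr (heq : EqOn γ' γ s) (ht : t ∈ s) :
    F.phase φ γ' s t = F.phase φ γ s t := by
  have h1 : EqOn (φ ∘ γ') (φ ∘ γ) s := fun r hr => congrArg φ (heq hr)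
  rw [phase, phaseCurve, derivWithin_congr h1 (h1 ht), h1 ht]
  rfl

theorem comp_add_const (h : F.IsGeodesicOn γ s) {a : ℝ} (hs : ∀ r, r + a ∈ s ↔ r ∈ s') :
    F.IsGeodesicOn (fun r => γ (r + a)) s' := by
  rw [isGeodesicOn_iff]
  refine ⟨h.1.comp (by fun_prop) fun r hr => (hs r).2 hr, fun φ hφ t ht hγ => ?_⟩
  exact (((isGeodesicOn_iff.1 h).2 φ hφ (t + a) ((hs t).2 ht) hγ).comp_add_const hs).1

theorem phase_comp_add_const (h : F.IsGeodesicOn γ s)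
    (hφ : φ ∈ atlas (EuclideanSpace ℝ (Fin n)) M) {a : ℝ} (hs : ∀ r, r + a ∈ s ↔ r ∈ s')
    (ht : t ∈ s') (hγ : γ (t + a) ∈ φ.source) :
    F.phase φ (fun r => γ (r + a)) s' t = F.phase φ γ s (t + a) := by
  have h1 := (((isGeodesicOn_iff.1 h).2 φ hφ (t + a) ((hs t).2 ht) hγ).comp_add_const hs).2
  rw [phase, phaseCurve]
  exact congrArg (fun v => legendre (F.lagrangian φ) (φ (γ (t + a)), v)) h1

theorem phase_change (h : F.IsGeodesicOn γ s) (hF : F.IsAbsolutelyHomogeneous)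
    (hφ : φ ∈ atlas (EuclideanSpace ℝ (Fin n)) M) (hψ : ψ ∈ atlas (EuclideanSpace ℝ (Fin n)) M)
    (hs : UniqueDiffOn ℝ s) (ht : t ∈ s) (hγφ : γ t ∈ φ.source) (hγψ : γ t ∈ ψ.source) :
    F.phase ψ γ s t = cotangentLift (φ.symm ≫ₕ ψ) (F.phase φ γ s t) := by
  have hmem : (φ ∘ γ) t ∈ (φ.symm ≫ₕ ψ).source :=
    ⟨φ.map_source hγφ, by
      change φ.symm (φ (γ t)) ∈ ψ.source
      rwa [φ.left_inv hγφ]⟩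
  have h1 := (F.isLagrangianChange hφ hψ).phaseCurve_comp (F.isLagrangian hF hφ)
    (fun x hx => hx.1) hs ht hmem (h.2 φ hφ t ht hγφ)
  have h2 : (ψ ∘ γ) =ᶠ[𝓝[s] t] (φ.symm ≫ₕ ψ) ∘ (φ ∘ γ) := by
    filter_upwards [h.eventually_mem_source ht hγφ] with r hr
    simp [φ.left_inv hr.2]
  rw [phase, phase, ← h1, phaseCurve, phaseCurve, h2.derivWithin_of_subset.self_of_nhdsWithin ht,
    h2.self_of_nhdsWithin ht]

theorem phase_mem (h : F.IsGeodesicOn γ s) (hF : F.IsAbsolutelyHomogeneous)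
    (hφ : φ ∈ atlas (EuclideanSpace ℝ (Fin n)) M) (ht : t ∈ s) (hγ : γ t ∈ φ.source) :
    F.phase φ γ s t ∈ (F.isLagrangian hF hφ).legendreHomeo.target :=
  (F.isLagrangian hF hφ).phaseCurve_mem (h.2 φ hφ t ht hγ) (φ.map_source hγ)

theorem hasDerivWithinAt_phase (h : F.IsGeodesicOn γ s) (hF : F.IsAbsolutelyHomogeneous)
    (hφ : φ ∈ atlas (EuclideanSpace ℝ (Fin n)) M) (ht : t ∈ s) (hγ : γ t ∈ φ.source) :
    HasDerivWithinAt (F.phase φ γ s) ((F.isLagrangian hF hφ).hamiltonField (F.phase φ γ s t)) s t :=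
  (F.isLagrangian hF hφ).hasDerivWithinAt_phaseCurve (h.2 φ hφ t ht hγ) (φ.map_source hγ)

end IsGeodesicOn

end FinslerMetric

/-! ### Uniqueness of geodesics with a given state. -/

/-- Local uniqueness for solutions of an ordinary differential equation on an interval. -/
theorem eventuallyEq_of_hasDerivWithinAt {Z : Type*} [NormedAddCommGroup Z] [NormedSpace ℝ Z]
    {f : Z → Z} {z₁ z₂ : ℝ → Z} {s : Set ℝ} {t₀ : ℝ} (hf : ContDiffAt ℝ 1 f (z₁ t₀))
    (hs : s.OrdConnected) (ht₀ : t₀ ∈ s) (h0 : z₁ t₀ = z₂ t₀)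
    (h1 : ∀ᶠ t in 𝓝[s] t₀, HasDerivWithinAt z₁ (f (z₁ t)) s t)
    (h2 : ∀ᶠ t in 𝓝[s] t₀, HasDerivWithinAt z₂ (f (z₂ t)) s t) : z₁ =ᶠ[𝓝[s] t₀] z₂ := by
  obtain ⟨K, V, hV, hK⟩ := hf.exists_lipschitzOnWith
  have hc1 := (h1.self_of_nhdsWithin ht₀).continuousWithinAt.preimage_mem_nhdsWithin hV
  have hc2 := (h2.self_of_nhdsWithin ht₀).continuousWithinAt.preimage_mem_nhdsWithin (h0 ▸ hV)
  have hall : ∀ᶠ t in 𝓝[s] t₀, z₁ t ∈ V ∧ z₂ t ∈ V ∧ HasDerivWithinAt z₁ (f (z₁ t)) s t ∧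
      HasDerivWithinAt z₂ (f (z₂ t)) s t := by
    filter_upwards [hc1, hc2, h1, h2] with t a b c d using ⟨a, b, c, d⟩
  obtain ⟨δ, hδ, hball⟩ := Metric.mem_nhdsWithin_iff.1 hall
  refine Metric.mem_nhdsWithin_iff.2 ⟨δ, hδ, fun r hr => ?_⟩
  have hin : ∀ t ∈ uIcc t₀ r, t ∈ s ∧ z₁ t ∈ V ∧ z₂ t ∈ V ∧ HasDerivWithinAt z₁ (f (z₁ t)) s t ∧
      HasDerivWithinAt z₂ (f (z₂ t)) s t := fun t ht => by
    have hts : t ∈ s := hs.uIcc_subset ht₀ hr.2 ht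
    refine ⟨hts, hball ⟨?_, hts⟩⟩
    rw [mem_ball, Real.dist_eq]
    exact (abs_sub_left_of_mem_uIcc ht).trans_lt (by simpa [Real.dist_eq] using hr.1)
  have hsub : uIcc t₀ r ⊆ s := fun t ht => (hin t ht).1
  have hcont1 : ContinuousOn z₁ (uIcc t₀ r) := fun t ht =>
    ((hin t ht).2.2.2.1.mono hsub).continuousWithinAt
  have hcont2 : ContinuousOn z₂ (uIcc t₀ r) := fun t ht =>
    ((hin t ht).2.2.2.2.mono hsub).continuousWithinAt
  rcases le_total t₀ r with hle | hle
  · rw [uIcc_of_le hle] at hin hsub hcont1 hcont2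
    have hI : ∀ t ∈ Ico t₀ r, Icc t₀ r ∈ 𝓝[≥] t := fun t ht =>
      Icc_mem_nhdsGE_of_mem ht
    exact ODE_solution_unique_of_mem_Icc_right (v := fun _ => f) (s := fun _ => V) (fun _ _ => hK)
      hcont1 (fun t ht => ((hin t (Ico_subset_Icc_self ht)).2.2.2.1.mono
        hsub).mono_of_mem_nhdsWithin (hI t ht))
      (fun t ht => (hin t (Ico_subset_Icc_self ht)).2.1)
      hcont2 (fun t ht => ((hin t (Ico_subset_Icc_self ht)).2.2.2.2.mono
        hsub).mono_of_mem_nhdsWithin (hI t ht))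
      (fun t ht => (hin t (Ico_subset_Icc_self ht)).2.2.1) h0 ⟨hle, le_rfl⟩
  · rw [uIcc_of_ge hle] at hin hsub hcont1 hcont2
    have hI : ∀ t ∈ Ioc r t₀, Icc r t₀ ∈ 𝓝[≤] t := fun t ht =>
      Icc_mem_nhdsLE_of_mem ht
    exact ODE_solution_unique_of_mem_Icc_left (v := fun _ => f) (s := fun _ => V) (fun _ _ => hK)
      hcont1 (fun t ht => ((hin t (Ioc_subset_Icc_self ht)).2.2.2.1.mono
        hsub).mono_of_mem_nhdsWithin (hI t ht))
      (fun t ht => (hin t (Ioc_subset_Icc_self ht)).2.1)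
      hcont2 (fun t ht => ((hin t (Ioc_subset_Icc_self ht)).2.2.2.2.mono
        hsub).mono_of_mem_nhdsWithin (hI t ht))
      (fun t ht => (hin t (Ioc_subset_Icc_self ht)).2.2.1) h0 ⟨le_rfl, hle⟩

namespace FinslerMetric

variable {n : ℕ} {M : Type*} [TopologicalSpace M]
  [ChartedSpace (EuclideanSpace ℝ (Fin n)) M] [IsManifold (𝓡 n) ∞ M]
  {φ ψ χ : OpenPartialHomeomorph M (EuclideanSpace ℝ (Fin n))}
  {F : FinslerMetric n M} {γ γ' : ℝ → M} {s : Set ℝ} {t : ℝ}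

namespace IsGeodesicOn

theorem eventuallyEq_of_phase_eq (h : F.IsGeodesicOn γ s) (h' : F.IsGeodesicOn γ' s)
    (hF : F.IsAbsolutelyHomogeneous) (hφ : φ ∈ atlas (EuclideanSpace ℝ (Fin n)) M)
    (hs : s.OrdConnected) (ht : t ∈ s) (hγ : γ t ∈ φ.source) (hγ' : γ' t ∈ φ.source)
    (heq : F.phase φ γ s t = F.phase φ γ' s t) : γ =ᶠ[𝓝[s] t] γ' := by
  have hL := F.isLagrangian hF hφ
  have h1 : F.phase φ γ s =ᶠ[𝓝[s] t] F.phase φ γ' s := by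
    refine eventuallyEq_of_hasDerivWithinAt (f := hL.hamiltonField)
      ((hL.contDiffOn_hamiltonField.contDiffAt (hL.legendreHomeo.open_target.mem_nhds
        (h.phase_mem hF hφ ht hγ))).of_le (by simp)) hs ht heq ?_ ?_
    · filter_upwards [h.eventually_mem_source ht hγ] with r hr
        using h.hasDerivWithinAt_phase hF hφ hr.1 hr.2
    · filter_upwards [h'.eventually_mem_source ht hγ'] with r hr
        using h'.hasDerivWithinAt_phase hF hφ hr.1 hr.2
  filter_upwards [h1, h.eventually_mem_source ht hγ, h'.eventually_mem_source ht hγ']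
    with r h2 h3 h4 using φ.injOn h3.2 h4.2 (congrArg Prod.fst h2 : _)

/-- An open and closed argument on the times at which the two germs agree. Openness is immediate; at
a limit of such times positions and momenta agree by continuity, and local uniqueness for Hamilton's
equations applies. -/
theorem eqOn_of_phase_eq [T2Space M] (h : F.IsGeodesicOn γ s) (h' : F.IsGeodesicOn γ' s)
    (hF : F.IsAbsolutelyHomogeneous) (hφ : φ ∈ atlas (EuclideanSpace ℝ (Fin n)) M)
    (hs : s.OrdConnected) (ht : t ∈ s) (hγ : γ t ∈ φ.source)
    (hγ' : γ' t ∈ φ.source) (heq : F.phase φ γ s t = F.phase φ γ' s t) : EqOn γ γ' s := by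
  have hstep : ∀ x ∈ s, ∀ᶠ y in 𝓝[s] x, ((γ =ᶠ[𝓝[s] x] γ') ↔ (γ =ᶠ[𝓝[s] y] γ')) := by
    intro x hx
    by_cases hA : γ =ᶠ[𝓝[s] x] γ'
    · filter_upwards [eventually_eventually_nhdsWithin.2 hA] with y hy using iff_of_true hA hy
    · by_contra hcon
      have hfreq : ∃ᶠ y in 𝓝[s] x, y ∈ s ∧ γ =ᶠ[𝓝[s] y] γ' := by
        have h1 := (not_eventually.1 hcon).and_eventually self_mem_nhdsWithin
        refine h1.mono fun y hy => ⟨hy.2, ?_⟩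
        by_contra h2
        exact hy.1 (iff_of_false hA h2)
      -- The Hausdorff property is needed to put both curves in a common chart before their momenta
      -- can be compared.
      have hxx : γ x = γ' x := tendsto_nhds_unique_of_frequently_eq (h.1 x hx) (h'.1 x hx)
        (hfreq.mono fun y hy => hy.2.self_of_nhdsWithin hy.1)
      set χ := chartAt (EuclideanSpace ℝ (Fin n)) (γ x)
      have hχ := chart_mem_atlas (EuclideanSpace ℝ (Fin n)) (γ x)
      have hsrc : γ x ∈ χ.source := mem_chart_source _ _
      have hsrc' : γ' x ∈ χ.source := hxx ▸ hsrc
      refine hA (h.eventuallyEq_of_phase_eq h' hF hχ hs hx hsrc hsrc' ?_)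
      refine tendsto_nhds_unique_of_frequently_eq
        (h.hasDerivWithinAt_phase hF hχ hx hsrc).continuousWithinAt
        (h'.hasDerivWithinAt_phase hF hχ hx hsrc').continuousWithinAt (hfreq.mono fun y hy => ?_)
      have h1 : (χ ∘ γ) =ᶠ[𝓝[s] y] (χ ∘ γ') := hy.2.fun_comp χ
      rw [phase, phase, phaseCurve, phaseCurve, h1.derivWithin_of_subset.self_of_nhdsWithin hy.1,
        h1.self_of_nhdsWithin hy.1]
  have h0 := h.eventuallyEq_of_phase_eq h' hF hφ hs ht hγ hγ' heq
  intro r hr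
  exact ((hs.isPreconnected.induction₂
    (fun x y => (γ =ᶠ[𝓝[s] x] γ') ↔ (γ =ᶠ[𝓝[s] y] γ')) hstep
    (fun _ _ _ _ _ _ h1 h2 => h1.trans h2) (fun _ _ _ _ h1 => h1.symm) ht hr).1
      h0).self_of_nhdsWithin hr

end IsGeodesicOn

/-! ### The geodesic flow as local volume-preserving maps of phase space. -/

/-- The energy `F² / 2` of a curve, computed in a chart. -/
def energy (F : FinslerMetric n M) (φ : OpenPartialHomeomorph M (EuclideanSpace ℝ (Fin n)))
    (γ : ℝ → M) (s : Set ℝ) (t : ℝ) : ℝ :=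
  F.lagrangian φ (φ (γ t)) (derivWithin (φ ∘ γ) s t)

theorem IsGeodesicOn.hamiltonian_phase (h : F.IsGeodesicOn γ s) (hF : F.IsAbsolutelyHomogeneous)
    (hφ : φ ∈ atlas (EuclideanSpace ℝ (Fin n)) M) (ht : t ∈ s) (hγ : γ t ∈ φ.source) :
    (F.isLagrangian hF hφ).hamiltonian (F.phase φ γ s t) = F.energy φ γ s t := by
  have h1 := (F.isLagrangian hF hφ).symm_legendre (z := ((φ ∘ γ) t, derivWithin (φ ∘ γ) s t))
    ⟨φ.map_source hγ, (h.2 φ hφ t ht hγ).2.1⟩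
  rw [IsLagrangian.hamiltonian, phase, phaseCurve, h1]
  rfl

theorem IsGeodesicOn.energy_change (h : F.IsGeodesicOn γ s) (hF : F.IsAbsolutelyHomogeneous)
    (hφ : φ ∈ atlas (EuclideanSpace ℝ (Fin n)) M) (hψ : ψ ∈ atlas (EuclideanSpace ℝ (Fin n)) M)
    (hs : UniqueDiffOn ℝ s) (ht : t ∈ s) (hγφ : γ t ∈ φ.source) (hγψ : γ t ∈ ψ.source) :
    F.energy ψ γ s t = F.energy φ γ s t := by
  have hmem : (φ ∘ γ) t ∈ (φ.symm ≫ₕ ψ).source :=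
    ⟨φ.map_source hγφ, by
      change φ.symm (φ (γ t)) ∈ ψ.source
      rwa [φ.left_inv hγφ]⟩
  have h1 := ((F.isLagrangianChange hφ hψ).eulerLagrangeAt_comp (F.isLagrangian hF hφ)
    (fun x hx => hx.1) hs ht hmem (h.eventually_eulerLagrangeAt hφ ht hγφ)).2
  have h2 : (ψ ∘ γ) =ᶠ[𝓝[s] t] (φ.symm ≫ₕ ψ) ∘ (φ ∘ γ) := by
    filter_upwards [h.eventually_mem_source ht hγφ] with r hr
    simp [φ.left_inv hr.2]
  have h3 := h2.self_of_nhdsWithin ht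
  rw [energy, energy, h2.derivWithin_of_subset.self_of_nhdsWithin ht, h1]
  exact (congrArg (fun x => F.lagrangian ψ x _) h3).trans
    ((F.isLagrangianChange hφ hψ).comp _ hmem _).symm

/-- Near the point `z₀` of phase space, the geodesic flow of time `T` from the chart `φ` to the
chart `ψ` is a continuous and volume preserving map, which preserves the energy. -/
def HasPhaseTransport (F : FinslerMetric n M)
    (φ ψ : OpenPartialHomeomorph M (EuclideanSpace ℝ (Fin n))) (T : ℝ)
    (z₀ : EuclideanSpace ℝ (Fin n) × EuclideanSpace ℝ (Fin n)) : Prop :=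
  ∃ (U : Set (EuclideanSpace ℝ (Fin n) × EuclideanSpace ℝ (Fin n)))
    (g : EuclideanSpace ℝ (Fin n) × EuclideanSpace ℝ (Fin n) →
      EuclideanSpace ℝ (Fin n) × EuclideanSpace ℝ (Fin n)),
    IsOpen U ∧ z₀ ∈ U ∧ ContinuousOn g U ∧
    (∀ A ⊆ U, MeasurableSet A → MeasurableSet (g '' A) ∧ volume (g '' A) = volume A) ∧
    ∀ γ, F.IsGeodesicOn γ (Ici 0) → ∀ t, 0 ≤ t → γ t ∈ φ.source → F.phase φ γ (Ici 0) t ∈ U →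
      γ (t + T) ∈ ψ.source ∧ F.phase ψ γ (Ici 0) (t + T) = g (F.phase φ γ (Ici 0) t) ∧
      F.energy ψ γ (Ici 0) (t + T) = F.energy φ γ (Ici 0) t

theorem isAddHaarMeasure_volume_prod : (volume : Measure (EuclideanSpace ℝ (Fin n) ×
    EuclideanSpace ℝ (Fin n))).IsAddHaarMeasure :=
  inferInstanceAs ((volume : Measure (EuclideanSpace ℝ (Fin n))).prod
    (volume : Measure (EuclideanSpace ℝ (Fin n)))).IsAddHaarMeasure

namespace HasPhaseTransport

variable {z₀ : EuclideanSpace ℝ (Fin n) × EuclideanSpace ℝ (Fin n)} {T T' : ℝ}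

theorem trans (h : F.HasPhaseTransport φ χ T (F.phase φ γ (Ici 0) t))
    (h' : F.HasPhaseTransport χ ψ T' (F.phase χ γ (Ici 0) (t + T)))
    (hγ : F.IsGeodesicOn γ (Ici 0)) (ht : 0 ≤ t) (hT : 0 ≤ T) (hγφ : γ t ∈ φ.source) :
    F.HasPhaseTransport φ ψ (T + T') (F.phase φ γ (Ici 0) t) := by
  obtain ⟨U, g, hU, hz, hg, hv, hflow⟩ := h
  obtain ⟨U', g', hU', hz', hg', hv', hflow'⟩ := h'
  refine ⟨U ∩ g ⁻¹' U', g' ∘ g, hg.isOpen_inter_preimage hU hU', ⟨hz, ?_⟩,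
    hg'.comp (hg.mono inter_subset_left) fun z hz => hz.2, fun A hA hAm => ?_,
    fun γ₁ hγ₁ r hr hr1 hr2 => ?_⟩
  · rw [mem_preimage, ← (hflow γ hγ t ht hγφ hz).2.1]
    exact hz'
  · obtain ⟨h1, h2⟩ := hv A (hA.trans inter_subset_left) hAm
    obtain ⟨h3, h4⟩ := hv' (g '' A) (by rintro _ ⟨z, hz, rfl⟩; exact (hA hz).2) h1
    rw [image_comp]
    exact ⟨h3, h4.trans h2⟩
  · obtain ⟨h1, h2, h3⟩ := hflow γ₁ hγ₁ r hr hr1 hr2.1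
    obtain ⟨h4, h5, h6⟩ := hflow' γ₁ hγ₁ (r + T) (add_nonneg hr hT) h1 (by rw [h2]; exact hr2.2)
    rw [← add_assoc]
    exact ⟨h4, by rw [h5, h2]; rfl, h6.trans h3⟩

theorem of_mem_source (hF : F.IsAbsolutelyHomogeneous)
    (hφ : φ ∈ atlas (EuclideanSpace ℝ (Fin n)) M) (hψ : ψ ∈ atlas (EuclideanSpace ℝ (Fin n)) M)
    (hγφ : γ t ∈ φ.source) (hγψ : γ t ∈ ψ.source) :
    F.HasPhaseTransport φ ψ 0 (F.phase φ γ (Ici 0) t) := by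
  have := isAddHaarMeasure_volume_prod (n := n)
  have hch := F.isLagrangianChange hφ hψ
  have hiff : ∀ γ : ℝ → M, ∀ r, γ r ∈ φ.source →
      (F.phase φ γ (Ici 0) r ∈ (φ.symm ≫ₕ ψ).source ×ˢ
        (univ : Set (EuclideanSpace ℝ (Fin n))) ↔ γ r ∈ ψ.source) := fun γ r hr => by
    rw [mem_prod, phase_fst, OpenPartialHomeomorph.trans_source, mem_inter_iff, mem_preimage,
      φ.left_inv hr]
    exact ⟨fun h => h.1.2, fun h => ⟨⟨φ.map_source hr, h⟩, mem_univ _⟩⟩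
  refine ⟨(φ.symm ≫ₕ ψ).source ×ˢ univ, cotangentLift (φ.symm ≫ₕ ψ),
    (φ.symm ≫ₕ ψ).open_source.prod isOpen_univ, (hiff γ t hγφ).2 hγψ,
    hch.contDiffOn_cotangentLift.continuousOn,
    fun A hA hAm => hch.measure_image_cotangentLift volume hA hAm, fun γ₁ h₁ r hr hr1 hr2 => ?_⟩
  have hr3 := (hiff γ₁ r hr1).1 hr2
  rw [add_zero]
  exact ⟨hr3, h₁.phase_change hF hφ hψ (uniqueDiffOn_Ici 0) hr hr1 hr3,
    h₁.energy_change hF hφ hψ (uniqueDiffOn_Ici 0) hr hr1 hr3⟩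

/-- The Hamiltonian flow preserves volume by Liouville's theorem. Its orbits project to geodesics,
and uniqueness identifies them with any given geodesic having the same state, which therefore stays
in the chart for time ε. The same ε serves all nearby states. -/
theorem exists_of_small_time [T2Space M] (hF : F.IsAbsolutelyHomogeneous)
    (hφ : φ ∈ atlas (EuclideanSpace ℝ (Fin n)) M)
    (hz₀ : z₀ ∈ (F.isLagrangian hF hφ).legendreHomeo.target) :
    ∃ ε > 0, ∀ᶠ z in 𝓝 z₀, ∀ T ∈ Icc 0 ε, F.HasPhaseTransport φ φ T z := by
  have := isAddHaarMeasure_volume_prod (n := n)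
  have hL := F.isLagrangian hF hφ
  obtain ⟨U, hU, hzU, hUΩ, ε, hε, α, hα, hvol⟩ := exists_volume_preserving_local_flow
    (volume : Measure (EuclideanSpace ℝ (Fin n) × EuclideanSpace ℝ (Fin n)))
    hL.legendreHomeo.open_target hL.contDiffOn_hamiltonField
    (fun z hz => hL.trace_fderiv_hamiltonField hz) hz₀
  refine ⟨ε, hε, ?_⟩
  filter_upwards [hU.mem_nhds hzU] with z hz T hT
  refine ⟨U, (α · T), hU, hz, (hvol T hT).1, (hvol T hT).2, fun γ hγ t ht hγφ hw => ?_⟩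
  set w := F.phase φ γ (Ici 0) t with hwdef
  obtain ⟨hα0, hα1⟩ := hα w hw
  set J := Icc t (t + ε) with hJ
  have hJu : UniqueDiffOn ℝ J := uniqueDiffOn_Icc (by linarith)
  have hJs : J ⊆ Ici 0 := fun r hr => ht.trans hr.1
  have htJ : t ∈ J := ⟨le_rfl, by linarith⟩
  have hTJ : t + T ∈ J := ⟨by linarith [hT.1], by linarith [hT.2]⟩
  set z := fun r => α w (r - t) with hzdef
  have hshift : ∀ r ∈ J, r - t ∈ Icc 0 ε := fun r hr => ⟨by linarith [hr.1], by linarith [hr.2]⟩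
  have hzm : ∀ r ∈ J, z r ∈ hL.legendreHomeo.target := fun r hr => (hα1 _ (hshift r hr)).2
  have hzd : ∀ r ∈ J, HasDerivWithinAt z (hL.hamiltonField (z r)) J r := fun r hr => by
    have h1 : HasDerivWithinAt (fun r : ℝ => r - t) 1 J r :=
      ((hasDerivAt_id r).sub_const t).hasDerivWithinAt
    have h2 := (hα1 _ (hshift r hr)).1.scomp r h1 hshift
    rwa [one_smul] at h2
  have hz := fun r hr => hL.eulerLagrangeAt_of_hasDerivWithinAt hJu hzm hzd (t := r) hr
  set γ₁ := φ.symm ∘ fun r => (z r).1 with hγ₁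
  have hgeo : F.IsGeodesicOn γ₁ J :=
    isGeodesicOn_of_eulerLagrangeAt hF hφ hJu fun r hr => ⟨(hz r hr).1, (hz r hr).2.1⟩
  have hsrc : ∀ r ∈ J, γ₁ r ∈ φ.source := fun r hr => φ.map_target (hz r hr).1
  have hph : ∀ r ∈ J, F.phase φ γ₁ J r = z r := fun r hr => by
    rw [← (hz r hr).2.2, phase, phaseCurve, phaseCurve]
    have h1 : EqOn (φ ∘ γ₁) (fun r => (z r).1) J := fun r hr => φ.right_inv (hz r hr).1
    rw [derivWithin_congr h1 (h1 hr), h1 hr]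
  have heq : EqOn γ γ₁ J := by
    refine (hγ.mono hJs hJu).eqOn_of_phase_eq hgeo hF hφ ordConnected_Icc htJ hγφ (hsrc t htJ) ?_
    rw [hph t htJ, hγ.phase_mono hφ hJs hJu htJ hγφ, hzdef]
    simp only [sub_self, hα0, ← hwdef]
  have hsrcγ : ∀ r ∈ J, γ r ∈ φ.source := fun r hr => by rw [heq hr]; exact hsrc r hr
  have hphγ : ∀ r ∈ J, F.phase φ γ (Ici 0) r = z r := fun r hr => by
    rw [← hγ.phase_mono hφ hJs hJu hr (hsrcγ r hr), phase_congr heq hr, hph r hr]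
  refine ⟨hsrcγ _ hTJ, ?_, ?_⟩
  · rw [hphγ _ hTJ, hzdef]
    simp only [add_sub_cancel_left]
  · rw [← hγ.hamiltonian_phase hF hφ (hJs hTJ) (hsrcγ _ hTJ),
      ← hγ.hamiltonian_phase hF hφ ht hγφ, hphγ _ hTJ, hphγ _ htJ]
    -- Conservation of energy: dH vanishes on the Hamiltonian field.
    have hH : ∀ r ∈ J, HasDerivWithinAt (fun r => hL.hamiltonian (z r)) 0 J r := fun r hr => by
      have h1 : HasFDerivAt hL.hamiltonian (fderiv ℝ hL.hamiltonian (z r)) (z r) :=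
        ((hL.contDiffOn_hamiltonian.contDiffAt (hL.legendreHomeo.open_target.mem_nhds
          (hzm r hr))).differentiableAt (by simp)).hasFDerivAt
      have h2 := h1.comp_hasDerivWithinAt r (hzd r hr)
      rwa [hL.fderiv_hamiltonian_hamiltonField (hzm r hr)] at h2
    exact constant_of_derivWithin_zero (fun r hr => (hH r hr).differentiableWithinAt)
      (fun r hr => (hH r (Ico_subset_Icc_self hr)).derivWithin (hJu r (Ico_subset_Icc_self hr)))
      _ hTJ

end HasPhaseTransport

/-- Along a geodesic, the geodesic flow is locally a volume preserving map of phase space. -/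
theorem IsGeodesicOn.hasPhaseTransport [T2Space M] (hγ : F.IsGeodesicOn γ (Ici 0))
    (hF : F.IsAbsolutelyHomogeneous) {T : ℝ} (hT : 0 ≤ T)
    (hφ : φ ∈ atlas (EuclideanSpace ℝ (Fin n)) M) (hψ : ψ ∈ atlas (EuclideanSpace ℝ (Fin n)) M)
    (hγφ : γ 0 ∈ φ.source) (hγψ : γ T ∈ ψ.source) :
    F.HasPhaseTransport φ ψ T (F.phase φ γ (Ici 0) 0) := by
  have hu : UniqueDiffOn ℝ (Ici (0 : ℝ)) := uniqueDiffOn_Ici 0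
  -- Around each time t a single chart χ carries the flow between nearby times a ≤ b; arbitrary
  -- charts at the ends are reached by transports of duration zero.
  have hloc : ∀ t : Icc 0 T, ∃ V : Set (Icc 0 T), IsOpen V ∧ t ∈ V ∧ ∀ a ∈ V, ∀ b ∈ V,
      (a : ℝ) ≤ b → ∀ φ ∈ atlas (EuclideanSpace ℝ (Fin n)) M,
      ∀ ψ ∈ atlas (EuclideanSpace ℝ (Fin n)) M, γ a ∈ φ.source → γ b ∈ ψ.source →
      F.HasPhaseTransport φ ψ (b - a) (F.phase φ γ (Ici 0) a) := by
    intro t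
    set χ := chartAt (EuclideanSpace ℝ (Fin n)) (γ t)
    have hχ := chart_mem_atlas (EuclideanSpace ℝ (Fin n)) (γ t)
    have hsrc : γ t ∈ χ.source := mem_chart_source _ _
    have ht0 : (t : ℝ) ∈ Ici (0 : ℝ) := t.2.1
    obtain ⟨ε, hε, hev⟩ := HasPhaseTransport.exists_of_small_time hF hχ
      (hγ.phase_mem hF hχ ht0 hsrc)
    have hcont := (hγ.hasDerivWithinAt_phase hF hχ ht0 hsrc).continuousWithinAt
    have hev1 : ∀ᶠ r in 𝓝[Ici 0] (t : ℝ), γ r ∈ χ.source ∧ |r - t| < ε / 2 ∧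
        ∀ T ∈ Icc 0 ε, F.HasPhaseTransport χ χ T (F.phase χ γ (Ici 0) r) := by
      filter_upwards [hγ.eventually_mem_source ht0 hsrc, hcont.eventually hev,
        mem_nhdsWithin_of_mem_nhds (ball_mem_nhds (t : ℝ) (half_pos hε))] with r h1 h2 h3
        using ⟨h1.2, h3, h2⟩
    have hev2 : ∀ᶠ r : Icc 0 T in 𝓝 t, γ r ∈ χ.source ∧ |(r : ℝ) - t| < ε / 2 ∧
        ∀ T ∈ Icc 0 ε, F.HasPhaseTransport χ χ T (F.phase χ γ (Ici 0) r) := by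
      refine Tendsto.eventually ?_ hev1
      refine tendsto_nhdsWithin_iff.2 ⟨continuous_subtype_val.tendsto t, ?_⟩
      exact Eventually.of_forall fun r => r.2.1
    obtain ⟨V, hV, hVo, htV⟩ := _root_.eventually_nhds_iff.1 hev2
    refine ⟨V, hVo, htV, fun a ha b hb hab φ hφ ψ hψ haφ hbψ => ?_⟩
    obtain ⟨ha1, ha2, ha3⟩ := hV a ha
    obtain ⟨hb1, hb2, -⟩ := hV b hb
    have hab' : (b : ℝ) - a ∈ Icc 0 ε := by
      rw [abs_lt] at ha2 hb2
      exact ⟨by linarith, by linarith⟩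
    have e1 : F.HasPhaseTransport φ χ 0 (F.phase φ γ (Ici 0) a) :=
      HasPhaseTransport.of_mem_source hF hφ hχ haφ ha1
    have e2 := e1.trans (ψ := χ) (by rw [add_zero]; exact ha3 _ hab') hγ a.2.1 le_rfl haφ
    have e3 := e2.trans (ψ := ψ) (T' := 0) (by
      rw [zero_add, add_sub_cancel]
      exact HasPhaseTransport.of_mem_source hF hχ hψ hb1 hbψ) hγ a.2.1
        (by rw [zero_add]; exact hab'.1) haφ
    simpa using e3
  choose V hVo htV hV using hloc
  -- By compactness [0, T] is cut into finitely many intervals, each contained in one of these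
  -- neighbourhoods; the transports are composed by induction.
  obtain ⟨τ, hτ0, hτm, ⟨m, hm⟩, hτ⟩ := exists_monotone_Icc_subset_open_cover_Icc hT hVo
    (fun t _ => mem_iUnion.2 ⟨t, htV t⟩)
  have hind : ∀ k, ∀ ψ ∈ atlas (EuclideanSpace ℝ (Fin n)) M, γ (τ k) ∈ ψ.source →
      F.HasPhaseTransport φ ψ (τ k) (F.phase φ γ (Ici 0) 0) := by
    intro k
    induction k with
    | zero =>
      intro ψ hψ hk
      rw [hτ0] at hk ⊢
      exact HasPhaseTransport.of_mem_source hF hφ hψ hγφ hk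
    | succ k ih =>
      intro ψ hψ hk
      obtain ⟨i, hi⟩ := hτ k
      have hle : τ k ≤ τ (k + 1) := hτm k.le_succ
      set χ := chartAt (EuclideanSpace ℝ (Fin n)) (γ (τ k))
      have hχ := chart_mem_atlas (EuclideanSpace ℝ (Fin n)) (γ (τ k))
      have hsrc : γ (τ k) ∈ χ.source := mem_chart_source _ _
      have h1 := hV i (τ k) (hi ⟨le_rfl, hle⟩) (τ (k + 1)) (hi ⟨hle, le_rfl⟩) hle χ hχ ψ hψ hsrc hk
      have h2 := (ih χ hχ hsrc).trans (ψ := ψ) (by rw [zero_add]; exact h1) hγ le_rfl (τ k).2.1 hγφ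
      rwa [add_sub_cancel] at h2
  have h1 := hind m ψ hψ (by rw [hm m le_rfl]; exact hγψ)
  rwa [hm m le_rfl] at h1

end FinslerMetric

/-! ### Measure-theoretic tools. -/

/-- An injective map which locally preserves the measure preserves the measure. -/
theorem measurableSet_image_and_measure_eq_of_local {Z Z' : Type*} [TopologicalSpace Z]
    [SecondCountableTopology Z] [MeasurableSpace Z] [OpensMeasurableSpace Z] [MeasurableSpace Z']
    {ν : Measure Z} {ν' : Measure Z'} {G : Z → Z'} {A : Set Z} (hA : MeasurableSet A)
    (hG : InjOn G A) (hloc : ∀ w ∈ A, ∃ U, IsOpen U ∧ w ∈ U ∧ ∀ B ⊆ U ∩ A, MeasurableSet B →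
      MeasurableSet (G '' B) ∧ ν' (G '' B) = ν B) :
    MeasurableSet (G '' A) ∧ ν' (G '' A) = ν A := by
  rcases A.eq_empty_or_nonempty with rfl | ⟨a, ha⟩
  · simp
  choose! U hUo hUm hU using hloc
  obtain ⟨t, htA, htc, ht⟩ := TopologicalSpace.countable_cover_nhdsWithin
    (fun w hw => mem_nhdsWithin_of_mem_nhds ((hUo w hw).mem_nhds (hUm w hw)) :
      ∀ w ∈ A, U w ∈ 𝓝[A] w)
  have htne : t.Nonempty := by
    obtain ⟨w, hw, -⟩ := mem_iUnion₂.1 (ht ha)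
    exact ⟨w, hw⟩
  obtain ⟨e, he⟩ := htc.exists_eq_range htne
  have heA : ∀ j, e j ∈ A := fun j => htA (he ▸ mem_range_self j)
  -- A countable subcover is made disjoint; injectivity keeps the images of the pieces disjoint, so
  -- countable additivity applies on both sides.
  set D := disjointed fun j => U (e j) with hD
  have hDm : ∀ j, MeasurableSet (D j) := fun j =>
    MeasurableSet.disjointed (fun j => (hUo _ (heA j)).measurableSet) j
  have hDU : ∀ j, D j ⊆ U (e j) := fun j => disjointed_subset _ j
  have hcov : A ⊆ ⋃ j, D j := by
    rw [hD, iUnion_disjointed]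
    refine ht.trans ?_
    rw [he]
    exact (biUnion_range (f := e) (g := U)).subset
  have hAD : A = ⋃ j, A ∩ D j := by
    rw [← inter_iUnion]
    exact (inter_eq_left.2 hcov).symm
  have hdisj : Pairwise (Disjoint on fun j => A ∩ D j) := fun i j hij =>
    (disjoint_disjointed (fun j => U (e j)) hij).mono inter_subset_right inter_subset_right
  have hloc : ∀ j, MeasurableSet (G '' (A ∩ D j)) ∧ ν' (G '' (A ∩ D j)) = ν (A ∩ D j) := fun j =>
    hU _ (heA j) _ (fun w hw => ⟨hDU j hw.2, hw.1⟩) (hA.inter (hDm j))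
  have himg : G '' A = ⋃ j, G '' (A ∩ D j) := by
    conv_lhs => rw [hAD]
    exact image_iUnion
  have hdisj' : Pairwise (Disjoint on fun j => G '' (A ∩ D j)) := fun i j hij => by
    rw [Function.onFun, Set.disjoint_left]
    rintro _ ⟨w, hw, rfl⟩ ⟨w', hw', heq⟩
    exact Set.disjoint_left.1 (hdisj hij) hw (hG hw'.1 hw.1 heq ▸ hw')
  rw [himg]
  refine ⟨MeasurableSet.iUnion fun j => (hloc j).1, ?_⟩
  rw [measure_iUnion hdisj' fun j => (hloc j).1]
  conv_rhs => rw [hAD]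
  rw [measure_iUnion hdisj fun j => hA.inter (hDm j)]
  exact tsum_congr fun j => (hloc j).2

theorem ContinuousOn.measurableSet_inter_preimage {Z M : Type*} [TopologicalSpace Z]
    [MeasurableSpace Z] [BorelSpace Z] [TopologicalSpace M] [MeasurableSpace M] [BorelSpace M]
    {g : Z → M} {W : Set Z} (hg : ContinuousOn g W) (hW : MeasurableSet W) {B : Set M}
    (hB : MeasurableSet B) : MeasurableSet (W ∩ g ⁻¹' B) := by
  have h1 := (continuousOn_iff_continuous_domRestrict.1 hg).measurable hB
  have h2 := (MeasurableEmbedding.subtype_coe hW).measurableSet_image.2 h1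
  convert! h2 using 1
  ext w
  simp [and_comm]

theorem OpenPartialHomeomorph.measurableSet_image {M E : Type*} [TopologicalSpace M]
    [MeasurableSpace M] [BorelSpace M] [TopologicalSpace E] [MeasurableSpace E] [BorelSpace E]
    (ψ : OpenPartialHomeomorph M E) {B : Set M} (hB : MeasurableSet B) (hs : B ⊆ ψ.source) :
    MeasurableSet (ψ '' B) := by
  have h1 := ψ.continuousOn_symm.measurableSet_inter_preimage ψ.open_target.measurableSet hB
  rwa [← ψ.image_eq_target_inter_inv_preimage hs] at h1

/-! ### A wandering set of initial states forces infinite volume. -/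

namespace FinslerMetric

variable {n : ℕ} {M : Type*} [TopologicalSpace M]
  [ChartedSpace (EuclideanSpace ℝ (Fin n)) M] [IsManifold (𝓡 n) ∞ M]
  {φ ψ : OpenPartialHomeomorph M (EuclideanSpace ℝ (Fin n))} {F : FinslerMetric n M}

/-- The momentum of a curve of speed at most one lies in the polar of the unit ball. -/
theorem IsGeodesicOn.inner_phase_le {γ : ℝ → M} {s : Set ℝ} {t : ℝ} (h : F.IsGeodesicOn γ s)
    (hF : F.IsAbsolutelyHomogeneous) (hψ : ψ ∈ atlas (EuclideanSpace ℝ (Fin n)) M) (ht : t ∈ s)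
    (hγ : γ t ∈ ψ.source) (hE : F.energy ψ γ s t ≤ 1 / 2) {v : EuclideanSpace ℝ (Fin n)}
    (hv : F.inChart ψ (ψ (γ t)) v ≤ 1) : ⟪(F.phase ψ γ s t).2, v⟫_ℝ ≤ 1 := by
  have h1 := (F.isLagrangian hF hψ).inner_momentum_le (ψ.map_source hγ) (h.2 ψ hψ t ht hγ).2.1 v
  have h2 : 0 ≤ F.inChart ψ (ψ (γ t)) v := by
    rcases eq_or_ne v 0 with rfl | hv0
    · exact (F.isMinkowskiNorm_inChart hF hψ (ψ.map_source hγ)).map_zero.ge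
    · exact (F.inChart_pos hψ (ψ.map_source hγ) hv0).le
  have h3 : F.lagrangian ψ (ψ (γ t)) v ≤ 1 / 2 := by
    rw [lagrangian]
    nlinarith
  exact h1.trans (by rw [energy] at hE; linarith)

variable [T2Space M] [SecondCountableTopology M] [MeasurableSpace M] [BorelSpace M]

/-- If the geodesics of a nonempty open set of initial data never return to the footpoints of this
set then the volume of the manifold is infinite. -/
theorem volumeMeasure_univ_eq_top_of_wandering (hF : F.IsAbsolutelyHomogeneous)
    {V : FinslerVolume n} {μ : Measure M} (hμ : V.IsVolumeMeasure F μ)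
    (hφ : φ ∈ atlas (EuclideanSpace ℝ (Fin n)) M)
    {W : Set (EuclideanSpace ℝ (Fin n) × EuclideanSpace ℝ (Fin n))} (hW : IsOpen W)
    (hWne : W.Nonempty)
    {Γ : EuclideanSpace ℝ (Fin n) × EuclideanSpace ℝ (Fin n) → ℝ → M}
    (hΓ : ∀ w ∈ W, F.IsGeodesicOn (Γ w) (Ici 0)) (hΓφ : ∀ w ∈ W, Γ w 0 ∈ φ.source)
    (hΓw : ∀ w ∈ W, F.phase φ (Γ w) (Ici 0) 0 = w)
    (hΓE : ∀ w ∈ W, F.energy φ (Γ w) (Ici 0) 0 ≤ 1 / 2)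
    (hwander : ∀ w ∈ W, ∀ w' ∈ W, ∀ m : ℕ, 0 < m → Γ w m ≠ Γ w' 0) : μ univ = ⊤ := by
  have h0 : (0 : ℝ) ∈ Ici (0 : ℝ) := mem_Ici.2 le_rfl
  have hk0 : ∀ k : ℕ, (k : ℝ) ∈ Ici (0 : ℝ) := fun k => mem_Ici.2 (Nat.cast_nonneg k)
  -- the local description of the flow
  have hflow : ∀ w ∈ W, ∀ k : ℕ, ∀ ψ ∈ atlas (EuclideanSpace ℝ (Fin n)) M, Γ w k ∈ ψ.source →
      ∃ U g, IsOpen U ∧ w ∈ U ∧ ContinuousOn g U ∧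
      (∀ A ⊆ U, MeasurableSet A → MeasurableSet (g '' A) ∧ volume (g '' A) = volume A) ∧
      ∀ w' ∈ U ∩ W, Γ w' k ∈ ψ.source ∧ F.phase ψ (Γ w') (Ici 0) k = g w' ∧
        F.energy ψ (Γ w') (Ici 0) k ≤ 1 / 2 := by
    intro w hw k ψ hψ hk
    obtain ⟨U, g, hU, hwU, hg, hv, h⟩ := (hΓ w hw).hasPhaseTransport hF (hk0 k) hφ hψ (hΓφ w hw) hk
    rw [hΓw w hw] at hwU
    refine ⟨U, g, hU, hwU, hg, hv, fun w' hw' => ?_⟩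
    have h1 := h (Γ w') (hΓ w' hw'.2) 0 le_rfl (hΓφ w' hw'.2) (by rw [hΓw w' hw'.2]; exact hw'.1)
    rw [zero_add, hΓw w' hw'.2] at h1
    exact ⟨h1.1, h1.2.1, h1.2.2.trans_le (hΓE w' hw'.2)⟩
  -- distinct initial data lead to distinct states, at all pairs of integer times
  have hinj : ∀ w ∈ W, ∀ w' ∈ W, ∀ j k : ℕ, j ≤ k → ∀ ψ ∈ atlas (EuclideanSpace ℝ (Fin n)) M,
      Γ w k ∈ ψ.source → Γ w' j ∈ ψ.source →
      F.phase ψ (Γ w) (Ici 0) k = F.phase ψ (Γ w') (Ici 0) j → j = k ∧ w = w' := by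
    intro w hw w' hw' j k hjk ψ hψ hk hj heq
    -- With k = j + m, translating Γ w by m gives a geodesic with the state of Γ w' at time j, so
    -- the two agree on [0, ∞). At time 0 this reads Γ w m = Γ w' 0, which wandering forbids unless
    -- m = 0.
    obtain ⟨m, rfl⟩ := Nat.exists_eq_add_of_le hjk
    have hm : Ici (m : ℝ) ⊆ Ici 0 := Ici_subset_Ici.2 (Nat.cast_nonneg m)
    have hs : ∀ r : ℝ, r + m ∈ Ici (m : ℝ) ↔ r ∈ Ici (0 : ℝ) := fun r => by simp
    have hjm : ((j : ℝ) + m) ∈ Ici (m : ℝ) := (hs j).2 (hk0 j)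
    rw [Nat.cast_add] at hk heq
    have hgm := (hΓ w hw).mono hm (uniqueDiffOn_Ici _)
    have h1 := (hgm.comp_add_const hs).eqOn_of_phase_eq (hΓ w' hw') hF hψ ordConnected_Ici
      (hk0 j) hk hj (by
        rw [hgm.phase_comp_add_const hψ hs (hk0 j) hk,
          (hΓ w hw).phase_mono hψ hm (uniqueDiffOn_Ici _) hjm hk, heq])
    have h2 : Γ w m = Γ w' 0 := by simpa using h1 h0
    rcases Nat.eq_zero_or_pos m with rfl | hmpos
    · refine ⟨rfl, ?_⟩
      have h3 : EqOn (Γ w) (Γ w') (Ici 0) := fun r hr => by simpa using h1 hr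
      rw [← hΓw w hw, ← hΓw w' hw', phase_congr h3 h0]
    · exact absurd h2 (hwander w hw w' hw' m hmpos)
  -- continuity of the geodesics in the initial data
  have hcont : ∀ k : ℕ, ContinuousOn (fun w => Γ w k) W := by
    intro k w hw
    set χ := chartAt (EuclideanSpace ℝ (Fin n)) (Γ w k)
    obtain ⟨U, g, hU, hwU, hg, -, h⟩ := hflow w hw k χ (chart_mem_atlas _ _) (mem_chart_source _ _)
    have h1 : ∀ w' ∈ U ∩ W, Γ w' k = χ.symm (g w').1 := fun w' hw' => by
      rw [← (h w' hw').2.1, phase_fst, χ.left_inv (h w' hw').1]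
    have h2 : ContinuousWithinAt (fun w' => χ.symm (g w').1) W w := by
      refine ContinuousAt.comp_continuousWithinAt (f := fun w' => (g w').1) ?_
        (continuous_fst.continuousAt.comp_continuousWithinAt
          (hg.continuousAt (hU.mem_nhds hwU)).continuousWithinAt)
      rw [← (h w ⟨hwU, hw⟩).2.1, phase_fst]
      exact χ.continuousAt_symm (χ.map_source (mem_chart_source _ _))
    refine h2.congr_of_eventuallyEq ?_ (h1 w ⟨hwU, hw⟩)
    filter_upwards [self_mem_nhdsWithin, mem_nhdsWithin_of_mem_nhds (hU.mem_nhds hwU)]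
      with w' a b using h1 w' ⟨b, a⟩
  -- a countable partition into pieces of charts
  obtain ⟨w₀, hw₀⟩ := hWne
  obtain ⟨T, hTc, hT⟩ := TopologicalSpace.countable_cover_nhds
    (fun x : M => chart_source_mem_nhds (EuclideanSpace ℝ (Fin n)) x)
  have hTne : T.Nonempty := by
    obtain ⟨x, hx, -⟩ := mem_iUnion₂.1 (hT.symm ▸ mem_univ (Γ w₀ 0))
    exact ⟨x, hx⟩
  obtain ⟨e, he⟩ := hTc.exists_eq_range hTne
  set ψ : ℕ → OpenPartialHomeomorph M (EuclideanSpace ℝ (Fin n)) := fun i =>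
    chartAt (EuclideanSpace ℝ (Fin n)) (e i) with hψdef
  have hψ : ∀ i, ψ i ∈ atlas (EuclideanSpace ℝ (Fin n)) M := fun i => chart_mem_atlas _ _
  set B : ℕ → Set M := disjointed fun i => (ψ i).source with hBdef
  have hBm : ∀ i, MeasurableSet (B i) := fun i =>
    MeasurableSet.disjointed (fun j => (ψ j).open_source.measurableSet) i
  have hBs : ∀ i, B i ⊆ (ψ i).source := fun i => disjointed_subset _ i
  have hBd : Pairwise (Disjoint on B) := disjoint_disjointed _
  have hBu : ⋃ i, B i = univ := by
    rw [hBdef, iUnion_disjointed, ← hT, he, biUnion_range]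
  -- S i k consists of the initial states whose geodesic lies over the piece B i at time k, and G i
  -- k records its state there in the chart of that piece.
  set S : ℕ → ℕ → Set (EuclideanSpace ℝ (Fin n) × EuclideanSpace ℝ (Fin n)) :=
    fun i k => W ∩ (fun w => Γ w k) ⁻¹' B i with hS
  have hSm : ∀ i k, MeasurableSet (S i k) := fun i k =>
    (hcont k).measurableSet_inter_preimage hW.measurableSet (hBm i)
  set G : ℕ → ℕ → EuclideanSpace ℝ (Fin n) × EuclideanSpace ℝ (Fin n) →
      EuclideanSpace ℝ (Fin n) × EuclideanSpace ℝ (Fin n) :=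
    fun i k w => F.phase (ψ i) (Γ w) (Ici 0) k with hG
  have hGS : ∀ i k, MeasurableSet (G i k '' S i k) ∧ volume (G i k '' S i k) = volume (S i k) := by
    intro i k
    refine measurableSet_image_and_measure_eq_of_local (hSm i k) (fun w hw w' hw' heq =>
      (hinj w hw.1 w' hw'.1 k k le_rfl (ψ i) (hψ i) (hBs i hw.2) (hBs i hw'.2) heq).2)
      fun w hw => ?_
    obtain ⟨U, g, hU, hwU, -, hv, h⟩ := hflow w hw.1 k (ψ i) (hψ i) (hBs i hw.2)
    refine ⟨U, hU, hwU, fun A hA hAm => ?_⟩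
    have h1 : G i k '' A = g '' A :=
      image_congr fun w' hw' => (h w' ⟨(hA hw').1, (hA hw').2.1⟩).2.1
    rw [h1]
    exact hv A (fun w' hw' => (hA hw').1) hAm
  have hGd : ∀ i, Pairwise (Disjoint on fun k => G i k '' S i k) := by
    intro i
    have : ∀ j k, j < k → Disjoint (G i j '' S i j) (G i k '' S i k) := by
      intro j k hjk
      rw [Set.disjoint_left]
      rintro _ ⟨w', hw', rfl⟩ ⟨w, hw, heq⟩
      exact hjk.ne (hinj w hw.1 w' hw'.1 j k hjk.le (ψ i) (hψ i) (hBs i hw.2) (hBs i hw'.2) heq).1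
    intro j k hjk
    rcases hjk.lt_or_gt with h | h
    · exact this j k h
    · exact (this k j h).symm
  -- the volume of the part of the phase space over a piece
  obtain ⟨C, hC, hpolar⟩ := V.exists_volume_polar_le
  -- The images at different times k are disjoint and lie over B i in the bundle of polars. Fubini
  -- integrates the fibre bound C σ over B i, which gives C μ(B i).
  have hpiece : ∀ i, ∑' k, volume (S i k) ≤ C * μ (B i) := by
    intro i
    set Y := ⋃ k, G i k '' S i k with hY
    have hYm : MeasurableSet Y := MeasurableSet.iUnion fun k => (hGS i k).1
    have hYvol : volume Y = ∑' k, volume (S i k) := by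
      rw [hY, measure_iUnion (hGd i) fun k => (hGS i k).1]
      exact tsum_congr fun k => (hGS i k).2
    have hYsub : ∀ z ∈ Y, z.1 ∈ ψ i '' B i ∧
        z.2 ∈ {p | ∀ v, F.inChart (ψ i) z.1 v ≤ 1 → ⟪p, v⟫_ℝ ≤ 1} := by
      intro z hz
      obtain ⟨k, w, hw, rfl⟩ := mem_iUnion.1 hz
      refine ⟨⟨Γ w k, hw.2, rfl⟩, fun v hv => ?_⟩
      obtain ⟨U, g, -, hwU, -, -, h⟩ := hflow w hw.1 k (ψ i) (hψ i) (hBs i hw.2)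
      exact (hΓ w hw.1).inner_phase_le hF (hψ i) (hk0 k) (hBs i hw.2) (h w ⟨hwU, hw.1⟩).2.2 hv
    have hBim : MeasurableSet (ψ i '' B i) := (ψ i).measurableSet_image (hBm i) (hBs i)
    rw [← hYvol, hμ (ψ i) (hψ i) (B i) (hBm i) (hBs i), Measure.volume_eq_prod,
      Measure.prod_apply hYm, ← lintegral_const_mul' _ _ hC, ← lintegral_indicator hBim]
    refine lintegral_mono fun x => ?_
    by_cases hx : x ∈ ψ i '' B i
    · rw [indicator_of_mem hx]
      obtain ⟨q, hq, rfl⟩ := hx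
      refine (measure_mono fun p hp => ?_).trans (hpolar _ (F.isMinkowskiNorm_inChart hF (hψ i)
        ((ψ i).map_source (hBs i hq))))
      exact (hYsub _ hp).2
    · have h1 : Prod.mk x ⁻¹' Y = ∅ := by
        ext p
        simp only [mem_preimage, mem_empty_iff_false, iff_false]
        exact fun hp => hx (hYsub _ hp).1
      rw [h1, measure_empty]
      exact zero_le
  -- For fixed k the sets S i k partition W, so after exchanging the sums a fixed positive volume is
  -- added infinitely often.
  have hsum : ∑' i, ∑' k, volume (S i k) = ⊤ := by
    rw [ENNReal.tsum_comm]
    have h1 : ∀ k, ∑' i, volume (S i k) = volume W := fun k => by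
      rw [← measure_iUnion (fun i j hij => ?_) fun i => hSm i k]
      · rw [hS]
        simp only
        rw [← inter_iUnion, ← preimage_iUnion, hBu, preimage_univ, inter_univ]
      · exact ((hBd hij).preimage _).mono inter_subset_right inter_subset_right
    simp only [h1]
    have := isAddHaarMeasure_volume_prod (n := n)
    exact ENNReal.tsum_const_eq_top_of_ne_zero (hW.measure_pos volume ⟨w₀, hw₀⟩).ne'
  have htot : (⊤ : ℝ≥0∞) ≤ C * μ univ := by
    rw [← hsum, ← hBu, measure_iUnion hBd hBm, ← ENNReal.tsum_mul_left]
    exact ENNReal.tsum_le_tsum hpiece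
  by_contra hne
  exact (ENNReal.mul_lt_top hC.lt_top (lt_top_iff_ne_top.2 hne)).not_ge htot

end FinslerMetric

/-! ### Convex functions on complete manifolds of finite volume. -/

namespace FinslerMetric

variable {n : ℕ} {M : Type*} [TopologicalSpace M]
  [ChartedSpace (EuclideanSpace ℝ (Fin n)) M] [IsManifold (𝓡 n) ∞ M]
  {φ : OpenPartialHomeomorph M (EuclideanSpace ℝ (Fin n))} {F : FinslerMetric n M}
  {f : M → ℝ}

/-- The exponential map of a chart, with a function that is convex on the manifold. -/
theorem IsConvex.exists_exponential (hf : F.IsConvex f) (hF : F.IsAbsolutelyHomogeneous)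
    (hφ : φ ∈ atlas (EuclideanSpace ℝ (Fin n)) M) {x₀ : EuclideanSpace ℝ (Fin n)}
    (hx₀ : x₀ ∈ φ.target) :
    ∃ X : EuclideanSpace ℝ (Fin n) × EuclideanSpace ℝ (Fin n) → EuclideanSpace ℝ (Fin n),
      HasStrictFDerivAt X (ContinuousLinearMap.fst ℝ _ _ + ContinuousLinearMap.snd ℝ _ _)
        (x₀, 0) ∧
      ∀ᶠ z in 𝓝 (x₀, (0 : EuclideanSpace ℝ (Fin n))), ContinuousAt X z ∧ z.1 ∈ φ.target ∧
        X z ∈ φ.target ∧ X (z.1, 0) = z.1 ∧ HasDerivAt (fun t : ℝ => X (z.1, t • z.2)) z.2 0 ∧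
        (z.2 ≠ 0 → F.IsGeodesicOn (φ.symm ∘ fun t : ℝ => X (z.1, t • z.2)) (Icc (-2) 2)) ∧
        ConvexOn ℝ (Icc (-2 : ℝ) 2) (fun t => (f ∘ φ.symm) (X (z.1, t • z.2))) := by
  obtain ⟨X, hX, hev⟩ := (F.isLagrangian hF hφ).exists_exponential hx₀
  refine ⟨X, hX, ?_⟩
  filter_upwards [hev] with z hz
  obtain ⟨h1, h2, h3, h4, h5⟩ := hz
  -- A constant curve is not a geodesic, so convexity at zero velocity is checked separately: the
  -- function is constant in t.
  by_cases hz2 : z.2 = 0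
  · have hzz : z = (z.1, 0) := Prod.ext rfl hz2
    refine ⟨h1, h2, by rw [hzz, h3]; exact h2, h3, h4, fun h => absurd hz2 h, ?_⟩
    simp only [hz2, smul_zero]
    exact convexOn_const _ (convex_Icc _ _)
  · have h6 := h5 hz2
    have hgeo := isGeodesicOn_of_eulerLagrangeAt hF hφ (uniqueDiffOn_Icc (by norm_num)) h6
    have h7 := (h6 1 ⟨by norm_num, by norm_num⟩).1
    rw [one_smul] at h7
    exact ⟨h1, h2, h7, h3, h4, fun _ => hgeo, hf _ _ _ (by norm_num) hgeo⟩

/-- Convex functions on a Finsler manifold are continuous. -/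
theorem IsConvex.continuous (hf : F.IsConvex f) (hF : F.IsAbsolutelyHomogeneous) :
    Continuous f := by
  rw [continuous_iff_continuousAt]
  intro q
  set φ := chartAt (EuclideanSpace ℝ (Fin n)) q
  have hφ := chart_mem_atlas (EuclideanSpace ℝ (Fin n)) q
  have hq : q ∈ φ.source := mem_chart_source _ _
  obtain ⟨X, hX, hev⟩ := hf.exists_exponential hF hφ (φ.map_source hq)
  have h1 : ContinuousAt (f ∘ φ.symm) (φ q) :=
    continuousAt_of_geodesic_convex hX (hev.mono fun z hz => ⟨hz.2.2.2.1, hz.2.2.2.2.2.2⟩)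
  refine (h1.comp (φ.continuousAt hq)).congr ?_
  filter_upwards [φ.open_source.mem_nhds hq] with p hp
  simp [φ.left_inv hp]

/-- A geodesic of short duration in a chart extends to a complete one with the same initial
state. -/
theorem IsComplete.exists_extension (hcomplete : F.IsComplete)
    {c : ℝ → EuclideanSpace ℝ (Fin n)}
    {v : EuclideanSpace ℝ (Fin n)} (hc : F.IsGeodesicOn (φ.symm ∘ c) (Icc (-2) 2))
    (hd : HasDerivAt c v 0) (hc0 : c 0 ∈ φ.target) :
    ∃ γ : ℝ → M, F.IsGeodesicOn γ (Ici 0) ∧ EqOn γ (φ.symm ∘ c) (Ico 0 2) ∧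
      γ 0 ∈ φ.source ∧ φ (γ 0) = c 0 ∧ derivWithin (φ ∘ γ) (Ici 0) 0 = v := by
  have hu : UniqueDiffOn ℝ (Ico (0 : ℝ) 2) := uniqueDiffOn_Ico 0 2
  have hsub : Ico (0 : ℝ) 2 ⊆ Icc (-2) 2 := fun t ht => ⟨by linarith [ht.1], ht.2.le⟩
  obtain ⟨γ, hγ, heq⟩ := hcomplete _ 0 2 two_pos (hc.mono hsub hu)
  have h0 : (0 : ℝ) ∈ Ico (0 : ℝ) 2 := ⟨le_rfl, two_pos⟩
  have h00 : γ 0 = φ.symm (c 0) := heq h0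
  have hsrc : γ 0 ∈ φ.source := h00 ▸ φ.map_target hc0
  refine ⟨γ, hγ, heq, hsrc, by rw [h00, φ.right_inv hc0], ?_⟩
  have hev : (φ ∘ γ) =ᶠ[𝓝[≥] 0] c := by
    have h1 : ∀ᶠ t in 𝓝[≥] (0 : ℝ), t ∈ Ico (0 : ℝ) 2 := Ico_mem_nhdsGE two_pos
    have h2 : ∀ᶠ t in 𝓝[≥] (0 : ℝ), c t ∈ φ.target :=
      hd.continuousAt.continuousWithinAt.preimage_mem_nhdsWithin (φ.open_target.mem_nhds hc0)
    filter_upwards [h1, h2] with t ht ht'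
    rw [Function.comp_apply, heq ht, Function.comp_apply, φ.right_inv ht']
  rw [hev.derivWithin_of_subset.self_of_nhdsWithin (mem_Ici.2 le_rfl)]
  exact hd.hasDerivWithinAt.derivWithin (uniqueDiffOn_Ici 0 0 (mem_Ici.2 le_rfl))

/-- A convex function increases at least linearly along a geodesic on which it increases. -/
theorem IsConvex.le_apply_nat (hf : F.IsConvex f) {γ : ℝ → M} (hγ : F.IsGeodesicOn γ (Ici 0))
    {δ : ℝ} (hδ : 0 ≤ δ) (h : f (γ 0) + δ ≤ f (γ 1)) {m : ℕ} (hm : 0 < m) :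
    f (γ 0) + δ ≤ f (γ m) := by
  have hm' : (1 : ℝ) ≤ m := by exact_mod_cast hm
  have hm0 : (0 : ℝ) < m := by linarith
  have hconv := hf γ 0 m hm0 (hγ.mono (fun t ht => mem_Ici.2 ht.1) (uniqueDiffOn_Icc hm0))
  have h1 := hconv.2 (show (0 : ℝ) ∈ Icc (0 : ℝ) m from ⟨le_rfl, hm0.le⟩)
    (show (m : ℝ) ∈ Icc (0 : ℝ) m from ⟨hm0.le, le_rfl⟩)
    (sub_nonneg.2 (inv_le_one_of_one_le₀ hm')) (inv_nonneg.2 hm0.le) (by ring)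
  have h2 : (1 - (m : ℝ)⁻¹) • (0 : ℝ) + (m : ℝ)⁻¹ • (m : ℝ) = 1 := by
    simp [inv_mul_cancel₀ hm0.ne']
  rw [h2] at h1
  simp only [Function.comp_apply, smul_eq_mul] at h1
  have h3 : (m : ℝ) * f (γ 1) ≤ (m - 1) * f (γ 0) + f (γ m) := by
    have := mul_le_mul_of_nonneg_left h1 hm0.le
    refine this.trans (le_of_eq ?_)
    field_simp
  nlinarith

variable [T2Space M] [SecondCountableTopology M] [MeasurableSpace M] [BorelSpace M]

/-- A convex function on a complete manifold of finite volume is locally constant. -/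
theorem IsConvex.eventually_eq (hf : F.IsConvex f) (hF : F.IsAbsolutelyHomogeneous)
    (hcomplete : F.IsComplete) {V : FinslerVolume n} {μ : Measure M}
    (hμ : V.IsVolumeMeasure F μ) (hfin : μ univ < ⊤) (q : M) : ∀ᶠ x in 𝓝 q, f x = f q := by
  by_contra hcon
  set φ := chartAt (EuclideanSpace ℝ (Fin n)) q
  have hφ : φ ∈ atlas (EuclideanSpace ℝ (Fin n)) M := chart_mem_atlas _ q
  have hq : q ∈ φ.source := mem_chart_source _ _
  have hL := F.isLagrangian hF hφ
  set x₀ := φ q with hx₀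
  have hx₀t : x₀ ∈ φ.target := φ.map_source hq
  obtain ⟨X, hX, hev⟩ := hf.exists_exponential hF hφ hx₀t
  set h := f ∘ φ.symm with hh
  have hfc := hf.continuous hF
  have hhx : h x₀ = f q := by rw [hh, Function.comp_apply, hx₀, φ.left_inv hq]
  have hX00 : X (x₀, 0) = x₀ := hev.self_of_nhds.2.2.2.1
  -- a small vector along which `f` varies
  have hfreq : ∃ᶠ v in 𝓝 (0 : EuclideanSpace ℝ (Fin n)), h (X (x₀, v)) ≠ h x₀ := by
    intro hno
    have h1 := eventually_eq_of_exponential hX (hev.mono fun z hz => hz.2.2.2.1)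
      (hno.mono fun v hv => not_not.1 hv)
    refine hcon ?_
    filter_upwards [φ.open_source.mem_nhds hq, (φ.continuousAt hq).eventually h1] with p hp hp'
    rw [← hhx, ← hp', hh, Function.comp_apply, φ.left_inv hp]
  have hc0 : Tendsto (fun v : EuclideanSpace ℝ (Fin n) => (x₀, v)) (𝓝 0) (𝓝 (x₀, 0)) :=
    (Continuous.prodMk_right x₀).tendsto 0
  have hlag : ∀ᶠ v in 𝓝 (0 : EuclideanSpace ℝ (Fin n)), F.lagrangian φ x₀ v < 1 / 2 := by
    have hN := F.isMinkowskiNorm_inChart hF hφ hx₀t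
    have h1 : Continuous fun v => F.lagrangian φ x₀ v := (hN.continuous.pow 2).div_const 2
    refine h1.continuousAt.eventually_lt continuousAt_const ?_
    rw [lagrangian, hN.map_zero]
    norm_num
  have hneg : Tendsto (fun v : EuclideanSpace ℝ (Fin n) => -v) (𝓝 0) (𝓝 0) := by
    simpa using (continuous_neg (G := EuclideanSpace ℝ (Fin n))).tendsto 0
  have hgood := (hc0.eventually hev.eventually_nhds).and hlag
  obtain ⟨v₁, hv₁, hg₁, hg₂⟩ := (hfreq.and_eventually (hgood.and (hneg.eventually hgood))).exists
  obtain ⟨v, hvinc, hgv, hlagv⟩ : ∃ v, h x₀ < h (X (x₀, v)) ∧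
      (∀ᶠ z in 𝓝 (x₀, v), ContinuousAt X z ∧ z.1 ∈ φ.target ∧
        X z ∈ φ.target ∧ X (z.1, 0) = z.1 ∧ HasDerivAt (fun t : ℝ => X (z.1, t • z.2)) z.2 0 ∧
        (z.2 ≠ 0 → F.IsGeodesicOn (φ.symm ∘ fun t : ℝ => X (z.1, t • z.2)) (Icc (-2) 2)) ∧
        ConvexOn ℝ (Icc (-2 : ℝ) 2) (fun t => h (X (z.1, t • z.2)))) ∧
      F.lagrangian φ x₀ v < 1 / 2 := by
    -- If f decreases towards v₁, it increases towards -v₁, because `x₀` is the midpoint of the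
    -- geodesic joining the two ends.
    rcases lt_or_gt_of_ne hv₁ with hlt | hgt
    · refine ⟨-v₁, ?_, hg₂.1, hg₂.2⟩
      have h1 := hg₁.1.self_of_nhds.2.2.2.2.2.2.2
        (show (-1 : ℝ) ∈ Icc (-2 : ℝ) 2 from ⟨by norm_num, by norm_num⟩)
        (show (1 : ℝ) ∈ Icc (-2 : ℝ) 2 from ⟨by norm_num, by norm_num⟩)
        (show (0 : ℝ) ≤ 1 / 2 by norm_num) (show (0 : ℝ) ≤ 1 / 2 by norm_num) (by norm_num)
      have h2 : (1 / 2 : ℝ) * (-1) + (1 / 2 : ℝ) * 1 = 0 := by norm_num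
      simp only [smul_eq_mul, h2, zero_smul, hX00, neg_smul, one_smul] at h1
      linarith
    · exact ⟨v₁, hgt, hg₁.1, hg₁.2⟩
  have hv0 : v ≠ 0 := by
    rintro rfl
    rw [hX00] at hvinc
    exact lt_irrefl _ hvinc
  -- an open set of initial states
  set δ := (h (X (x₀, v)) - h x₀) / 3 with hδ
  have hδ0 : 0 < δ := by rw [hδ]; linarith
  have hhc : ∀ x ∈ φ.target, ContinuousAt h x := fun x hx =>
    hfc.continuousAt.comp (φ.continuousAt_symm hx)
  have hXv := hgv.self_of_nhds
  have hev1 : ∀ᶠ z in 𝓝 (x₀, v), h (X (x₀, v)) - δ < h (X z) :=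
    ((hhc _ hXv.2.2.1).comp hXv.1).eventually (lt_mem_nhds (by simp only [Function.comp_apply]; linarith))
  have hev2 : ∀ᶠ z in 𝓝 (x₀, v), h z.1 ∈ Ioo (h x₀ - δ / 2) (h x₀ + δ / 2) := by
    have h1 : ContinuousAt (fun z : EuclideanSpace ℝ (Fin n) × EuclideanSpace ℝ (Fin n) => h z.1)
        (x₀, v) := ContinuousAt.comp (g := h) (hhc x₀ hx₀t) continuousAt_fst
    exact h1.eventually (Ioo_mem_nhds (by simp only; linarith) (by simp only; linarith))
  have hmem : (x₀, v) ∈ φ.target ×ˢ ({0}ᶜ : Set (EuclideanSpace ℝ (Fin n))) := ⟨hx₀t, hv0⟩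
  have hev3 : ∀ᶠ z in 𝓝 (x₀, v), F.lagrangian φ z.1 z.2 < 1 / 2 :=
    (hL.contDiffAt hmem).continuousAt.eventually_lt continuousAt_const hlagv
  obtain ⟨S, hS, hSo, hSm⟩ := _root_.eventually_nhds_iff.1
    (hgv.and (hev1.and (hev2.and (hev3.and (hL.isOpen_domain.mem_nhds hmem)))))
  have hSsub : S ⊆ hL.legendreHomeo.source := fun z hz => (hS z hz).2.2.2.2
  have hWo : IsOpen (hL.legendreHomeo '' S) :=
    hL.legendreHomeo.isOpen_image_of_subset_source hSo hSsub
  -- the geodesics with these initial states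
  have hΓ : ∀ w ∈ hL.legendreHomeo '' S, ∃ γ : ℝ → M, F.IsGeodesicOn γ (Ici 0) ∧
      γ 0 ∈ φ.source ∧ F.phase φ γ (Ici 0) 0 = w ∧ F.energy φ γ (Ici 0) 0 ≤ 1 / 2 ∧
      f (γ 0) ∈ Ioo (h x₀ - δ / 2) (h x₀ + δ / 2) ∧ f (γ 0) + δ ≤ f (γ 1) := by
    rintro _ ⟨z, hz, rfl⟩
    obtain ⟨⟨-, hz1, hz2, hz3, hz4, hz5, -⟩, hz6, hz7, hz8, hz9⟩ := hS z hz
    have hc0 : X (z.1, (0 : ℝ) • z.2) = z.1 := by rw [zero_smul, hz3]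
    obtain ⟨γ, hγ, heq, hγs, hγ0, hγd⟩ := hcomplete.exists_extension (hz5 hz9.2) hz4
      (by rw [hc0]; exact hz1)
    rw [hc0] at hγ0
    have hf0 : f (γ 0) = h z.1 := by
      rw [hh, Function.comp_apply, ← hγ0, φ.left_inv hγs]
    have hf1 : f (γ 1) = h (X z) := by
      rw [heq ⟨zero_le_one, one_lt_two⟩, hh]
      simp only [Function.comp_apply, one_smul]
    refine ⟨γ, hγ, hγs, ?_, ?_, hf0 ▸ hz7, ?_⟩
    · rw [phase, phaseCurve, hγd, Function.comp_apply, hγ0]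
      rfl
    · rw [energy, hγd, hγ0]
      exact hz8.le
    · rw [hf0, hf1]
      linarith [hz7.2]
  have : Nonempty M := ⟨q⟩
  choose! Γ hΓ1 hΓ2 hΓ3 hΓ4 hΓ5 hΓ6 using hΓ
  refine hfin.ne (volumeMeasure_univ_eq_top_of_wandering hF hμ hφ hWo ⟨_, mem_image_of_mem _ hSm⟩
    hΓ1 hΓ2 hΓ3 hΓ4 fun w hw w' hw' m hm heq => ?_)
  -- A return would place a value of at least f(γ(0)) + δ > h x₀ + δ/2 among the initial values,
  -- which are below h x₀ + δ/2.
  have h1 := hf.le_apply_nat (hΓ1 w hw) hδ0.le (hΓ6 w hw) hm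
  rw [heq] at h1
  linarith [(hΓ5 w hw).1, (hΓ5 w' hw').2]

end FinslerMetric

end

theorem mainTheorem2 {n : ℕ} {M : Type*} [TopologicalSpace M] [T2Space M]
    [SecondCountableTopology M] [ConnectedSpace M] [NoncompactSpace M]
    [ChartedSpace (EuclideanSpace ℝ (Fin n)) M] [IsManifold (𝓡 n) ∞ M]
    [MeasurableSpace M] [BorelSpace M]
    (F : FinslerMetric n M) (hF : F.IsAbsolutelyHomogeneous) (hcomplete : F.IsComplete)
    (V : FinslerVolume n) (μ : MeasureTheory.Measure M) (hμ : V.IsVolumeMeasure F μ)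
    (hfinite : μ Set.univ < ⊤)
    (f : M → ℝ) (hf : F.IsConvex f) :
    ∃ c : ℝ, ∀ x : M, f x = c := by
  obtain ⟨q⟩ := (inferInstance : Nonempty M)
  have hloc : IsLocallyConstant f :=
    IsLocallyConstant.iff_eventually_eq f |>.2 fun x =>
      hf.eventually_eq hF hcomplete hμ hfinite x
  exact ⟨f q, fun x => hloc.apply_eq_of_preconnectedSpace x q⟩
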